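/- An instance of the 2-Disjoint Shortest Paths problem (2-DSP) on weighted DAGs consists of a directed acyclic graph $G$ with $n$ vertices and $m$ edges, a positive integer weight on every edge, and source and target vertices $s_1,t_1,s_2,t_2$. The question is whether there are a shortest $(s_1,t_1)$-path $P_1$ and a shortest $(s_2,t_2)$-path $P_2$ in $G$ that are internally vertex-disjoint, that is, such that no internal vertex of one path lies on the other. Theorem. 2-DSP on weighted DAGs can be decided by a randomized algorithm with high probability in $O(m+n)$ time in the Word-RAM model with words of size $O(\log n)$. In detail: for every $d\in\mathbb N$ there are a randomized Word-RAM program and constants $c\ge 2$ and $C$ such that for every word length $w\ge c(\lfloor\log_2 n\rfloor+1)$ and every instance whose edge weights fit into one word (are less than $2^w$), given as $n$, $m$, the terminals and a list of the weighted edges in arbitrary order, the program always halts within $C(m+n)$ steps. If the two disjoint shortest paths exist, then it answers YES with probability at least $1-n^{-d}$; if they do not exist, then it never answers YES. -/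

import Mathlib

/-! ### Weighted directed acyclic graphs and disjoint shortest paths -/

/-- A weighted directed acyclic graph on the vertex set `Fin n`.  Edge weights are positive
integers; the value of `weight` on pairs that are not edges is irrelevant. -/
structure WeightedDAG (n : ℕ) where
  graph : Digraph (Fin n)
  weight : Fin n → Fin n → ℕ
  weight_pos : ∀ u v, graph.Adj u v → 0 < weight u v
  acyclic : ∀ v, ¬ Relation.TransGen graph.Adj v v

namespace WeightedDAG

variable {n : ℕ}

/-- The set of edges. -/
abbrev Edge (G : WeightedDAG n) : Type := {p : Fin n × Fin n // G.graph.Adj p.1 p.2}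

/-- The vertex sequence `P` is a path from `s` to `t`. -/
structure IsPath (G : WeightedDAG n) (s t : Fin n) (P : List (Fin n)) : Prop where
  head : P.head? = some s
  last : P.getLast? = some t
  chain : P.IsChain G.graph.Adj
  nodup : P.Nodup

/-- The length of a vertex sequence: the sum of the weights of the edges that it traverses. -/
def length (G : WeightedDAG n) : List (Fin n) → ℕ
  | u :: v :: P => G.weight u v + G.length (v :: P)
  | _ => 0

/-- `P` is a shortest path from `s` to `t`. -/
def IsShortestPath (G : WeightedDAG n) (s t : Fin n) (P : List (Fin n)) : Prop :=
  G.IsPath s t P ∧ ∀ Q, G.IsPath s t Q → G.length P ≤ G.length Q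

/-- The internal vertices of a path: all but its first and its last vertex. -/
def internal (P : List (Fin n)) : List (Fin n) := P.tail.dropLast

/-- Two paths are internally vertex-disjoint if no internal vertex of one lies on the other. -/
def InternallyDisjoint (P Q : List (Fin n)) : Prop :=
  (∀ v ∈ internal P, v ∉ Q) ∧ (∀ v ∈ internal Q, v ∉ P)

/-- The two disjoint shortest paths property with sources `s₁, s₂` and targets `t₁, t₂`. -/
def HasTwoDSP (G : WeightedDAG n) (s₁ t₁ s₂ t₂ : Fin n) : Prop :=
  ∃ P₁ P₂, G.IsShortestPath s₁ t₁ P₁ ∧ G.IsShortestPath s₂ t₂ P₂ ∧ InternallyDisjoint P₁ P₂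

end WeightedDAG

/-! ### A randomized word RAM with words of `w` bits

Words are natural numbers below `2 ^ w`.  A program uses finitely many registers and finitely many
arrays of words; arrays are indexed by words. -/

namespace WordRAM

/-- The unit-cost word operations. -/
inductive Op
  | add | sub | mul | div | mod | and | or | xor | shl | shr | lt | eq

/-- The result of a word operation; arithmetic is modulo `2 ^ w`, comparisons return 0 or 1,
and dividing by zero follows the convention of `ℕ`. -/
def Op.apply (w : ℕ) : Op → ℕ → ℕ → ℕ
  | .add, a, b => (a + b) % 2 ^ w
  | .sub, a, b => (a + 2 ^ w - b) % 2 ^ w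
  | .mul, a, b => (a * b) % 2 ^ w
  | .div, a, b => (a / b) % 2 ^ w
  | .mod, a, b => (a % b) % 2 ^ w
  | .and, a, b => (a &&& b) % 2 ^ w
  | .or, a, b => (a ||| b) % 2 ^ w
  | .xor, a, b => (a ^^^ b) % 2 ^ w
  | .shl, a, b => (a * 2 ^ b) % 2 ^ w
  | .shr, a, b => (a / 2 ^ b) % 2 ^ w
  | .lt, a, b => (if a < b then 1 else 0) % 2 ^ w
  | .eq, a, b => (if a = b then 1 else 0) % 2 ^ w

/-- A machine state: registers, arrays, and the number of random words drawn so far. -/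
structure State where
  reg : ℕ → ℕ
  arr : ℕ → ℕ → ℕ
  pos : ℕ

/-- Expressions: constants, registers, array cells, and word operations. -/
inductive Term
  | const (c : ℕ)
  | reg (r : ℕ)
  | get (a : ℕ) (i : Term)
  | op (o : Op) (x y : Term)

/-- The value of an expression. -/
def Term.eval (w : ℕ) (σ : State) : Term → ℕ
  | .const c => c % 2 ^ w
  | .reg r => σ.reg r
  | .get a i => σ.arr a (i.eval w σ)
  | .op o x y => o.apply w (x.eval w σ) (y.eval w σ)

/-- The cost of evaluating an expression: one per constant, register access, array access and
word operation. -/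
def Term.cost : Term → ℕ
  | .const _ => 1
  | .reg _ => 1
  | .get _ i => i.cost + 1
  | .op _ x y => x.cost + y.cost + 1

/-- Programs.  `rand r` draws a uniformly random word into register `r`. -/
inductive Prog
  | assign (r : ℕ) (x : Term)
  | put (a : ℕ) (i x : Term)
  | rand (r : ℕ)
  | seq (p q : Prog)
  | ite (x : Term) (p q : Prog)
  | loop (x : Term) (p : Prog)

/-- `Exec w ω p σ τ k`: with word length `w` and random words `ω 0, ω 1, …`, the program `p`
started in state `σ` halts in state `τ` after exactly `k` steps.  In `ite x p q` the branch `p`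
is taken when `x` is nonzero, and `loop x p` repeats `p` as long as `x` is nonzero. -/
inductive Exec (w : ℕ) (ω : ℕ → ℕ) : Prog → State → State → ℕ → Prop
  | assign (r : ℕ) (x : Term) (σ : State) :
      Exec w ω (.assign r x) σ { σ with reg := Function.update σ.reg r (x.eval w σ) } (x.cost + 1)
  | put (a : ℕ) (i x : Term) (σ : State) :
      Exec w ω (.put a i x) σ
        { σ with
          arr := Function.update σ.arr a
            (Function.update (σ.arr a) (i.eval w σ) (x.eval w σ)) }
        (i.cost + x.cost + 1)
  | rand (r : ℕ) (σ : State) :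
      Exec w ω (.rand r) σ
        { σ with reg := Function.update σ.reg r (ω σ.pos), pos := σ.pos + 1 } 1
  | seq {p q : Prog} {σ τ υ : State} {k l : ℕ} :
      Exec w ω p σ τ k → Exec w ω q τ υ l → Exec w ω (.seq p q) σ υ (k + l)
  | ite_true {x : Term} {p q : Prog} {σ τ : State} {k : ℕ} :
      x.eval w σ ≠ 0 → Exec w ω p σ τ k → Exec w ω (.ite x p q) σ τ (x.cost + 1 + k)
  | ite_false {x : Term} {p q : Prog} {σ τ : State} {k : ℕ} :
      x.eval w σ = 0 → Exec w ω q σ τ k → Exec w ω (.ite x p q) σ τ (x.cost + 1 + k)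
  | loop_done {x : Term} {p : Prog} {σ : State} :
      x.eval w σ = 0 → Exec w ω (.loop x p) σ σ (x.cost + 1)
  | loop_step {x : Term} {p : Prog} {σ τ υ : State} {k l : ℕ} :
      x.eval w σ ≠ 0 → Exec w ω p σ τ k → Exec w ω (.loop x p) τ υ l →
      Exec w ω (.loop x p) σ υ (x.cost + 1 + k + l)

/-- On the random words `ω` the program halts from `σ` after at most `T` steps. -/
def HaltsWithin (w : ℕ) (p : Prog) (σ : State) (T : ℕ) (ω : ℕ → ℕ) : Prop :=
  ∃ τ k, Exec w ω p σ τ k ∧ k ≤ T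

/-- On the random words `ω` the program halts from `σ` with the answer YES, which is
signalled by a nonzero value in register `0`. -/
def Accepts (w : ℕ) (p : Prog) (σ : State) (ω : ℕ → ℕ) : Prop :=
  ∃ τ k, Exec w ω p σ τ k ∧ τ.reg 0 ≠ 0

/-- Finitely many random words, seen as a sequence (padded with zeros). -/
def tape {w R : ℕ} (ω : Fin R → Fin (2 ^ w)) (i : ℕ) : ℕ :=
  if h : i < R then (ω ⟨i, h⟩ : ℕ) else 0

open Classical in
/-- The probability, over `R` independent uniformly random words of `w` bits, that the program
answers YES.  (A program that halts within `R` steps draws at most `R` random words.) -/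
noncomputable def acceptProb (w : ℕ) (p : Prog) (σ : State) (R : ℕ) : ℝ :=
  (Fintype.card {ω : Fin R → Fin (2 ^ w) // Accepts w p σ (tape ω)} : ℝ) /
    (Fintype.card (Fin R → Fin (2 ^ w)) : ℝ)

/-- The input of 2-DSP: `n, m` and the terminals in registers `0` to `5`, and the list of the `m`
edges, in an arbitrary order, in arrays `0` (tails), `1` (heads) and `2` (weights).  All other
registers and cells hold `0`. -/
def input {n m : ℕ} (G : WeightedDAG n) (e : Fin m ≃ G.Edge) (s₁ t₁ s₂ t₂ : Fin n) : State where
  reg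
    | 0 => n
    | 1 => m
    | 2 => s₁
    | 3 => t₁
    | 4 => s₂
    | 5 => t₂
    | _ => 0
  arr a i :=
    if h : i < m then
      match a with
      | 0 => (e ⟨i, h⟩).1.1
      | 1 => (e ⟨i, h⟩).1.2
      | 2 => G.weight (e ⟨i, h⟩).1.1 (e ⟨i, h⟩).1.2
      | _ => 0
    else 0
  pos := 0

end WordRAM

/-! Attach a variable over a field of characteristic two to every edge and weigh a pair of paths by
the product of the variables along both. The total weight of all pairs of shortest paths (P, Q) is a
product of two path sums, each computed in linear time along a topological order. What is wanted is
the weight of the disjoint pairs only.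

If P and Q share c maximal common segments, then c is the number of common vertices minus the number
of common edges. Hence the sum of c times the weight over all pairs is a sum, over vertices and
edges, of products of path sums into and out of the common place; this is `meetSum`, again
computable in linear time. A meeting pair should be counted once but is counted c times, and the
surplus c - 1 counts the gaps between consecutive common segments. In a gap the two paths run
between the same two vertices, and both are shortest there, so their pieces may be exchanged. The
exchange preserves the weight and is an involution without fixed points on pairs with a marked gap,
so the surplus vanishes in characteristic two. Therefore the sum over disjoint pairs is the product
of the path sums plus `meetSum` (`meetSum_pathSum`, `disjointSum_eq_meetSum`). The formal proof is
an induction over the sorted edge list, in which the exchange takes the local form `Commuting`;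
`allCommuting_of_potential` derives it from distances.

Internally disjoint paths may share terminals. Each path therefore receives private copies of its
own terminals as extra labels, edges away from all terminals are shared, and edges at terminals
belong to one path. Fully disjoint paths in the labelled graph correspond to the required paths
(`linked_iff_hasTwoDSP`).

If a disjoint pair exists, the sum over disjoint pairs is a nonzero multilinear polynomial, and a
Schwartz-Zippel argument bounds the probability that it vanishes at random field elements by the
number of variables divided by the field size (`card_disjointSum_eq_zero_mul_le`). If none exists,
the sum is identically zero, so the error is one-sided.

For linear time the field operations must take constant time. Words below 2^(2^j) form a field under
xor and nim multiplication (`exists_isNimField`). A multiplication table for a small field is built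
in linear time, and d + 4 further doublings of the number of bits, a constant number of Karatsuba
steps, lead to a field with at least 2 m n^d elements. The rest is Kahn's algorithm on adjacency
lists and relaxation in topological order, with two-word distances because a sum of weights can
exceed one word. -/

namespace WordRAM

/-! ### Evaluating loop-free programs -/

/-- Programs without loops. -/
def Prog.straight : Prog → Bool
  | .assign _ _ => true
  | .put _ _ _ => true
  | .rand _ => true
  | .seq p q => p.straight && q.straight
  | .ite _ p q => p.straight && q.straight
  | .loop _ _ => false

/-- A bound on the cost of a loop-free program. -/
def Prog.maxCost : Prog → ℕ
  | .assign _ x => x.cost + 1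
  | .put _ i x => i.cost + x.cost + 1
  | .rand _ => 1
  | .seq p q => p.maxCost + q.maxCost
  | .ite x p q => x.cost + 1 + max p.maxCost q.maxCost
  | .loop _ _ => 0

/-- Assigning a value to a register. -/
def State.setReg (σ : State) (r v : ℕ) : State :=
  { σ with reg := Function.update σ.reg r v }

/-- Assigning a value to an array cell. -/
def State.setArr (σ : State) (a i v : ℕ) : State :=
  { σ with arr := Function.update σ.arr a (Function.update (σ.arr a) i v) }

@[simp] theorem State.setReg_reg (σ : State) (r v r' : ℕ) :
    (σ.setReg r v).reg r' = if r' = r then v else σ.reg r' := by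
  simp [setReg, Function.update_apply]

@[simp] theorem State.setReg_arr (σ : State) (r v : ℕ) : (σ.setReg r v).arr = σ.arr := rfl

@[simp] theorem State.setReg_pos (σ : State) (r v : ℕ) : (σ.setReg r v).pos = σ.pos := rfl

@[simp] theorem State.setArr_reg (σ : State) (a i v : ℕ) : (σ.setArr a i v).reg = σ.reg := rfl

@[simp] theorem State.setArr_arr (σ : State) (a i v a' i' : ℕ) :
    (σ.setArr a i v).arr a' i' = if a' = a ∧ i' = i then v else σ.arr a' i' := by
  by_cases h : a' = a
  · subst h; simp [setArr, Function.update_apply]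
  · simp [setArr, h]

@[simp] theorem State.setArr_pos (σ : State) (a i v : ℕ) : (σ.setArr a i v).pos = σ.pos := rfl

/-- The final state of a loop-free program. -/
def sem (w : ℕ) (ω : ℕ → ℕ) : Prog → State → State
  | .assign r x, σ => σ.setReg r (x.eval w σ)
  | .put a i x, σ => σ.setArr a (i.eval w σ) (x.eval w σ)
  | .rand r, σ => { σ with reg := Function.update σ.reg r (ω σ.pos), pos := σ.pos + 1 }
  | .seq p q, σ => sem w ω q (sem w ω p σ)
  | .ite x p q, σ => if x.eval w σ ≠ 0 then sem w ω p σ else sem w ω q σ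
  | .loop _ _, σ => σ

theorem exec_sem (w : ℕ) (ω : ℕ → ℕ) (p : Prog) (hp : p.straight = true) (σ : State) :
    ∃ k ≤ p.maxCost, Exec w ω p σ (sem w ω p σ) k := by
  induction p generalizing σ with
  | assign r x => exact ⟨_, le_rfl, .assign r x σ⟩
  | put a i x => exact ⟨_, le_rfl, .put a i x σ⟩
  | rand r => exact ⟨_, le_rfl, .rand r σ⟩
  | seq p q ihp ihq =>
    simp only [Prog.straight, Bool.and_eq_true] at hp
    obtain ⟨k, hk, h⟩ := ihp hp.1 σ
    obtain ⟨l, hl, h'⟩ := ihq hp.2 (sem w ω p σ)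
    exact ⟨k + l, Nat.add_le_add hk hl, .seq h h'⟩
  | ite x p q ihp ihq =>
    simp only [Prog.straight, Bool.and_eq_true] at hp
    by_cases hx : x.eval w σ = 0
    · obtain ⟨k, hk, h⟩ := ihq hp.2 σ
      refine ⟨x.cost + 1 + k, ?_, ?_⟩
      · simp only [Prog.maxCost]
        have := le_max_right p.maxCost q.maxCost
        omega
      · simp only [sem, hx, ne_eq, not_true_eq_false, if_false]
        exact .ite_false hx h
    · obtain ⟨k, hk, h⟩ := ihp hp.1 σ
      refine ⟨x.cost + 1 + k, ?_, ?_⟩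
      · simp only [Prog.maxCost]
        have := le_max_left p.maxCost q.maxCost
        omega
      · simp only [sem, hx, ne_eq, not_false_eq_true, if_true]
        exact .ite_true hx h
  | loop x p => simp [Prog.straight] at hp

/-- Acceptance quantifies existentially over executions; determinism lets a single exhibited run
decide it. -/
theorem Exec.deterministic {w : ℕ} {ω : ℕ → ℕ} {p : Prog} {σ τ τ' : State} {k k' : ℕ}
    (h : Exec w ω p σ τ k) (h' : Exec w ω p σ τ' k') : τ = τ' := by
  induction h generalizing τ' k' with
  | assign r x σ => cases h'; rfl
  | put a i x σ => cases h'; rfl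
  | rand r σ => cases h'; rfl
  | seq _ _ ihp ihq =>
    cases h' with
    | seq h₁ h₂ => obtain rfl := ihp h₁; exact ihq h₂
  | ite_true hx _ ih =>
    cases h' with
    | ite_true _ h => exact ih h
    | ite_false hx' _ => exact absurd hx' hx
  | ite_false hx _ ih =>
    cases h' with
    | ite_true hx' _ => exact absurd hx hx'
    | ite_false _ h => exact ih h
  | loop_done hx =>
    cases h' with
    | loop_done _ => rfl
    | loop_step hx' _ _ => exact absurd hx hx'
  | loop_step hx _ _ ihp ihl =>
    cases h' with
    | loop_done hx' => exact absurd hx' hx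
    | loop_step _ h₁ h₂ => obtain rfl := ihp h₁; exact ihl h₂

/-! ### What a program leaves unchanged -/

/-- Whether a program assigns to register `r`. -/
def Prog.wreg (r : ℕ) : Prog → Bool
  | .assign r' _ => r == r'
  | .put _ _ _ => false
  | .rand r' => r == r'
  | .seq p q => p.wreg r || q.wreg r
  | .ite _ p q => p.wreg r || q.wreg r
  | .loop _ p => p.wreg r

/-- Whether a program writes to array `a`. -/
def Prog.warr (a : ℕ) : Prog → Bool
  | .assign _ _ => false
  | .put a' _ _ => a == a'
  | .rand _ => false
  | .seq p q => p.warr a || q.warr a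
  | .ite _ p q => p.warr a || q.warr a
  | .loop _ p => p.warr a

/-- Whether a program draws random words. -/
def Prog.draws : Prog → Bool
  | .assign _ _ => false
  | .put _ _ _ => false
  | .rand _ => true
  | .seq p q => p.draws || q.draws
  | .ite _ p q => p.draws || q.draws
  | .loop _ p => p.draws

/-- The states agree on everything that the program does not write to. -/
structure Frame (p : Prog) (σ τ : State) : Prop where
  reg : ∀ r, p.wreg r = false → τ.reg r = σ.reg r
  arr : ∀ a, p.warr a = false → τ.arr a = σ.arr a
  pos : p.draws = false → τ.pos = σ.pos

theorem Frame.refl (p : Prog) (σ : State) : Frame p σ σ :=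
  ⟨fun _ _ => rfl, fun _ _ => rfl, fun _ => rfl⟩

theorem Frame.trans {p : Prog} {σ τ υ : State} (h : Frame p σ τ) (h' : Frame p τ υ) :
    Frame p σ υ :=
  ⟨fun r hr => (h'.reg r hr).trans (h.reg r hr), fun a ha => (h'.arr a ha).trans (h.arr a ha),
    fun hp => (h'.pos hp).trans (h.pos hp)⟩

theorem Frame.mono {p q : Prog} {σ τ : State} (h : Frame p σ τ)
    (hr : ∀ r, q.wreg r = false → p.wreg r = false)
    (ha : ∀ a, q.warr a = false → p.warr a = false) (hd : q.draws = false → p.draws = false) :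
    Frame q σ τ :=
  ⟨fun r h' => h.reg r (hr r h'), fun a h' => h.arr a (ha a h'), fun h' => h.pos (hd h')⟩

theorem Frame.seq_left {p q : Prog} {σ τ : State} (h : Frame p σ τ) : Frame (.seq p q) σ τ :=
  h.mono (by simp +contextual [Prog.wreg]) (by simp +contextual [Prog.warr])
    (by simp +contextual [Prog.draws])

theorem Frame.seq_right {p q : Prog} {σ τ : State} (h : Frame q σ τ) : Frame (.seq p q) σ τ :=
  h.mono (by simp +contextual [Prog.wreg]) (by simp +contextual [Prog.warr])
    (by simp +contextual [Prog.draws])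

/-- The footprint of a program is a computable Boolean, so later side conditions of the form "this
phase leaves that array alone" are closed by `rfl`. -/
theorem Exec.frame {w : ℕ} {ω : ℕ → ℕ} {p : Prog} {σ τ : State} {k : ℕ}
    (h : Exec w ω p σ τ k) : Frame p σ τ := by
  induction h with
  | assign r x σ =>
    refine ⟨fun r' hr => ?_, fun _ _ => rfl, fun _ => rfl⟩
    simp only [Prog.wreg, beq_eq_false_iff_ne] at hr
    simp [hr]
  | put a i x σ =>
    refine ⟨fun _ _ => rfl, fun a' ha => ?_, fun _ => rfl⟩
    simp only [Prog.warr, beq_eq_false_iff_ne] at ha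
    simp [ha]
  | rand r σ =>
    refine ⟨fun r' hr => ?_, fun _ _ => rfl, fun h => by simp [Prog.draws] at h⟩
    simp only [Prog.wreg, beq_eq_false_iff_ne] at hr
    simp [hr]
  | seq _ _ ihp ihq => exact ihp.seq_left.trans ihq.seq_right
  | ite_true _ _ ih =>
    exact ih.mono (by simp +contextual [Prog.wreg]) (by simp +contextual [Prog.warr])
      (by simp +contextual [Prog.draws])
  | ite_false _ _ ih =>
    exact ih.mono (by simp +contextual [Prog.wreg]) (by simp +contextual [Prog.warr])
      (by simp +contextual [Prog.draws])
  | loop_done _ => exact Frame.refl _ _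
  | loop_step _ _ _ ihp ihl =>
    refine Frame.trans (ihp.mono ?_ ?_ ?_) ihl <;> simp [Prog.wreg, Prog.warr, Prog.draws]

/-- Used to run the deterministic preparation once, on the zero tape, and to transport that run to
every tape. The data it computes are then visibly independent of the random words. -/
theorem Exec.congr_tape {w : ℕ} {ω : ℕ → ℕ} {p : Prog} {σ τ : State} {k : ℕ}
    (h : Exec w ω p σ τ k) (hp : p.draws = false) (ω' : ℕ → ℕ) : Exec w ω' p σ τ k := by
  induction h with
  | assign r x σ => exact .assign r x σ
  | put a i x σ => exact .put a i x σ
  | rand r σ => simp [Prog.draws] at hp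
  | seq _ _ ihp ihq =>
    simp only [Prog.draws, Bool.or_eq_false_iff] at hp
    exact .seq (ihp hp.1) (ihq hp.2)
  | ite_true hx _ ih =>
    simp only [Prog.draws, Bool.or_eq_false_iff] at hp
    exact .ite_true hx (ih hp.1)
  | ite_false hx _ ih =>
    simp only [Prog.draws, Bool.or_eq_false_iff] at hp
    exact .ite_false hx (ih hp.2)
  | loop_done hx => exact .loop_done hx
  | loop_step hx _ _ ihp ihl => exact .loop_step hx (ihp hp) (ihl hp)

/-! ### Total correctness with time bounds -/

/-- The program halts from `σ` within `T` steps in a state that satisfies `Q`. -/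
def Runs (w : ℕ) (ω : ℕ → ℕ) (p : Prog) (σ : State) (T : ℕ) (Q : State → Prop) : Prop :=
  ∃ τ k, Exec w ω p σ τ k ∧ k ≤ T ∧ Q τ

variable {w : ℕ} {ω : ℕ → ℕ}

theorem Runs.mono {p : Prog} {σ : State} {T T' : ℕ} {Q Q' : State → Prop}
    (h : Runs w ω p σ T Q) (hT : T ≤ T') (hQ : ∀ τ, Q τ → Q' τ) : Runs w ω p σ T' Q' := by
  obtain ⟨τ, k, h, hk, hq⟩ := h
  exact ⟨τ, k, h, hk.trans hT, hQ τ hq⟩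

theorem Runs.frame {p : Prog} {σ : State} {T : ℕ} {Q : State → Prop}
    (h : Runs w ω p σ T Q) : Runs w ω p σ T (fun τ => Frame p σ τ ∧ Q τ) := by
  obtain ⟨τ, k, h, hk, hq⟩ := h
  exact ⟨τ, k, h, hk, h.frame, hq⟩

theorem Runs.seq {p q : Prog} {σ : State} {T T' : ℕ} {Q Q' : State → Prop}
    (h : Runs w ω p σ T Q) (h' : ∀ τ, Q τ → Runs w ω q τ T' Q') :
    Runs w ω (.seq p q) σ (T + T') Q' := by
  obtain ⟨τ, k, h, hk, hq⟩ := h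
  obtain ⟨υ, l, h', hl, hq'⟩ := h' τ hq
  exact ⟨υ, k + l, .seq h h', Nat.add_le_add hk hl, hq'⟩

theorem runs_sem {p : Prog} (hp : p.straight = true) {σ : State} {Q : State → Prop}
    (h : Q (sem w ω p σ)) : Runs w ω p σ p.maxCost Q := by
  obtain ⟨k, hk, h'⟩ := exec_sem w ω p hp σ
  exact ⟨_, k, h', hk, h⟩

theorem Runs.assign (r : ℕ) (x : Term) (σ : State) :
    Runs w ω (.assign r x) σ (x.cost + 1) (fun τ => τ = σ.setReg r (x.eval w σ)) :=
  ⟨_, _, .assign r x σ, le_rfl, rfl⟩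

theorem Runs.put (a : ℕ) (i x : Term) (σ : State) :
    Runs w ω (.put a i x) σ (i.cost + x.cost + 1)
      (fun τ => τ = σ.setArr a (i.eval w σ) (x.eval w σ)) :=
  ⟨_, _, .put a i x σ, le_rfl, rfl⟩

/-- The rule for loops, with a potential that pays for the running time. -/
theorem Runs.loop {x : Term} {p : Prog} (I : State → Prop) (Φ : State → ℕ)
    (step : ∀ σ, I σ → x.eval w σ ≠ 0 →
      ∃ T, Runs w ω p σ T (fun τ => I τ ∧ x.cost + 1 + T + Φ τ ≤ Φ σ))
    {σ : State} (h : I σ) :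
    Runs w ω (.loop x p) σ (Φ σ + x.cost + 1) (fun τ => I τ ∧ x.eval w τ = 0) := by
  -- The potential drops by at least the cost of the guard, which is positive, so strong induction
  -- on its value proves termination and the time bound together.
  induction hN : Φ σ using Nat.strong_induction_on generalizing σ with
  | _ N ih =>
    by_cases hx : x.eval w σ = 0
    · exact ⟨σ, _, .loop_done hx, by omega, h, hx⟩
    · obtain ⟨T, τ, k, hk, hkT, hI, hΦ⟩ := step σ h hx
      obtain ⟨υ, l, hl, hlT, hυ⟩ := ih (Φ τ) (by omega) hI rfl
      exact ⟨υ, _, .loop_step hx hk hl, by omega, hυ⟩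

/-- Running `p` for `r = 0, 1, …` up to the value of register `b`, exclusive. -/
def forUp (r b : ℕ) (p : Prog) : Prog :=
  .seq (.assign r (.const 0))
    (.loop (.op .lt (.reg r) (.reg b)) (.seq p (.assign r (.op .add (.reg r) (.const 1)))))

/-- An iteration costs the body plus 8: four steps for the guard and four for the increment. The
initial assignment and the final test take six steps and fit into the extra unit of `M + 1`. -/
theorem Runs.forUp {r b : ℕ} {p : Prog} (hp : p.straight = true) (hr : p.wreg r = false)
    (hb : p.wreg b = false) (hrb : (b == r) = false) {σ : State} {M : ℕ} (hM : σ.reg b = M)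
    (hMw : M < 2 ^ w) (I : ℕ → State → Prop) (init : I 0 (σ.setReg r 0))
    (step : ∀ i < M, ∀ τ, Frame (WordRAM.forUp r b p) σ τ → τ.reg r = i → I i τ →
      I (i + 1) ((sem w ω p τ).setReg r (i + 1))) :
    Runs w ω (WordRAM.forUp r b p) σ ((M + 1) * (p.maxCost + 8)) (I M) := by
  have hrb' : b ≠ r := by simpa using hrb
  -- The constant 1 evaluates to 1 only when words are nontrivial; for `w = 0` the loop is empty.
  have h2 : 1 < 2 ^ w ∨ M = 0 := by omega
  let I' : State → Prop := fun τ =>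
    Frame (WordRAM.forUp r b p) σ τ ∧ τ.reg r ≤ M ∧ I (τ.reg r) τ
  have bM : ∀ τ, Frame (WordRAM.forUp r b p) σ τ → τ.reg b = M := by
    intro τ hτ
    rw [hτ.reg b ?_, hM]
    simp [WordRAM.forUp, Prog.wreg, hb, hrb']
  have key := Runs.loop (w := w) (ω := ω) (x := .op .lt (.reg r) (.reg b))
    (p := .seq p (.assign r (.op .add (.reg r) (.const 1)))) I'
    (fun τ => (M - τ.reg r) * (p.maxCost + 8)) ?_ (σ := σ.setReg r 0) ?_
  · have h1 : Runs w ω (.assign r (.const 0)) σ 2 (fun τ => τ = σ.setReg r 0) := by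
      refine (runs_sem rfl ?_).mono (le_refl _) (fun _ h => h)
      simp [sem, Term.eval]
    refine (h1.seq (T' := M * (p.maxCost + 8) + 4) (Q' := I M) ?_).mono ?_ (fun _ h => h)
    · rintro τ rfl
      refine key.mono ?_ ?_
      · simp [State.setReg, Term.cost]
      · rintro τ ⟨⟨hF, hle, hI⟩, hx⟩
        have : τ.reg r = M := by
          by_contra hne
          have hlt : τ.reg r < M := by omega
          have h2 : 1 < 2 ^ w := by omega
          simp [Term.eval, Op.apply, bM τ hF, hlt, Nat.mod_eq_of_lt h2] at hx
        rwa [this] at hI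
    · rw [add_mul]; omega
  · rintro τ ⟨hF, hle, hI⟩ hx
    have hlt : τ.reg r < M := by
      by_contra hne
      simp [Term.eval, Op.apply, bM τ hF, hne] at hx
    have h2 : 1 < 2 ^ w := by omega
    refine ⟨p.maxCost + 4, ?_⟩
    obtain ⟨k, hk, he⟩ := exec_sem w ω p hp τ
    have hF2 := he.frame
    have hr' : (sem w ω p τ).reg r = τ.reg r := hF2.reg r hr
    have hev : (Term.op .add (.reg r) (.const 1)).eval w (sem w ω p τ) = τ.reg r + 1 := by
      simp only [Term.eval, Op.apply, hr', Nat.mod_eq_of_lt h2]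
      exact Nat.mod_eq_of_lt (by omega)
    have he2 := Exec.assign (w := w) (ω := ω) r (.op .add (.reg r) (.const 1)) (sem w ω p τ)
    rw [hev] at he2
    have he3 := Exec.seq he he2
    refine ⟨_, _, he3, by simp [Term.cost]; omega, ⟨?_, ?_, ?_⟩, ?_⟩
    · refine hF.trans (he3.frame.mono ?_ ?_ ?_) <;>
        simp +contextual [WordRAM.forUp, Prog.wreg, Prog.warr, Prog.draws]
    · simp; omega
    · simpa [State.setReg] using step _ hlt τ hF rfl hI
    · simp only [Function.update_self, Term.cost]
      obtain ⟨c, hc⟩ : ∃ c, M = τ.reg r + 1 + c := ⟨M - (τ.reg r + 1), by omega⟩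
      rw [hc, show τ.reg r + 1 + c - (τ.reg r + 1) = c by omega,
        show τ.reg r + 1 + c - τ.reg r = c + 1 by omega, add_mul]
      omega
  · refine ⟨⟨fun r' h => ?_, fun _ _ => rfl, fun _ => rfl⟩, by simp [State.setReg], ?_⟩
    · have : r' ≠ r := by
        rintro rfl; simp [WordRAM.forUp, Prog.wreg] at h
      simp [State.setReg, this]
    · simpa [State.setReg] using init

end WordRAM

/-! ### Nim multiplication: binary fields on natural numbers -/

/-- The product of the nimbers `x` and `y` below `2 ^ 2 ^ i`. -/
def nimMul : ℕ → ℕ → ℕ → ℕ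
  | 0, x, y => x * y
  | i + 1, x, y =>
    let p := nimMul i (x / 2 ^ 2 ^ i) (y / 2 ^ 2 ^ i)
    let q := nimMul i (x % 2 ^ 2 ^ i) (y % 2 ^ 2 ^ i)
    let r := nimMul i (x / 2 ^ 2 ^ i ^^^ x % 2 ^ 2 ^ i) (y / 2 ^ 2 ^ i ^^^ y % 2 ^ 2 ^ i)
    (r ^^^ q) * 2 ^ 2 ^ i + (q ^^^ nimMul i (2 ^ (2 ^ i - 1)) p)

/-- `φ` interprets the numbers below `2 ^ 2 ^ i` as elements of a field of characteristic two
such that addition is `xor` and multiplication is nim multiplication. -/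
structure IsNimField (i : ℕ) (K : Type) [Field K] (φ : ℕ → K) : Prop where
  two : (1 + 1 : K) = 0
  inj : ∀ x < 2 ^ 2 ^ i, ∀ y < 2 ^ 2 ^ i, φ x = φ y → x = y
  zero : φ 0 = 0
  one : φ 1 = 1
  xor : ∀ x < 2 ^ 2 ^ i, ∀ y < 2 ^ 2 ^ i, φ (x ^^^ y) = φ x + φ y
  mul : ∀ x < 2 ^ 2 ^ i, ∀ y < 2 ^ 2 ^ i, φ (nimMul i x y) = φ x * φ y
  mul_lt : ∀ x < 2 ^ 2 ^ i, ∀ y < 2 ^ 2 ^ i, nimMul i x y < 2 ^ 2 ^ i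
  irreducible : ∀ r : K, r ^ 2 ≠ φ (2 ^ (2 ^ i - 1)) + 1 * r

/-- A tower of quadratic extensions: each level adjoins a root X of X² = X + a, where a is the top
power of two of the level below, and a number is read as (high half) X + (low half). The
irreducibility of this polynomial is carried through the induction, since it is what makes the next
level a field. -/
theorem exists_isNimField (i : ℕ) : ∃ (K : Type) (_ : Field K) (φ : ℕ → K), IsNimField i K φ := by
  induction i with
  | zero =>
    refine ⟨ZMod 2, inferInstance, fun x => x, by decide, ?_, by simp, by simp, ?_, ?_, ?_, ?_⟩
    · intro x hx y hy h
      simp only [pow_zero, pow_one] at hx hy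
      interval_cases x <;> interval_cases y <;> simp_all
    · intro x hx y hy
      simp only [pow_zero, pow_one] at hx hy
      interval_cases x <;> interval_cases y <;> simp <;> decide
    · intro x _ y _
      simp [nimMul]
    · intro x hx y hy
      simp only [pow_zero, pow_one] at hx hy
      interval_cases x <;> interval_cases y <;> simp [nimMul]
    · simp only [pow_zero, Nat.sub_self, Nat.cast_one]
      decide
  | succ i ih =>
    obtain ⟨K, _, φ, h⟩ := ih
    set S := 2 ^ 2 ^ i with hS
    set a := 2 ^ (2 ^ i - 1) with ha
    have hSa : a < S := Nat.pow_lt_pow_right (by norm_num) (by have := Nat.two_pow_pos i; omega)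
    have hS0 : 0 < S := by positivity
    have hS2 : 2 ^ 2 ^ (i + 1) = S * S := by rw [hS, ← pow_add, pow_succ]; congr 1; ring
    have hS1 : 1 < S := Nat.one_lt_two_pow (by positivity)
    have two' : ∀ x : K, x + x = 0 := fun x => by
      have := congrArg (x * ·) h.two
      simpa [mul_add] using this
    have : Fact (∀ r : K, r ^ 2 ≠ φ a + 1 * r) := ⟨h.irreducible⟩
    have hdiv : ∀ x < S * S, x / S < S := fun x hx => Nat.div_lt_of_lt_mul hx
    have hmod : ∀ x, x % S < S := fun x => Nat.mod_lt _ hS0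
    have hxor : ∀ x < S, ∀ y < S, x ^^^ y < S := fun x hx y hy => Nat.xor_lt_two_pow hx hy
    have hlow : ∀ u < S, ∀ v < S, (u * S + v) / S = u ∧ (u * S + v) % S = v := fun u _ v hv => by
      rw [mul_comm, Nat.mul_add_div hS0, Nat.mul_add_mod, Nat.div_eq_of_lt hv, Nat.mod_eq_of_lt hv]
      simp
    -- Karatsuba with X² = X + a: the X-coefficient x₁y₁ + x₁y₀ + x₀y₁ is (x₁ + x₀)(y₁ + y₀) + x₀y₀
    -- in characteristic two, and the constant coefficient is x₀y₀ + a x₁y₁.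
    have parts : ∀ x < S * S, ∀ y < S * S, ∃ u < S, ∃ v < S, nimMul (i + 1) x y = u * S + v ∧
        φ u = φ (x / S) * φ (y / S) + φ (x / S) * φ (y % S) + φ (x % S) * φ (y / S) ∧
        φ v = φ (x % S) * φ (y % S) + φ a * (φ (x / S) * φ (y / S)) := by
      intro x hx y hy
      have hp := h.mul_lt _ (hdiv x hx) _ (hdiv y hy)
      have hq := h.mul_lt _ (hmod x) _ (hmod y)
      have hr := h.mul_lt _ (hxor _ (hdiv x hx) _ (hmod x)) _ (hxor _ (hdiv y hy) _ (hmod y))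
      have hs := h.mul_lt _ hSa _ hp
      refine ⟨_, hxor _ hr _ hq, _, hxor _ hq _ hs, rfl, ?_, ?_⟩
      · rw [h.xor _ hr _ hq, h.mul _ (hxor _ (hdiv x hx) _ (hmod x)) _ (hxor _ (hdiv y hy) _ (hmod y)),
          h.mul _ (hmod x) _ (hmod y), h.xor _ (hdiv x hx) _ (hmod x),
          h.xor _ (hdiv y hy) _ (hmod y)]
        linear_combination two' (φ (x % S) * φ (y % S))
      · rw [h.xor _ hq _ hs, h.mul _ hSa _ hp, h.mul _ (hdiv x hx) _ (hdiv y hy),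
          h.mul _ (hmod x) _ (hmod y)]
    refine ⟨QuadraticAlgebra K (φ a) 1, inferInstance, fun x => ⟨φ (x % S), φ (x / S)⟩,
      ?_, ?_, ?_, ?_, ?_, ?_, ?_, ?_⟩
    · ext <;> simp [QuadraticAlgebra.re_one, QuadraticAlgebra.im_one, h.two]
    · intro x hx y hy hxy
      rw [hS2] at hx hy
      simp only [QuadraticAlgebra.mk.injEq] at hxy
      have h1 := h.inj _ (hmod x) _ (hmod y) hxy.1
      have h2 := h.inj _ (hdiv x hx) _ (hdiv y hy) hxy.2
      rw [← Nat.div_add_mod x S, ← Nat.div_add_mod y S, h1, h2]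
    · ext <;> simp [h.zero]
    · ext <;> simp [QuadraticAlgebra.re_one, QuadraticAlgebra.im_one, h.zero, h.one,
        Nat.mod_eq_of_lt hS1, Nat.div_eq_of_lt hS1]
    · intro x hx y hy
      rw [hS2] at hx hy
      have e1 : (x ^^^ y) % S = x % S ^^^ y % S := Nat.xor_mod_two_pow
      have e2 : (x ^^^ y) / S = x / S ^^^ y / S := Nat.xor_div_two_pow
      rw [e1, e2, h.xor _ (hmod x) _ (hmod y), h.xor _ (hdiv x hx) _ (hdiv y hy)]
      rfl
    · intro x hx y hy
      rw [hS2] at hx hy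
      obtain ⟨u, hu, v, hv, e, hu', hv'⟩ := parts x hx y hy
      obtain ⟨e1, e2⟩ := hlow u hu v hv
      rw [e, e1, e2, hu', hv']
      ext
      · simp; ring
      · simp; ring
    · intro x hx y hy
      rw [hS2] at hx hy ⊢
      obtain ⟨u, hu, v, hv, e, -, -⟩ := parts x hx y hy
      rw [e]
      nlinarith
    · intro r hr
      have e3 : 2 ^ (2 ^ (i + 1) - 1) = a * S := by
        rw [ha, hS, ← pow_add]
        congr 1
        have := Nat.two_pow_pos i
        rw [pow_succ]; omega
      rw [e3, Nat.mul_mod_left, Nat.mul_div_cancel _ hS0, h.zero] at hr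
      -- The new constant is a X, with a the old constant. For a root of the new equation the
      -- coefficients of X say that its X-coefficient is a root of the old equation, because the
      -- cross term occurs twice and cancels.
      have him := congrArg QuadraticAlgebra.im hr
      simp only [pow_two, QuadraticAlgebra.im_mul, QuadraticAlgebra.im_add, one_mul] at him
      refine h.irreducible r.im ?_
      linear_combination him - two' (r.re * r.im)

/-- Nim multiplication does not depend on the level. -/
theorem nimMul_succ (i : ℕ) {x y : ℕ} (hx : x < 2 ^ 2 ^ i) (hy : y < 2 ^ 2 ^ i) :
    nimMul (i + 1) x y = nimMul i x y := by
  obtain ⟨K, _, φ, h⟩ := exists_isNimField i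
  have h0 : (0 : ℕ) < 2 ^ 2 ^ i := by positivity
  -- Absorption by zero is read off from the field through injectivity, without unfolding the
  -- recursion.
  have hz : ∀ z < 2 ^ 2 ^ i, nimMul i z 0 = 0 := fun z hz =>
    h.inj _ (h.mul_lt _ hz _ h0) _ h0 (by rw [h.mul _ hz _ h0, h.zero, mul_zero])
  have ha : 2 ^ (2 ^ i - 1) < 2 ^ 2 ^ i :=
    Nat.pow_lt_pow_right (by norm_num) (by have := Nat.two_pow_pos i; omega)
  simp [nimMul, Nat.div_eq_of_lt hx, Nat.div_eq_of_lt hy, Nat.mod_eq_of_lt hx, Nat.mod_eq_of_lt hy,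
    hz 0 h0, hz _ ha]

theorem nimMul_lt (i : ℕ) {x y : ℕ} (hx : x < 2 ^ 2 ^ i) (hy : y < 2 ^ 2 ^ i) :
    nimMul i x y < 2 ^ 2 ^ i := by
  obtain ⟨K, _, φ, h⟩ := exists_isNimField i
  exact h.mul_lt x hx y hy

/-! ### Path sums over a sorted list of edges -/

/-- An edge with a length, available to path `i` if `flag i` holds. -/
structure FlagEdge where
  tail : ℕ
  head : ℕ
  len : ℕ
  flag : Bool → Bool

namespace FlagEdge

variable {K : Type} [Field K]

/-- The coefficient of an edge with the variable `x` in the path sums of path `i`. -/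
def coef (i : Bool) (e : FlagEdge × K) : K := if e.1.flag i then e.2 else 0

/-- The sum over all paths for `i` from `a` to `b`, of the product of the variables. -/
def pathSum (i : Bool) : List (FlagEdge × K) → ℕ → ℕ → K
  | [], a, b => if a = b then 1 else 0
  | e :: l, a, b =>
    pathSum i l a b + if a = e.1.tail then coef i e * pathSum i l e.1.head b else 0

/-- The sum over all pairs of disjoint paths that start in `a` and `b` and end in `t i`. -/
def disjointSum (t : Bool → ℕ) : List (FlagEdge × K) → ℕ → ℕ → K
  | [], a, b => if a = b then 0 else if a = t false ∧ b = t true then 1 else 0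
  | e :: l, a, b =>
    if a = b then 0 else
      disjointSum t l a b +
        (if a = e.1.tail then coef false e * disjointSum t l e.1.head b else 0) +
        (if b = e.1.tail then coef true e * disjointSum t l a e.1.head else 0)

/-- The edges are sorted topologically. -/
def Sorted : List (FlagEdge × K) → Prop
  | [] => True
  | e :: l => e.1.head ≠ e.1.tail ∧ (∀ f ∈ l, f.1.head ≠ e.1.tail) ∧ Sorted l

/-- The edges available to both paths contribute to this sum over vertices and edges the number
of vertices minus the number of edges in which two paths intersect. -/
def meetSum (S : Finset ℕ) (r : Bool → ℕ → K) (l : List (FlagEdge × K)) (p q : ℕ → K) : K :=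
  ∑ v ∈ S, p v * q v * (r false v * r true v) +
    (l.map fun e => p e.1.tail * q e.1.tail *
      (coef false e * coef true e * (r false e.1.head * r true e.1.head))).sum

theorem pathSum_of_not_head (i : Bool) {l : List (FlagEdge × K)} {u : ℕ}
    (h : ∀ f ∈ l, f.1.head ≠ u) (a : ℕ) : pathSum i l a u = if a = u then 1 else 0 := by
  induction l generalizing a with
  | nil => rfl
  | cons e l ih =>
    have h1 := h e (by simp)
    have h2 : ∀ f ∈ l, f.1.head ≠ u := fun f hf => h f (by simp [hf])
    simp [pathSum, ih h2, h1]

theorem disjointSum_self (t : Bool → ℕ) (l : List (FlagEdge × K)) (a : ℕ) :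
    disjointSum t l a a = 0 := by
  cases l <;> simp [disjointSum]

/-- The paths that the two flags allow between two vertices coincide up to a factor. -/
def Commuting (e : FlagEdge × K) (l : List (FlagEdge × K)) : Prop :=
  ∀ w, coef true e * (pathSum false l e.1.tail w * pathSum true l e.1.head w) =
    coef false e * (pathSum false l e.1.head w * pathSum true l e.1.tail w)

/-- `Commuting` for every edge and the edges after it. -/
def AllCommuting : List (FlagEdge × K) → Prop
  | [] => True
  | e :: l => Commuting e l ∧ AllCommuting l

theorem meetSum_add_left (S : Finset ℕ) (r : Bool → ℕ → K) (l : List (FlagEdge × K))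
    (p p' q : ℕ → K) (c : K) :
    meetSum S r l (fun v => p v + c * p' v) q = meetSum S r l p q + c * meetSum S r l p' q := by
  simp only [meetSum, mul_add, Finset.mul_sum, ← List.sum_map_mul_left]
  rw [add_add_add_comm, ← Finset.sum_add_distrib, ← List.sum_map_add]
  congr 2
  · ext v; ring
  · congr 1; ext e; ring

theorem meetSum_comm (S : Finset ℕ) (r : Bool → ℕ → K) (l : List (FlagEdge × K))
    (p q : ℕ → K) : meetSum S r l p q = meetSum S r l q p := by
  simp only [meetSum, mul_comm (p _)]

theorem meetSum_add_right (S : Finset ℕ) (r : Bool → ℕ → K) (l : List (FlagEdge × K))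
    (p q q' : ℕ → K) (c : K) :
    meetSum S r l p (fun v => q v + c * q' v) = meetSum S r l p q + c * meetSum S r l p q' := by
  rw [meetSum_comm, meetSum_add_left, meetSum_comm S r l q, meetSum_comm S r l q']

theorem meetSum_congr (S : Finset ℕ) (r : Bool → ℕ → K) (l : List (FlagEdge × K))
    {p q p' q' : ℕ → K} (h : ∀ v, p v * q v = p' v * q' v) :
    meetSum S r l p q = meetSum S r l p' q' := by
  simp only [meetSum, h]

/-- Changing the final sums at a vertex that is not a head. -/
theorem meetSum_update (S : Finset ℕ) (r r' : Bool → ℕ → K) (l : List (FlagEdge × K)) {u : ℕ}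
    (hu : u ∈ S) (hr : ∀ i v, v ≠ u → r' i v = r i v) (hl : ∀ f ∈ l, f.1.head ≠ u)
    (p q : ℕ → K) :
    meetSum S r' l p q = meetSum S r l p q +
      p u * q u * (r' false u * r' true u - r false u * r true u) := by
  have h1 : (l.map fun e => p e.1.tail * q e.1.tail *
      (coef false e * coef true e * (r' false e.1.head * r' true e.1.head))) =
      l.map fun e => p e.1.tail * q e.1.tail *
      (coef false e * coef true e * (r false e.1.head * r true e.1.head)) := by
    refine List.map_congr_left fun f hf => ?_
    rw [hr _ _ (hl f hf), hr _ _ (hl f hf)]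
  rw [meetSum, meetSum, h1, ← Finset.add_sum_erase S _ hu, ← Finset.add_sum_erase S _ hu]
  have h2 : ∑ v ∈ S.erase u, p v * q v * (r' false v * r' true v) =
      ∑ v ∈ S.erase u, p v * q v * (r false v * r true v) := by
    refine Finset.sum_congr rfl fun v hv => ?_
    rw [hr _ _ (Finset.ne_of_mem_erase hv), hr _ _ (Finset.ne_of_mem_erase hv)]
  rw [h2]
  ring

/-- The right-hand side is the weight of the meeting pairs, since plus and minus agree. Induction on
the earliest edge: its tail is the head of no edge in the list, so only paths that start there are
affected. The exchange argument enters just once, when both paths start at that tail and exactly one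
of them takes the edge; there `Commuting` makes the two contributions equal, and they cancel. -/
theorem meetSum_pathSum (two : (1 + 1 : K) = 0) (t : Bool → ℕ) (S : Finset ℕ)
    (l : List (FlagEdge × K)) (hS : ∀ e ∈ l, e.1.tail ∈ S ∧ e.1.head ∈ S)
    (hsort : Sorted l) (hcomm : AllCommuting l) (a b : ℕ) (ha : a ∈ S) (hb : b ∈ S) :
    meetSum S (fun i v => pathSum i l v (t i)) l (pathSum false l a) (pathSum true l b) =
      pathSum false l a (t false) * pathSum true l b (t true) + disjointSum t l a b := by
  have two' : ∀ x : K, x + x = 0 := fun x => by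
    have := congrArg (x * ·) two
    simpa [mul_add] using this
  induction l generalizing a b with
  | nil =>
    simp only [meetSum, pathSum, disjointSum, List.map_nil, List.sum_nil, add_zero]
    rw [Finset.sum_eq_single a (fun v _ hv => by simp [Ne.symm hv]) (fun h => absurd ha h)]
    by_cases hab : a = b
    · subst hab; simp
    · rw [if_neg (Ne.symm hab), if_neg hab]
      split_ifs with h1 h2 h3 h4 h5
      all_goals first | (simp [two]; done) | (exfalso; tauto)
  | cons e l ih =>
    obtain ⟨hne, hhead, hsort'⟩ := hsort
    obtain ⟨hc, hcomm'⟩ := hcomm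
    obtain ⟨huS, hvS⟩ := hS e (by simp)
    replace ih := ih (fun f hf => hS f (by simp [hf])) hsort' hcomm'
    set u := e.1.tail with hu
    set v := e.1.head with hv
    set r : Bool → ℕ → K := fun i x => pathSum i l x (t i) with hr
    set r' : Bool → ℕ → K := fun i x => pathSum i (e :: l) x (t i) with hr'
    have r'v : ∀ i x, x ≠ u → r' i x = r i x := fun i x hx => by simp [hr', hr, pathSum, ← hu, hx]
    -- No edge of the list enters `u`, so a path visits `u` only by starting there.
    have tu : ∀ i x, pathSum i l x u = if x = u then 1 else 0 := fun i =>
      pathSum_of_not_head i hhead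
    have tu' : ∀ i x, pathSum i (e :: l) x u = if x = u then 1 else 0 := fun i x => by
      simp [pathSum, tu, ← hv, hne]
    have t'eq : ∀ i x, pathSum i (e :: l) x =
        fun w => pathSum i l x w + (if x = u then coef i e else 0) * pathSum i l v w := by
      intro i x; ext w; simp [pathSum, ← hu, ← hv]
    -- The new edge alters the meeting sum in two places: through the sums out of `u`, and through
    -- its own term for pairs that share it. Both corrections carry the factor `p u * q u`.
    have expand : ∀ p q, meetSum S r' (e :: l) p q = meetSum S r l p q +
        p u * q u * (r' false u * r' true u - r false u * r true u +
          coef false e * coef true e * (r false v * r true v)) := by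
      intro p q
      have h1 : meetSum S r' (e :: l) p q = meetSum S r' l p q + p u * q u *
          (coef false e * coef true e * (r' false v * r' true v)) := by
        simp only [meetSum, List.map_cons, List.sum_cons, ← hu, ← hv]; ring
      rw [h1, meetSum_update S r r' l huS r'v hhead, r'v _ v hne, r'v _ v hne]
      ring
    have rdef : ∀ i x, r' i x = r i x + (if x = u then coef i e else 0) * r i v := by
      intro i x; simp only [hr', hr, t'eq]
    change meetSum S r' (e :: l) _ _ = r' false a * r' true b + _
    rw [expand, tu', tu', t'eq, t'eq, meetSum_add_left, meetSum_add_right, meetSum_add_right,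
      ih a b ha hb, ih a v ha hvS, ih v b hvS hb, ih v v hvS hvS, disjointSum_self]
    change (r false a * r true b + _ + _ * (r false a * r true v + _)) +
      _ * (r false v * r true b + _ + _ * (r false v * r true v + 0)) + _ = _
    rw [rdef false a, rdef true b]
    by_cases hab : a = b
    · subst hab
      simp only [disjointSum_self]
      by_cases hau : a = u
      · subst hau
        -- `Commuting` holds at every vertex `w` where the two paths may meet next, so it passes to
        -- the whole meeting sum, which depends on `p` and `q` only through the products `p w * q
        -- w`.
        have cross : coef true e * meetSum S r l (pathSum false l u) (pathSum true l v) =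
            coef false e * meetSum S r l (pathSum false l v) (pathSum true l u) := by
          have := meetSum_congr S r l (p := fun w => coef true e * pathSum false l u w)
            (q := pathSum true l v) (p' := fun w => coef false e * pathSum false l v w)
            (q' := pathSum true l u) (fun w => by
              have := hc w
              rw [← hu, ← hv] at this
              linear_combination this)
          have h0 : ∀ (c : K) p q, meetSum S r l (fun w => c * p w) q = c * meetSum S r l p q := by
            intro c p q
            have := meetSum_add_left S r l (fun _ => 0) p q c
            simpa [meetSum] using this
          rwa [h0, h0] at this
        rw [ih u v huS hvS, ih v u hvS huS] at cross
        simp only [if_true, rdef]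
        change coef true e * (r false u * r true v + _) = coef false e * (r false v * r true u + _)
          at cross
        linear_combination cross + two' (coef false e * (r false v * r true u +
          disjointSum t l v u)) + two' (coef false e * coef true e * (r false v * r true v))
      · simp [hau]
    · have hd : disjointSum t (e :: l) a b = disjointSum t l a b +
          (if a = u then coef false e * disjointSum t l v b else 0) +
          (if b = u then coef true e * disjointSum t l a v else 0) := by
        simp [disjointSum, hab, ← hu, ← hv]
      rw [hd]
      -- As `a ≠ b`, at most one start is `u`; the correction factor `p u * q u` is then zero, and
      -- only the path starting at `u` is expanded.
      by_cases hau : a = u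
      · have hbu : b ≠ u := fun h => hab (hau.trans h.symm)
        simp [hau, hbu]; ring
      · by_cases hbu : b = u
        · simp [hau, hbu]; ring
        · simp [hau, hbu]

/-! ### Potentials -/

/-- Potentials (with zero for undefined) that certify that the flags mark tight edges. -/
structure Potential (p : Bool → ℕ → ℕ) (e : FlagEdge) : Prop where
  tight : ∀ i, e.flag i → p i e.tail ≠ 0 ∧ p i e.head = p i e.tail + e.len
  other : ∀ i, e.flag i → p (!i) e.tail ≠ 0 → p (!i) e.head ≠ 0 ∧
    p (!i) e.head ≤ p (!i) e.tail + e.len ∧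
    (p (!i) e.head = p (!i) e.tail + e.len → e.flag (!i))

variable {p : Bool → ℕ → ℕ}

/-- A nonzero sum has at least one path, and `D` is its length. Its edges are tight for its own
potential, so that potential grows by exactly `D`; the other potential obeys only the relaxation
inequality along the way. -/
theorem exists_length_of_pathSum_ne_zero {l : List (FlagEdge × K)}
    (hp : ∀ e ∈ l, Potential p e.1) (i : Bool) {a b : ℕ} (h : pathSum i l a b ≠ 0) :
    ∃ D, p i b = p i a + D ∧ (a ≠ b → p i a ≠ 0) ∧
      (p (!i) a ≠ 0 → p (!i) b ≠ 0 ∧ p (!i) b ≤ p (!i) a + D) := by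
  induction l generalizing a with
  | nil =>
    have hab : a = b := by by_contra hab; simp [pathSum, hab] at h
    subst hab
    exact ⟨0, by simp⟩
  | cons e l ih =>
    replace ih := fun a h => ih (fun f hf => hp f (by simp [hf])) (a := a) h
    by_cases h1 : pathSum i l a b = 0
    · by_cases hae : a = e.1.tail
      · have hf : e.1.flag i = true := by
          by_contra hf; simp [pathSum, h1, coef, hf] at h
        have h2 : pathSum i l e.1.head b ≠ 0 := by
          intro h2; simp [pathSum, h1, h2] at h
        obtain ⟨D, hD, -, hD'⟩ := ih _ h2
        obtain ⟨ht0, ht⟩ := (hp e (by simp)).tight i hf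
        have ho := (hp e (by simp)).other i hf
        subst hae
        refine ⟨e.1.len + D, by omega, fun _ => ht0, fun h0 => ?_⟩
        obtain ⟨h3, h4, -⟩ := ho h0
        obtain ⟨h5, h6⟩ := hD' h3
        exact ⟨h5, by omega⟩
      · simp [pathSum, h1, hae] at h
    · exact ih _ h1

/-- When both potentials grow by the same amount from `a` to `b`, a path that is tight for one has a
length that the other can match only if it too is tight on every edge. Hence the two families of
paths are the same. -/
theorem pathSum_eq_of_aligned {l : List (FlagEdge × K)}
    (hp : ∀ e ∈ l, Potential p e.1) {a b : ℕ} (h0 : p false a ≠ 0) (h1 : p true a ≠ 0)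
    (h : p false b + p true a = p true b + p false a) :
    pathSum false l a b = pathSum true l a b := by
  induction l generalizing a with
  | nil => rfl
  | cons e l ih =>
    have hp' : ∀ f ∈ l, Potential p f.1 := fun f hf => hp f (by simp [hf])
    replace ih := fun a => ih hp' (a := a)
    have pe := hp e (by simp)
    simp only [pathSum, ih a h0 h1 h]
    congr 1
    by_cases hae : a = e.1.tail
    · subst hae
      simp only [if_true]
      rcases hff : e.1.flag false <;> rcases hft : e.1.flag true
      · simp [coef, hff, hft]
      · have o := pe.other true hft h0
        have t := pe.tight true hft
        simp only [Bool.not_true, hff] at o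
        -- The edge is available to only one path, so the other potential loses slack on it. Slack
        -- is never regained, hence no path of the first kind leads on to the aligned vertex `b`.
        rw [show pathSum true l e.1.head b = 0 from ?_]
        · simp [coef, hff]
        by_contra hne
        obtain ⟨D, hD, -, hD'⟩ := exists_length_of_pathSum_ne_zero hp' true hne
        obtain ⟨-, h6⟩ := hD' o.1
        simp only [Bool.not_true] at h6
        have : ¬ p false e.1.head = p false e.1.tail + e.1.len := fun h => by simpa using o.2.2 h
        omega
      · have o := pe.other false hff h1
        have t := pe.tight false hff
        simp only [Bool.not_false, hft] at o
        rw [show pathSum false l e.1.head b = 0 from ?_]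
        · simp [coef, hft]
        by_contra hne
        obtain ⟨D, hD, -, hD'⟩ := exists_length_of_pathSum_ne_zero hp' false hne
        obtain ⟨-, h6⟩ := hD' o.1
        simp only [Bool.not_false] at h6
        have : ¬ p true e.1.head = p true e.1.tail + e.1.len := fun h => by simpa using o.2.2 h
        omega
      · have tf := pe.tight false hff
        have tt := pe.tight true hft
        rw [ih e.1.head (by omega) (by omega) (by omega)]
        simp [coef, hff, hft]
    · simp [hae]

/-- One path runs through `e` to `w`, the other from the tail of `e` to `w` directly. Each route
bounds the potential of the other path at `w`, so both have the same length. Then `e` is tight for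
both, the potentials are aligned from the tail and from the head to `w`, and the path sums agree. -/
theorem commuting_aux {e : FlagEdge × K} {l : List (FlagEdge × K)} (pe : Potential p e.1)
    (hp : ∀ f ∈ l, Potential p f.1) (hhead : ∀ f ∈ l, f.1.head ≠ e.1.tail)
    (hne : e.1.head ≠ e.1.tail) {w : ℕ} {i : Bool} (hc : coef i e ≠ 0)
    (h1 : pathSum (!i) l e.1.tail w ≠ 0) (h2 : pathSum i l e.1.head w ≠ 0) :
    coef true e * (pathSum false l e.1.tail w * pathSum true l e.1.head w) =
      coef false e * (pathSum false l e.1.head w * pathSum true l e.1.tail w) := by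
  have hf : e.1.flag i = true := by by_contra hf; simp [coef, hf] at hc
  have hw : e.1.tail ≠ w := by
    rintro rfl
    rw [pathSum_of_not_head i hhead] at h2
    simp [hne] at h2
  obtain ⟨t0, t⟩ := pe.tight i hf
  obtain ⟨D, hD, hD0, hD'⟩ := exists_length_of_pathSum_ne_zero hp _ h1
  obtain ⟨E, hE, -, hE'⟩ := exists_length_of_pathSum_ne_zero hp _ h2
  simp only [Bool.not_not] at hD'
  obtain ⟨o0, o1, o2⟩ := pe.other i hf (hD0 hw)
  obtain ⟨-, h5⟩ := hE' o0
  obtain ⟨-, h6⟩ := hD' t0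
  -- The bounds `h5` and `h6` give D ≤ len + E and len + E ≤ D; equality forces the other potential
  -- to be tight on `e`.
  have hf' := o2 (by omega)
  have h7 : p (!i) e.1.head = p (!i) e.1.tail + e.1.len := by omega
  have h8 : p (!i) w + p i e.1.tail = p i w + p (!i) e.1.tail := by omega
  have h9 : p (!i) w + p i e.1.head = p i w + p (!i) e.1.head := by omega
  have g0 := hD0 hw
  have g1 : p i e.1.head ≠ 0 := by omega
  cases i
  · simp only [Bool.not_false] at *
    rw [pathSum_eq_of_aligned hp t0 g0 h8.symm, pathSum_eq_of_aligned hp g1 o0 h9.symm]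
    simp only [coef, hf, hf', if_true]; ring
  · simp only [Bool.not_true] at *
    rw [pathSum_eq_of_aligned hp g0 t0 h8, pathSum_eq_of_aligned hp o0 g1 h9]
    simp only [coef, hf, hf', if_true]; ring

theorem allCommuting_of_potential {l : List (FlagEdge × K)} (hp : ∀ e ∈ l, Potential p e.1)
    (hsort : Sorted l) : AllCommuting l := by
  induction l with
  | nil => trivial
  | cons e l ih =>
    have hp' : ∀ f ∈ l, Potential p f.1 := fun f hf => hp f (by simp [hf])
    refine ⟨fun w => ?_, ih hp' hsort.2.2⟩
    by_contra hne
    -- If both sides vanish nothing is to be shown; a nonzero side supplies the two paths that the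
    -- exchange needs.
    by_cases h : coef true e * (pathSum false l e.1.tail w * pathSum true l e.1.head w) = 0
    · rw [h] at hne
      have h' := Ne.symm hne
      refine hne (h ▸ commuting_aux (i := false) (hp e (by simp)) hp' hsort.2.1 hsort.1
        (left_ne_zero_of_mul h') (right_ne_zero_of_mul (right_ne_zero_of_mul h'))
        (left_ne_zero_of_mul (right_ne_zero_of_mul h')))
    · exact hne (commuting_aux (i := true) (hp e (by simp)) hp' hsort.2.1 hsort.1
        (left_ne_zero_of_mul h) (left_ne_zero_of_mul (right_ne_zero_of_mul h))
        (right_ne_zero_of_mul (right_ne_zero_of_mul h)))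

end FlagEdge

/-! ### Disjoint pairs of paths and the zeros of their generating function -/

namespace FlagEdge

/-- There are disjoint paths from `a` and `b` to `t false` and `t true`. -/
def Linked (t : Bool → ℕ) : List FlagEdge → ℕ → ℕ → Prop
  | [], a, b => a ≠ b ∧ a = t false ∧ b = t true
  | e :: l, a, b => a ≠ b ∧ (Linked t l a b ∨
      (a = e.tail ∧ e.flag false ∧ Linked t l e.head b) ∨
      (b = e.tail ∧ e.flag true ∧ Linked t l a e.head))

variable {K : Type}

/-- Assigning the variable `x k` to the edge number `k`. -/
def label (l : List FlagEdge) (x : ℕ → K) : List (FlagEdge × K) := l.mapIdx fun k e => (e, x k)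

theorem label_cons (e : FlagEdge) (l : List FlagEdge) (x : ℕ → K) :
    label (e :: l) x = (e, x 0) :: label l fun k => x (k + 1) := by
  simp [label, List.mapIdx_cons]

variable [Field K]

/-- The sound direction: a nonzero sum has a nonzero term, whatever the values of the variables.
This is why a false YES never occurs. -/
theorem linked_of_disjointSum_ne_zero {t : Bool → ℕ} {l : List FlagEdge} {x : ℕ → K} {a b : ℕ}
    (h : disjointSum t (label l x) a b ≠ 0) : Linked t l a b := by
  induction l generalizing x a b with
  | nil =>
    by_contra h'
    refine h ?_
    simp only [label, List.mapIdx_nil, disjointSum]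
    simp only [Linked] at h'
    split_ifs <;> tauto
  | cons e l ih =>
    rw [label_cons] at h
    have hab : a ≠ b := by rintro rfl; exact h (disjointSum_self _ _ _)
    refine ⟨hab, ?_⟩
    by_contra h'
    push Not at h'
    obtain ⟨h1, h2, h3⟩ := h'
    refine h ?_
    have z : ∀ a b, ¬ Linked t l a b → disjointSum t (label l fun k => x (k + 1)) a b = 0 :=
      fun a b hn => by by_contra hc; exact hn (ih hc)
    simp only [disjointSum, if_neg hab, z a b h1, zero_add, coef]
    have e1 : (if a = e.tail then (if e.flag false = true then x 0 else 0) *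
        disjointSum t (label l fun k => x (k + 1)) e.head b else 0) = 0 := by
      split_ifs with ha hf
      · rw [z _ _ (h2 ha hf), mul_zero]
      · rw [zero_mul]
      · rfl
    have e2 : (if b = e.tail then (if e.flag true = true then x 0 else 0) *
        disjointSum t (label l fun k => x (k + 1)) a e.head else 0) = 0 := by
      split_ifs with hb hf
      · rw [z _ _ (h3 hb hf), mul_zero]
      · rw [zero_mul]
      · rfl
    rw [e1, e2, add_zero]

/-- The variables given by `R` samples. -/
def sample {Ω : Type} {R : ℕ} (ψ : Ω → K) (ω : Fin R → Ω) (k : ℕ) : K :=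
  if h : k < R then ψ (ω ⟨k, h⟩) else 0

theorem sample_cons_zero {Ω : Type} {R : ℕ} (ψ : Ω → K) (y : Ω) (ω : Fin R → Ω) :
    sample ψ (Fin.cons y ω : Fin (R + 1) → Ω) 0 = ψ y := by
  simp [sample]

theorem sample_cons_succ {Ω : Type} {R : ℕ} (ψ : Ω → K) (y : Ω) (ω : Fin R → Ω) (k : ℕ) :
    sample ψ (Fin.cons y ω : Fin (R + 1) → Ω) (k + 1) = sample ψ ω k := by
  simp only [sample, Nat.add_lt_add_iff_right]
  split_ifs with h
  · congr 1
  · rfl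

-- A nonconstant affine function has one root, and a nonzero constant has none. The hypothesis `hψ`
-- says that no field element is hit with probability above 1/q.
open Classical in
theorem card_affine_zero_mul_le {Ω : Type} [Fintype Ω] (ψ : Ω → K) (q : ℕ)
    (hψ : ∀ κ, (Finset.univ.filter fun y => ψ y = κ).card * q ≤ Fintype.card Ω) (α β : K)
    (h : α ≠ 0 ∨ β ≠ 0) :
    (Finset.univ.filter fun y => α + ψ y * β = 0).card * q ≤ Fintype.card Ω := by
  by_cases hβ : β = 0
  · have hα : α ≠ 0 := by tauto
    simp [hβ, hα]
  · refine le_trans (Nat.mul_le_mul_right q (Finset.card_le_card ?_)) (hψ (-α / β))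
    intro y
    simp only [Finset.mem_filter, Finset.mem_univ, true_and]
    intro hy
    rw [eq_div_iff hβ]
    linear_combination hy

open Classical in
/-- If there are disjoint paths then their generating function is seldom zero. -/
theorem card_disjointSum_eq_zero_mul_le {Ω : Type} [Fintype Ω] (ψ : Ω → K) (q : ℕ)
    (hψ : ∀ κ, (Finset.univ.filter fun y => ψ y = κ).card * q ≤ Fintype.card Ω) (t : Bool → ℕ)
    (l : List FlagEdge) (R : ℕ) (hR : l.length ≤ R) (a b : ℕ) (h : Linked t l a b) :
    (Finset.univ.filter fun ω : Fin R → Ω =>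
      disjointSum t (label l (sample ψ ω)) a b = 0).card * q ≤
      l.length * Fintype.card Ω ^ R := by
  induction l generalizing R a b with
  | nil =>
    obtain ⟨h1, h2, h3⟩ := h
    have : t false ≠ t true := by rw [← h2, ← h3]; exact h1
    simp [label, disjointSum, h2, h3, this]
  | cons e l ih =>
    obtain ⟨R, rfl⟩ : ∃ R', R = R' + 1 := ⟨R - 1, by simp at hR; omega⟩
    simp only [List.length_cons, Nat.add_le_add_iff_right] at hR
    obtain ⟨hab, h⟩ := h
    let α : (Fin R → Ω) → K := fun ω => disjointSum t (label l (sample ψ ω)) a b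
    let β : (Fin R → Ω) → K := fun ω =>
      (if a = e.tail ∧ e.flag false then disjointSum t (label l (sample ψ ω)) e.head b else 0) +
      (if b = e.tail ∧ e.flag true then disjointSum t (label l (sample ψ ω)) a e.head else 0)
    -- The variable of the first edge occurs to degree at most one: two disjoint paths cannot both
    -- leave the same tail.
    have split : ∀ (y : Ω) (ω : Fin R → Ω), disjointSum t
        (label (e :: l) (sample ψ (Fin.cons y ω : Fin (R + 1) → Ω))) a b = α ω + ψ y * β ω := by
      intro y ω
      simp only [label_cons, sample_cons_zero, sample_cons_succ, disjointSum, if_neg hab, coef,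
        α, β]
      rcases hff : e.flag false <;> rcases hft : e.flag true <;>
        by_cases ha : a = e.tail <;> by_cases hb : b = e.tail <;> simp [ha, hb, mul_add, add_assoc]
    -- Outside `bad` the first variable has at most a 1/q chance of being a root; `bad` itself is
    -- controlled by the induction hypothesis.
    let bad := Finset.univ.filter fun ω : Fin R → Ω => α ω = 0 ∧ β ω = 0
    have hbad : bad.card * q ≤ l.length * Fintype.card Ω ^ R := by
      -- Whichever alternative links `a` and `b` provides a linked pair for the shorter list whose
      -- generating function vanishes on `bad`. Since `a ≠ b`, only one summand of `β` is present,
      -- so no cancellation between the two can occur.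
      have key : ∃ a' b', Linked t l a' b' ∧ ∀ ω ∈ bad,
          disjointSum t (label l (sample ψ ω)) a' b' = 0 := by
        simp only [bad, Finset.mem_filter, Finset.mem_univ, true_and, α, β]
        rcases h with h | ⟨ha, hf, h⟩ | ⟨hb, hf, h⟩
        · exact ⟨a, b, h, fun ω hω => hω.1⟩
        · refine ⟨e.head, b, h, fun ω hω => ?_⟩
          have hb : b ≠ e.tail := fun hb => hab (ha.trans hb.symm)
          simpa [ha, hf, hb] using hω.2
        · refine ⟨a, e.head, h, fun ω hω => ?_⟩
          have ha : a ≠ e.tail := fun ha => hab (ha.trans hb.symm)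
          simpa [hb, hf, ha] using hω.2
      obtain ⟨a', b', h', hz⟩ := key
      refine le_trans (Nat.mul_le_mul_right q (Finset.card_le_card ?_)) (ih R hR a' b' h')
      intro ω hω
      simpa using hz ω hω
    have count : (Finset.univ.filter fun ω : Fin (R + 1) → Ω =>
        disjointSum t (label (e :: l) (sample ψ ω)) a b = 0).card =
        ∑ ω : Fin R → Ω, (Finset.univ.filter fun y => α ω + ψ y * β ω = 0).card := by
      rw [← Finset.card_sigma]
      refine (Finset.card_bij (fun p _ => (Fin.cons p.2 p.1 : Fin (R + 1) → Ω)) ?_ ?_ ?_).symm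
      · rintro ⟨ω, y⟩ hp
        simpa [split] using hp
      · rintro ⟨ω, y⟩ _ ⟨ω', y'⟩ _ heq
        obtain ⟨h1, h2⟩ := Fin.cons_injective2 heq
        simp only at h1 h2
        rw [h1, h2]
      · intro ω hω
        refine ⟨⟨Fin.tail ω, ω 0⟩, ?_, Fin.cons_self_tail ω⟩
        simp only [Finset.mem_filter, Finset.mem_univ, true_and] at hω
        rw [← Fin.cons_self_tail ω, split] at hω
        simpa using hω
    rw [count, Finset.sum_mul]
    calc ∑ ω : Fin R → Ω, (Finset.univ.filter fun y => α ω + ψ y * β ω = 0).card * q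
        ≤ ∑ ω : Fin R → Ω, (Fintype.card Ω +
            if ω ∈ bad then Fintype.card Ω * q else 0) := by
          refine Finset.sum_le_sum fun ω _ => ?_
          by_cases hω : ω ∈ bad
          · rw [if_pos hω]
            exact le_trans (Nat.mul_le_mul_right q (Finset.card_le_univ _)) (Nat.le_add_left _ _)
          · rw [if_neg hω, add_zero]
            refine card_affine_zero_mul_le ψ q hψ _ _ ?_
            by_contra hc
            push Not at hc
            exact hω (by simpa [bad] using hc)
      _ = Fintype.card Ω ^ (R + 1) + bad.card * q * Fintype.card Ω := by
          rw [Finset.sum_add_distrib, Finset.sum_ite_mem, Finset.univ_inter, Finset.sum_const,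
            Finset.sum_const, Finset.card_univ, Fintype.card_fun, Fintype.card_fin]
          simp only [smul_eq_mul]
          ring
      _ ≤ (l.length + 1) * Fintype.card Ω ^ (R + 1) := by
          have := Nat.mul_le_mul_right (Fintype.card Ω) hbad
          rw [pow_succ] at *
          linarith

/-! ### Disjoint paths as lists of vertices -/

/-- `P` is a path for `i` from `a` to `b`. -/
structure IsRoute (i : Bool) (l : List FlagEdge) (a b : ℕ) (P : List ℕ) : Prop where
  head : P.head? = some a
  last : P.getLast? = some b
  chain : P.IsChain fun u v => ∃ e ∈ l, e.flag i ∧ e.tail = u ∧ e.head = v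

/-- The edges are sorted topologically, and the list has no loops. -/
def SortedEdges : List FlagEdge → Prop
  | [] => True
  | e :: l => e.head ≠ e.tail ∧ (∀ f ∈ l, f.head ≠ e.tail) ∧ SortedEdges l

theorem sorted_label {l : List FlagEdge} (h : SortedEdges l) (x : ℕ → K) :
    Sorted (label l x) := by
  induction l generalizing x with
  | nil => simp [label, Sorted]
  | cons e l ih =>
    rw [label_cons]
    refine ⟨h.1, ?_, ih h.2.2 _⟩
    intro f hf
    obtain ⟨k, hk, rfl⟩ := List.mem_iff_getElem.1 hf
    simp only [label, List.getElem_mapIdx]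
    exact h.2.1 _ (List.getElem_mem _)

theorem IsRoute.mem_tail {i : Bool} {l : List FlagEdge} {a b : ℕ} {P : List ℕ}
    (h : IsRoute i l a b P) {v : ℕ} (hv : v ∈ P) : v = a ∨ ∃ e ∈ l, e.head = v := by
  obtain ⟨h1, -, h3⟩ := h
  induction P generalizing a with
  | nil => simp at hv
  | cons c P ih =>
    simp only [List.head?_cons, Option.some.injEq] at h1
    subst h1
    rcases List.mem_cons.1 hv with rfl | hv
    · exact .inl rfl
    · cases P with
      | nil => simp at hv
      | cons d P =>
        rw [List.isChain_cons_cons] at h3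
        obtain ⟨⟨e, he, -, -, hd⟩, h3⟩ := h3
        rcases ih hv rfl h3 with rfl | h
        · exact .inr ⟨e, he, hd⟩
        · exact .inr h

theorem IsRoute.mono {i : Bool} {l l' : List FlagEdge} {a b : ℕ} {P : List ℕ}
    (h : IsRoute i l a b P) (hl : ∀ e ∈ l, e ∈ l') : IsRoute i l' a b P :=
  ⟨h.head, h.last, h.chain.imp fun _ _ ⟨e, he, h⟩ => ⟨e, hl e he, h⟩⟩

/-- A route that starts elsewhere does not use the first edge. -/
theorem IsRoute.of_cons {i : Bool} {e : FlagEdge} {l : List FlagEdge} {a b : ℕ} {P : List ℕ}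
    (h : IsRoute i (e :: l) a b P) (hs : SortedEdges (e :: l)) (ha : a ≠ e.tail) :
    IsRoute i l a b P := by
  refine ⟨h.head, h.last, ?_⟩
  obtain ⟨h1, -, h3⟩ := h
  induction P generalizing a with
  | nil => simp
  | cons c P ih =>
    simp only [List.head?_cons, Option.some.injEq] at h1
    subst h1
    cases P with
    | nil => simp
    | cons d P =>
      rw [List.isChain_cons_cons] at h3 ⊢
      obtain ⟨⟨f, hf, hfi, hfc, hfd⟩, h3⟩ := h3
      have hd : d ≠ e.tail := by
        rcases List.mem_cons.1 hf with rfl | hf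
        · rw [← hfd]; exact hs.1
        · rw [← hfd]; exact hs.2.1 f hf
      refine ⟨⟨f, ?_, hfi, hfc, hfd⟩, ih hd rfl h3⟩
      rcases List.mem_cons.1 hf with rfl | hf
      · exact absurd hfc.symm ha
      · exact hf

theorem IsRoute.cons {i : Bool} {e : FlagEdge} {l : List FlagEdge} {b : ℕ} {P : List ℕ}
    (h : IsRoute i l e.head b P) (hf : e.flag i) : IsRoute i (e :: l) e.tail b (e.tail :: P) := by
  obtain ⟨h1, h2, h3⟩ := h.mono (l' := e :: l) (by simp +contextual)
  refine ⟨rfl, ?_, ?_⟩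
  · cases P with
    | nil => simp at h1
    | cons c P => simpa using h2
  · cases P with
    | nil => simp
    | cons c P =>
      simp only [List.head?_cons, Option.some.injEq] at h1
      subst h1
      rw [List.isChain_cons_cons]
      exact ⟨⟨e, by simp, hf, rfl, rfl⟩, h3⟩

/-- A route from the tail of the first edge is trivial, uses it first, or not at all. -/
theorem IsRoute.tail_cases {i : Bool} {e : FlagEdge} {l : List FlagEdge} {b : ℕ} {P : List ℕ}
    (h : IsRoute i (e :: l) e.tail b P) (hs : SortedEdges (e :: l)) :
    IsRoute i l e.tail b P ∨
      ∃ Q, P = e.tail :: Q ∧ e.flag i ∧ IsRoute i l e.head b Q := by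
  obtain ⟨h1, h2, h3⟩ := h
  cases P with
  | nil => simp at h1
  | cons c P =>
    simp only [List.head?_cons, Option.some.injEq] at h1
    subst h1
    cases P with
    | nil => exact .inl ⟨rfl, h2, by simp⟩
    | cons d P =>
      rw [List.isChain_cons_cons] at h3
      obtain ⟨⟨f, hf, hfi, hfc, hfd⟩, h3⟩ := h3
      have hd : d ≠ e.tail := by
        rcases List.mem_cons.1 hf with rfl | hf
        · rw [← hfd]; exact hs.1
        · rw [← hfd]; exact hs.2.1 f hf
      have hr : IsRoute i (e :: l) d b (d :: P) := ⟨rfl, by simpa using h2, h3⟩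
      have hr' := hr.of_cons hs hd
      rcases List.mem_cons.1 hf with rfl | hf
      · exact .inr ⟨_, rfl, hfi, by rw [hfd]; exact hr'⟩
      · refine .inl ⟨rfl, h2, ?_⟩
        rw [List.isChain_cons_cons]
        exact ⟨⟨f, hf, hfi, hfc, hfd⟩, hr'.chain⟩

/-- In a topological order the first edge can only be the first step of a route that starts at its
tail. Peeling edges off the list therefore follows both routes at once, and it suffices to compare
the two current ends, since a vertex left behind is never entered again. -/
theorem linked_iff {t : Bool → ℕ} {l : List FlagEdge} (hs : SortedEdges l) {a b : ℕ} :
    Linked t l a b ↔ ∃ P Q, IsRoute false l a (t false) P ∧ IsRoute true l b (t true) Q ∧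
      ∀ v ∈ P, v ∉ Q := by
  induction l generalizing a b with
  | nil =>
    have triv : ∀ {i a c P}, IsRoute i [] a c P → P = [a] ∧ a = c := by
      rintro i a c P ⟨h1, h2, h3⟩
      match P, h1, h2, h3 with
      | [x], h1, h2, _ => simp_all
      | x :: y :: P, _, _, h3 => simp at h3
    constructor
    · rintro ⟨h, rfl, rfl⟩
      exact ⟨[t false], [t true], ⟨rfl, rfl, by simp⟩, ⟨rfl, rfl, by simp⟩, by simpa using h⟩
    · rintro ⟨P, Q, hP, hQ, h⟩
      obtain ⟨rfl, rfl⟩ := triv hP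
      obtain ⟨rfl, rfl⟩ := triv hQ
      exact ⟨by simpa using h, rfl, rfl⟩
  | cons e l ih =>
    replace ih := fun a b => ih hs.2.2 (a := a) (b := b)
    -- The vertex just left is the head of no later edge, so the other route, which does not start
    -- there, avoids it.
    have notin : ∀ {i a c P}, IsRoute i l a c P → a ≠ e.tail → e.tail ∉ P := by
      intro i a c P h ha hm
      rcases h.mem_tail hm with h | ⟨f, hf, h⟩
      · exact ha h.symm
      · exact hs.2.1 f hf h
    have hmem : ∀ {i l a c P}, IsRoute i l a c P → a ∈ P := fun h => List.mem_of_mem_head? (by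
      simp [h.head])
    constructor
    · rintro ⟨hab, h | ⟨rfl, hf, h⟩ | ⟨rfl, hf, h⟩⟩
      · obtain ⟨P, Q, hP, hQ, h⟩ := (ih a b).1 h
        exact ⟨P, Q, hP.mono (by simp +contextual), hQ.mono (by simp +contextual), h⟩
      · obtain ⟨P, Q, hP, hQ, h⟩ := (ih _ _).1 h
        refine ⟨_, Q, hP.cons hf, hQ.mono (by simp +contextual), ?_⟩
        intro v hv
        rcases List.mem_cons.1 hv with rfl | hv
        · exact notin hQ (Ne.symm hab)
        · exact h v hv
      · obtain ⟨P, Q, hP, hQ, h⟩ := (ih _ _).1 h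
        refine ⟨P, _, hP.mono (by simp +contextual), hQ.cons hf, ?_⟩
        intro v hv hv'
        rcases List.mem_cons.1 hv' with rfl | hv'
        · exact notin hP hab hv
        · exact h v hv hv'
    · rintro ⟨P, Q, hP, hQ, h⟩
      have hab : a ≠ b := by rintro rfl; exact h _ (hmem hP) (hmem hQ)
      refine ⟨hab, ?_⟩
      by_cases ha : a = e.tail
      · have hQ' := hQ.of_cons hs (fun hb => hab (ha.trans hb.symm))
        subst ha
        rcases hP.tail_cases hs with hP' | ⟨P', rfl, hf, hP'⟩
        · exact .inl ((ih _ _).2 ⟨P, Q, hP', hQ', h⟩)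
        · exact .inr (.inl ⟨rfl, hf, (ih _ _).2 ⟨P', Q, hP', hQ',
            fun v hv => h v (List.mem_cons_of_mem _ hv)⟩⟩)
      · have hP' := hP.of_cons hs ha
        by_cases hb : b = e.tail
        · subst hb
          rcases hQ.tail_cases hs with hQ' | ⟨Q', rfl, hf, hQ'⟩
          · exact .inl ((ih _ _).2 ⟨P, Q, hP', hQ', h⟩)
          · exact .inr (.inr ⟨rfl, hf, (ih _ _).2 ⟨P, Q', hP', hQ',
              fun v hv hv' => h v hv (List.mem_cons_of_mem _ hv')⟩⟩)
        · exact .inl ((ih _ _).2 ⟨P, Q, hP', hQ.of_cons hs hb, h⟩)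

end FlagEdge

/-! ### Shortest paths as paths of tight edges -/

namespace WeightedDAG

variable {n : ℕ}

/-- `N v` is zero if `v` cannot be reached from `s`, and the distance from `s` plus `base`
otherwise. -/
structure IsDist (G : WeightedDAG n) (s : Fin n) (base : ℕ) (N : ℕ → ℕ) : Prop where
  base_pos : 0 < base
  source : N s = base
  base_le : ∀ v : Fin n, N v ≠ 0 → base ≤ N v
  relax : ∀ u v : Fin n, G.graph.Adj u v → N u ≠ 0 → N v ≠ 0 ∧ N v ≤ N u + G.weight u v
  pred : ∀ v : Fin n, N v ≠ 0 → v = s ∨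
    ∃ u : Fin n, G.graph.Adj u v ∧ N u ≠ 0 ∧ N v = N u + G.weight u v

/-- The edges that lie on shortest paths from the source. -/
def Tight (G : WeightedDAG n) (N : ℕ → ℕ) (u v : Fin n) : Prop :=
  G.graph.Adj u v ∧ N u ≠ 0 ∧ N v = N u + G.weight u v

variable {G : WeightedDAG n} {s : Fin n} {base : ℕ} {N : ℕ → ℕ}

theorem nodup_of_isChain {P : List (Fin n)} (h : P.IsChain G.graph.Adj) : P.Nodup := by
  have h1 : P.IsChain (Relation.TransGen G.graph.Adj) := h.imp fun _ _ => .single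
  rw [List.isChain_iff_pairwise] at h1
  exact h1.imp fun {a b} hab => by rintro rfl; exact G.acyclic _ hab

/-- Telescoping of the relaxation inequality. Slack only accumulates along a walk, so equality at
the end forces equality on each edge. -/
theorem IsDist.le_length (hN : G.IsDist s base N) {P : List (Fin n)} {a b : Fin n}
    (ha : P.head? = some a) (hb : P.getLast? = some b) (hP : P.IsChain G.graph.Adj)
    (h0 : N a ≠ 0) : N b ≠ 0 ∧ N b ≤ N a + G.length P ∧
      (N b = N a + G.length P → P.IsChain (G.Tight N)) := by
  induction P generalizing a with
  | nil => simp at ha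
  | cons c P ih =>
    simp only [List.head?_cons, Option.some.injEq] at ha
    subst ha
    cases P with
    | nil => simp at hb; subst hb; simp [length, h0]
    | cons d P =>
      rw [List.isChain_cons_cons] at hP
      obtain ⟨h1, h2⟩ := hN.relax _ _ hP.1 h0
      obtain ⟨i1, i2, i3⟩ := ih rfl (by simpa using hb) hP.2 h1
      simp only [length]
      refine ⟨i1, by omega, fun h => ?_⟩
      rw [List.isChain_cons_cons]
      exact ⟨⟨hP.1, h0, by omega⟩, i3 (by omega)⟩

theorem length_of_tight {P : List (Fin n)} {a b : Fin n}
    (ha : P.head? = some a) (hb : P.getLast? = some b) (hP : P.IsChain (G.Tight N)) :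
    N b = N a + G.length P ∧ ∀ x ∈ P, N x ≤ N b := by
  induction P generalizing a with
  | nil => simp at ha
  | cons c P ih =>
    simp only [List.head?_cons, Option.some.injEq] at ha
    subst ha
    cases P with
    | nil => simp at hb; subst hb; simp [length]
    | cons d P =>
      rw [List.isChain_cons_cons] at hP
      obtain ⟨⟨-, -, h1⟩, h2⟩ := hP
      obtain ⟨i1, i2⟩ := ih rfl (by simpa using hb) h2
      simp only [length]
      refine ⟨by omega, fun x hx => ?_⟩
      rcases List.mem_cons.1 hx with rfl | hx
      · omega
      · exact i2 x hx

/-- Predecessors are followed backwards; positive weights make the value strictly smaller, so the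
source is reached. -/
theorem IsDist.exists_tight (hN : G.IsDist s base N) (v : Fin n) (h0 : N v ≠ 0) :
    ∃ P : List (Fin n), P.head? = some s ∧ P.getLast? = some v ∧ P.IsChain (G.Tight N) := by
  induction hk : N v using Nat.strong_induction_on generalizing v with
  | _ k ih =>
    subst hk
    rcases hN.pred v h0 with rfl | ⟨u, hadj, hu, huv⟩
    · exact ⟨[v], rfl, rfl, by simp⟩
    · have := G.weight_pos u v hadj
      obtain ⟨P, h1, h2, h3⟩ := ih (N u) (by omega) u hu rfl
      refine ⟨P ++ [v], by simp [h1], by simp, ?_⟩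
      rw [List.isChain_append]
      refine ⟨h3, by simp, fun x hx y hy => ?_⟩
      simp only [h2, Option.mem_def, Option.some.injEq, List.head?_cons] at hx hy
      subst hx; subst hy
      exact ⟨hadj, hu, huv⟩

theorem isPath_of_tight {P : List (Fin n)} {a b : Fin n} (ha : P.head? = some a)
    (hb : P.getLast? = some b) (hP : P.IsChain (G.Tight N)) : G.IsPath a b P :=
  have h := hP.imp fun _ _ h => h.1
  ⟨ha, hb, h, nodup_of_isChain h⟩

/-- Being shortest becomes a condition on single edges, which is what path sums can express. A tight
path to the target shows that the bound of `le_length` is attained, so a shortest path attains it as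
well. -/
theorem IsDist.isShortestPath_iff (hN : G.IsDist s base N) {t : Fin n} {P : List (Fin n)} :
    G.IsShortestPath s t P ↔
      P.head? = some s ∧ P.getLast? = some t ∧ P.IsChain (G.Tight N) := by
  have hs : N s ≠ 0 := by rw [hN.source]; exact hN.base_pos.ne'
  constructor
  · rintro ⟨hP, hmin⟩
    obtain ⟨h1, h2, h3⟩ := hN.le_length hP.head hP.last hP.chain hs
    obtain ⟨Q, hQ1, hQ2, hQ3⟩ := hN.exists_tight t h1
    have := hmin Q (isPath_of_tight hQ1 hQ2 hQ3)
    have := (length_of_tight hQ1 hQ2 hQ3).1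
    exact ⟨hP.head, hP.last, h3 (by omega)⟩
  · rintro ⟨h1, h2, h3⟩
    refine ⟨isPath_of_tight h1 h2 h3, fun Q hQ => ?_⟩
    have := (length_of_tight h1 h2 h3).1
    have := (hN.le_length hQ.head hQ.last hQ.chain hs).2.1
    omega

theorem IsDist.not_tight_source (hN : G.IsDist s base N) (u : Fin n) : ¬ G.Tight N u s := by
  rintro ⟨hadj, hu, h⟩
  have := G.weight_pos _ _ hadj
  have := hN.base_le u hu
  have := hN.source
  omega

end WeightedDAG

theorem List.exists_of_mem_internal {α : Type} {R : α → α → Prop} {L : List α}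
    (h : L.IsChain R) {x : α} (hx : x ∈ L.tail.dropLast) : (∃ y, R y x) ∧ ∃ z, R x z := by
  constructor
  · replace hx := List.mem_of_mem_dropLast hx
    induction L with
    | nil => simp at hx
    | cons a L ih =>
      cases L with
      | nil => simp at hx
      | cons b L =>
        rw [List.isChain_cons_cons] at h
        rcases List.mem_cons.1 hx with rfl | hx
        · exact ⟨a, h.1⟩
        · exact ih h.2 hx
  · replace h := h.tail
    generalize L.tail = M at *
    induction M with
    | nil => simp at hx
    | cons a L ih =>
      cases L with
      | nil => simp at hx
      | cons b L =>
        rw [List.isChain_cons_cons] at h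
        rw [List.dropLast_cons_cons] at hx
        rcases List.mem_cons.1 hx with rfl | hx
        · exact ⟨b, h.1⟩
        · exact ih hx h.2

theorem List.mem_internal {α : Type} {L : List α} {a b x : α} (ha : L.head? = some a)
    (hb : L.getLast? = some b) (hx : x ∈ L) (hxa : x ≠ a) (hxb : x ≠ b) :
    x ∈ L.tail.dropLast := by
  cases L with
  | nil => simp at hx
  | cons c L =>
    simp only [List.head?_cons, Option.some.injEq] at ha
    subst ha
    replace hx : x ∈ L := by simpa [hxa] using hx
    have hL : L ≠ [] := List.ne_nil_of_mem hx
    rw [List.getLast?_cons, List.getLast?_eq_some_getLast hL] at hb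
    simp only [Option.getD_some, Option.some.injEq] at hb
    rw [← List.dropLast_append_getLast hL, hb] at hx
    simpa [hxb] using hx

/-! ### The edges seen by the two paths -/

open FlagEdge WeightedDAG

/-- Data computed for an instance: the list of edges in a topological order, and the distances
from the two sources. -/
structure Survey {n : ℕ} (G : WeightedDAG n) (s : Bool → Fin n) (m : ℕ) where
  src : ℕ → ℕ
  dst : ℕ → ℕ
  len : ℕ → ℕ
  base : ℕ
  dist : Bool → ℕ → ℕ
  edge : ∀ j < m, ∃ u v : Fin n, G.graph.Adj u v ∧ src j = u ∧ dst j = v ∧ len j = G.weight u v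
  surj : ∀ u v : Fin n, G.graph.Adj u v → ∃ j < m, src j = u ∧ dst j = v
  sorted : ∀ i j, i ≤ j → j < m → dst j ≠ src i
  isDist : ∀ i, G.IsDist (s i) base (dist i)

namespace Survey

variable {n m : ℕ} {G : WeightedDAG n} {s : Bool → Fin n} (D : Survey G s m) (t : Bool → Fin n)

/-- The label of the source of path `i`. -/
def start (n : ℕ) (i : Bool) : ℕ := if i then n + 1 else n

/-- The label of the target of path `i`. -/
def goal (s t : Bool → Fin n) (i : Bool) : ℕ := if s i = t i then start n i else start n i + 2

/-- The vertex is one of the terminals. -/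
def IsTerminal (s t : Bool → Fin n) (v : ℕ) : Prop := ∃ i, v = s i ∨ v = t i

/-- The edge number `j` is tight for path `i`. -/
def TightAt (i : Bool) (j : ℕ) : Prop :=
  D.dist i (D.src j) ≠ 0 ∧ D.dist i (D.dst j) = D.dist i (D.src j) + D.len j

/-- The edge number `j` avoids the terminals. -/
def Mid (j : ℕ) : Prop := ¬ IsTerminal s t (D.src j) ∧ ¬ IsTerminal s t (D.dst j)

/-- Path `i` may use the edge number `j`. -/
def Usable (i : Bool) (j : ℕ) : Prop :=
  D.TightAt i j ∧ (D.src j = s i ∨ ¬ IsTerminal s t (D.src j)) ∧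
    (D.dst j = t i ∨ ¬ IsTerminal s t (D.dst j))

/-- The label of the tail `v` of an edge of path `i`. -/
def tailLabel (s : Bool → Fin n) (i : Bool) (v : ℕ) : ℕ := if v = s i then start n i else v

/-- The label of the head `v` of an edge of path `i`. -/
def headLabel (s t : Bool → Fin n) (i : Bool) (v : ℕ) : ℕ := if v = t i then goal s t i else v

open Classical in
/-- An edge at a terminal, for path `i` only. -/
noncomputable def sideEdge (i : Bool) (j : ℕ) : FlagEdge :=
  if ¬ D.Mid t j ∧ D.Usable t i j then
    ⟨tailLabel s i (D.src j), headLabel s t i (D.dst j), D.len j, fun i' => i' == i⟩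
  else ⟨n + 4, n + 5, 0, fun _ => false⟩

open Classical in
/-- An edge for both paths, or an edge at a terminal for the first path. -/
noncomputable def mainEdge (j : ℕ) : FlagEdge :=
  if D.Mid t j then ⟨D.src j, D.dst j, D.len j, fun i => decide (D.TightAt i j)⟩
  else D.sideEdge t false j

/-- The edges with labels as vertices. -/
noncomputable def flagEdge (k : ℕ) : FlagEdge :=
  if k % 2 = 0 then D.mainEdge t (k / 2) else D.sideEdge t true (k / 2)

/-- The list of all edges with labels as vertices. -/
noncomputable def flagEdges : List FlagEdge := (List.range (2 * m)).map (D.flagEdge t)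

variable {D t}

theorem start_ge (i : Bool) : n ≤ start n i := by cases i <;> simp [start]

theorem src_lt {j : ℕ} (hj : j < m) : D.src j < n := by
  obtain ⟨u, v, -, hu, -⟩ := D.edge j hj
  omega

theorem dst_lt {j : ℕ} (hj : j < m) : D.dst j < n := by
  obtain ⟨u, v, -, -, hv, -⟩ := D.edge j hj
  omega

theorem len_pos {j : ℕ} (hj : j < m) : 0 < D.len j := by
  obtain ⟨u, v, h, -, -, hl⟩ := D.edge j hj
  rw [hl]; exact G.weight_pos u v h

theorem tightAt_iff {i : Bool} {j : ℕ} (hj : j < m) : D.TightAt i j ↔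
    ∃ u v : Fin n, G.Tight (D.dist i) u v ∧ D.src j = u ∧ D.dst j = v := by
  obtain ⟨u, v, h, hu, hv, hl⟩ := D.edge j hj
  constructor
  · rintro ⟨h1, h2⟩
    exact ⟨u, v, ⟨h, by rwa [← hu], by rw [← hu, ← hv, ← hl]; exact h2⟩, hu, hv⟩
  · rintro ⟨u', v', ⟨h0, h1, h2⟩, hu', hv'⟩
    obtain rfl : u' = u := Fin.ext (by omega)
    obtain rfl : v' = v := Fin.ext (by omega)
    exact ⟨by rwa [hu], by rw [hu, hv, hl]; exact h2⟩

theorem dst_ne_of_tightAt {i : Bool} {j : ℕ} (hj : j < m) (h : D.TightAt i j) :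
    D.dst j ≠ s i := by
  obtain ⟨u, v, ht, hu, hv⟩ := (tightAt_iff hj).1 h
  intro hs
  obtain rfl : v = s i := Fin.ext (by omega)
  exact (D.isDist i).not_tight_source u ht

/-- The labels of source and target coincide only when `s i = t i`, and then no tight edge enters
the target. -/
theorem goal_ne_start {i i' : Bool} {j : ℕ} (hj : j < m) (h : D.TightAt i j)
    (hd : D.dst j = t i) : goal s t i ≠ start n i' := by
  have := dst_ne_of_tightAt hj h
  have hst : s i ≠ t i := by intro hst; rw [hst] at this; exact this hd
  cases i <;> cases i' <;> simp [goal, start, hst] <;> omega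

/-- The possible tails. -/
theorem tail_cases (k : ℕ) :
    ((D.flagEdge t k).tail = D.src (k / 2)) ∨
    (∃ i, (D.flagEdge t k).tail = start n i) ∨ (D.flagEdge t k).tail = n + 4 := by
  have side : ∀ i j, (D.sideEdge t i j).tail = D.src j ∨
      (∃ i', (D.sideEdge t i j).tail = start n i') ∨ (D.sideEdge t i j).tail = n + 4 := by
    intro i j
    unfold sideEdge
    split_ifs
    · by_cases h : D.src j = s i
      · exact .inr (.inl ⟨i, by simp [tailLabel, h]⟩)
      · exact .inl (by simp [tailLabel, h])
    · exact .inr (.inr rfl)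
  unfold flagEdge mainEdge
  split_ifs
  · exact .inl rfl
  · exact side _ _
  · exact side _ _

/-- The possible heads. -/
theorem head_cases (k : ℕ) :
    ((D.flagEdge t k).head = D.dst (k / 2)) ∨
    (∃ i, D.TightAt i (k / 2) ∧ D.dst (k / 2) = t i ∧ (D.flagEdge t k).head = goal s t i) ∨
      (D.flagEdge t k).head = n + 5 := by
  have side : ∀ i j, (D.sideEdge t i j).head = D.dst j ∨
      (∃ i', D.TightAt i' j ∧ D.dst j = t i' ∧ (D.sideEdge t i j).head = goal s t i') ∨
        (D.sideEdge t i j).head = n + 5 := by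
    intro i j
    unfold sideEdge
    split_ifs with h'
    · by_cases h : D.dst j = t i
      · exact .inr (.inl ⟨i, h'.2.1, h, by simp [headLabel, h]⟩)
      · exact .inl (by simp [headLabel, h])
    · exact .inr (.inr rfl)
  unfold flagEdge mainEdge
  split_ifs
  · exact .inl rfl
  · exact side _ _
  · exact side _ _

/-- Labels below `n` inherit the topological order. Among the extra labels the start labels are
never heads, the goal labels of actual edges are never tails, and the dummy edges use two labels of
their own. The case `k = k'` excludes loops. -/
theorem head_ne_tail {k k' : ℕ} (hkk : k ≤ k') (hk : k' < 2 * m) :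
    (D.flagEdge t k').head ≠ (D.flagEdge t k).tail := by
  have hj : k / 2 < m := by omega
  have hj' : k' / 2 < m := by omega
  have l1 := src_lt (D := D) hj
  have l2 := dst_lt (D := D) hj'
  have g4 : ∀ i, start n i ≤ n + 1 := fun i => by cases i <;> simp [start]
  have g5 : ∀ i, n ≤ goal s t i ∧ goal s t i ≤ n + 3 := fun i => by
    have := start_ge (n := n) i
    have := g4 i
    simp only [goal]; split_ifs <;> omega
  rcases head_cases (D := D) (t := t) k' with h | ⟨i, hti, hdi, h⟩ | h <;>
    rcases tail_cases (D := D) (t := t) k with h' | ⟨i', h'⟩ | h' <;> rw [h, h']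
  · exact D.sorted _ _ (by omega) hj'
  · have := start_ge (n := n) i'; omega
  · omega
  · have := g5 i; omega
  · exact goal_ne_start hj' hti hdi
  · have := g5 i; omega
  · omega
  · have := g4 i'; omega
  · omega

theorem sortedEdges_of_pairwise {l : List FlagEdge} (h : ∀ e ∈ l, e.head ≠ e.tail)
    (h' : l.Pairwise fun e f => f.head ≠ e.tail) : SortedEdges l := by
  induction l with
  | nil => trivial
  | cons e l ih =>
    rw [List.pairwise_cons] at h'
    exact ⟨h e (by simp), h'.1, ih (fun f hf => h f (by simp [hf])) h'.2⟩

theorem sortedEdges : SortedEdges (D.flagEdges t) := by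
  apply sortedEdges_of_pairwise
  · intro e he
    simp only [flagEdges, List.mem_map, List.mem_range] at he
    obtain ⟨k, hk, rfl⟩ := he
    exact head_ne_tail le_rfl hk
  · rw [flagEdges, List.pairwise_map]
    have := List.pairwise_lt_range (n := 2 * m)
    refine (List.Pairwise.and_mem.1 this).imp ?_
    rintro a b ⟨ha, hb, hab⟩
    exact head_ne_tail hab.le (by simpa using hb)

theorem mem_labels {e : FlagEdge} (he : e ∈ D.flagEdges t) :
    e.tail ∈ Finset.range (n + 6) ∧ e.head ∈ Finset.range (n + 6) := by
  simp only [flagEdges, List.mem_map, List.mem_range] at he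
  obtain ⟨k, hk, rfl⟩ := he
  have hj : k / 2 < m := by omega
  have l1 := src_lt (D := D) hj
  have l2 := dst_lt (D := D) hj
  have g4 : ∀ i, start n i ≤ n + 1 := fun i => by cases i <;> simp [start]
  have g5 : ∀ i, goal s t i ≤ n + 3 := fun i => by
    have := g4 i
    simp only [goal]; split_ifs <;> omega
  simp only [Finset.mem_range]
  constructor
  · rcases tail_cases (D := D) (t := t) _ with h | ⟨i, h⟩ | h <;> rw [h]
    · omega
    · have := g4 i; omega
    · omega
  · rcases head_cases (D := D) (t := t) _ with h | ⟨i, -, -, h⟩ | h <;> rw [h]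
    · omega
    · have := g5 i; omega
    · omega

/-! ### Potentials on the labelled graph -/

variable (D t) in
/-- The distances as potentials on the labels. -/
def potential (i : Bool) (l : ℕ) : ℕ :=
  if l < n then D.dist i l
  else if l = start n i then D.base
  else if l = start n (!i) then 0
  else if l = goal s t i then D.dist i (t i)
  else if l = goal s t (!i) then 1
  else 0

theorem potential_of_lt {i : Bool} {l : ℕ} (h : l < n) : D.potential t i l = D.dist i l := by
  simp [potential, h]

theorem potential_start (i : Bool) : D.potential t i (start n i) = D.dist i (s i) := by
  have := start_ge (n := n) i
  simp [potential, (D.isDist i).source, not_lt.2 this]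

theorem potential_start_other (i : Bool) : D.potential t (!i) (start n i) = 0 := by
  have := start_ge (n := n) i
  have h : start n i ≠ start n (!i) := by cases i <;> simp [start]
  simp [potential, not_lt.2 this, h]

theorem potential_goal (i : Bool) : D.potential t i (goal s t i) = D.dist i (t i) := by
  by_cases h : s i = t i
  · rw [goal, if_pos h, potential_start, h]
  · have h0 := start_ge (n := n) i
    have h1 : ∀ i', goal s t i ≠ start n i' := fun i' => by
      cases i <;> cases i' <;> simp [goal, h, start] <;> omega
    have h2 : ¬ goal s t i < n := by simp [goal, h]; omega
    simp [potential, h1, h2]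

/-- The value 1 is the smallest defined potential. An edge of positive length from a vertex with
defined potential then satisfies the relaxation inequality strictly, so the edge into a private goal
is not tight for the other path. -/
theorem potential_goal_other {i : Bool} (h : s i ≠ t i) :
    D.potential t (!i) (goal s t i) = 1 := by
  have h0 := start_ge (n := n) i
  have h1 : ∀ i', goal s t i ≠ start n i' := fun i' => by
    cases i <;> cases i' <;> simp [goal, h, start] <;> omega
  have h2 : ¬ goal s t i < n := by simp [goal, h]; omega
  have h3 : goal s t i ≠ goal s t (!i) := by
    simp only [goal, h, if_false]
    cases i <;> simp [start] <;> split_ifs <;> omega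
  simp [potential, h1, h2, h3]

theorem dist_relax {j : ℕ} (hj : j < m) (i : Bool) (h : D.dist i (D.src j) ≠ 0) :
    D.dist i (D.dst j) ≠ 0 ∧ D.dist i (D.dst j) ≤ D.dist i (D.src j) + D.len j := by
  obtain ⟨u, v, hadj, hu, hv, hl⟩ := D.edge j hj
  rw [hu] at h
  rw [hu, hv, hl]
  exact (D.isDist i).relax u v hadj h

/-- An edge of one path at a terminal either leaves its private start, where the other potential is
undefined, or enters its private goal, where the other potential is too small to be tight. Either
way the other path need not be allowed on it. -/
theorem potential_sideEdge {j : ℕ} (hj : j < m) (i : Bool) :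
    Potential (D.potential t) (D.sideEdge t i j) := by
  have hs := src_lt (D := D) hj
  have hd := dst_lt (D := D) hj
  unfold sideEdge
  split_ifs with h
  · obtain ⟨hmid, htight, hsrc, hdst⟩ := h
    have hne := dst_ne_of_tightAt hj htight
    have etail : D.potential t i (tailLabel s i (D.src j)) =
        D.dist i (D.src j) := by
      unfold tailLabel
      split_ifs with h
      · rw [potential_start, h]
      · rw [potential_of_lt hs]
    have ehead : D.potential t i (headLabel s t i (D.dst j)) =
        D.dist i (D.dst j) := by
      unfold headLabel
      split_ifs with h
      · rw [potential_goal, h]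
      · rw [potential_of_lt hd]
    constructor
    · intro i' hi
      obtain rfl : i' = i := by simpa using hi
      dsimp only
      rw [etail, ehead]
      exact htight
    · intro i' hi h0
      obtain rfl : i' = i := by simpa using hi
      dsimp only at h0 ⊢
      unfold tailLabel headLabel at *
      have h1 : D.src j ≠ s i' := by
        intro h1
        rw [if_pos h1, potential_start_other] at h0
        exact h0 rfl
      have h2 : ¬ IsTerminal s t (D.src j) := hsrc.resolve_left h1
      -- The tail is not a terminal but the edge touches one, so its head is a terminal, and
      -- usability leaves only the path's own target.
      have h3 : D.dst j = t i' := by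
        by_contra h3
        exact hmid ⟨h2, hdst.resolve_left h3⟩
      rw [if_neg h1, if_pos h3, potential_goal_other (fun hst => hne (by rw [h3, hst]))]
      rw [if_neg h1] at h0
      have := len_pos (D := D) hj
      refine ⟨one_ne_zero, by omega, fun h => by omega⟩
  · exact ⟨by simp, by simp⟩

theorem potential_flagEdges {e : FlagEdge} (he : e ∈ D.flagEdges t) :
    Potential (D.potential t) e := by
  simp only [flagEdges, List.mem_map, List.mem_range] at he
  obtain ⟨k, hk, rfl⟩ := he
  have hj : k / 2 < m := by omega
  unfold flagEdge
  split_ifs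
  · unfold mainEdge
    split_ifs with h
    · constructor
      · intro i hi
        simp only [decide_eq_true_eq] at hi
        simp only [potential_of_lt (src_lt hj), potential_of_lt (dst_lt hj)]
        exact hi
      · intro i hi h0
        simp only [potential_of_lt (src_lt hj), potential_of_lt (dst_lt hj)] at h0 ⊢
        obtain ⟨h1, h2⟩ := dist_relax hj _ h0
        exact ⟨h1, h2, fun h => by simpa using ⟨h0, h⟩⟩
    · exact potential_sideEdge hj _
  · exact potential_sideEdge hj _

/-! ### Routes and shortest paths -/

/-- The edges with labels as vertices that path `i` may use. -/
theorem exists_flag_iff {i : Bool} {x y : ℕ} :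
    (∃ e ∈ D.flagEdges t, e.flag i ∧ e.tail = x ∧ e.head = y) ↔
    ∃ j < m, D.Usable t i j ∧ tailLabel s i (D.src j) = x ∧ headLabel s t i (D.dst j) = y := by
  have side : ∀ i' j, (D.sideEdge t i' j).flag i = true ↔
      i = i' ∧ ¬ D.Mid t j ∧ D.Usable t i j := by
    intro i' j
    unfold sideEdge
    split_ifs with h
    · simp only [beq_iff_eq]
      constructor
      · rintro rfl; exact ⟨rfl, h⟩
      · exact fun h => h.1
    · simp only [Bool.false_eq_true, false_iff]
      rintro ⟨rfl, h'⟩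
      exact h h'
  have mid : ∀ j, D.Mid t j → (D.TightAt i j ↔ D.Usable t i j) ∧ D.src j ≠ s i ∧
      D.dst j ≠ t i := by
    rintro j ⟨h1, h2⟩
    exact ⟨⟨fun h => ⟨h, .inr h1, .inr h2⟩, fun h => h.1⟩, fun h => h1 ⟨i, .inl h⟩,
      fun h => h2 ⟨i, .inr h⟩⟩
  constructor
  · rintro ⟨e, he, hf, rfl, rfl⟩
    simp only [flagEdges, List.mem_map, List.mem_range] at he
    obtain ⟨k, hk, rfl⟩ := he
    refine ⟨k / 2, by omega, ?_⟩
    by_cases hmid : D.Mid t (k / 2)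
    · obtain ⟨h1, h2, h3⟩ := mid _ hmid
      rw [tailLabel, headLabel, if_neg h2, if_neg h3]
      unfold flagEdge mainEdge at *
      by_cases h0 : k % 2 = 0
      · simp only [h0, hmid, if_true, decide_eq_true_eq] at hf ⊢
        exact ⟨h1.1 hf, by simp⟩
      · simp [h0, side, hmid] at hf
    · have key : ∀ i', (D.sideEdge t i' (k / 2)).flag i = true → D.Usable t i (k / 2) ∧
          tailLabel s i (D.src (k / 2)) = (D.sideEdge t i' (k / 2)).tail ∧
          headLabel s t i (D.dst (k / 2)) = (D.sideEdge t i' (k / 2)).head := by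
        intro i' h
        obtain ⟨rfl, h1, h2⟩ := (side _ _).1 h
        refine ⟨h2, ?_⟩
        simp [sideEdge, h1, h2]
      unfold flagEdge mainEdge at *
      by_cases h0 : k % 2 = 0
      · simp only [h0, hmid, if_true, if_false] at hf ⊢
        exact key _ hf
      · simp only [h0, if_false] at hf ⊢
        exact key _ hf
  · rintro ⟨j, hj, hu, rfl, rfl⟩
    by_cases hmid : D.Mid t j
    · obtain ⟨h1, h2, h3⟩ := mid _ hmid
      refine ⟨D.flagEdge t (2 * j), List.mem_map.2 ⟨_, by simpa using hj, rfl⟩, ?_⟩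
      simp [flagEdge, mainEdge, hmid, h1.2 hu, h2, h3, tailLabel, headLabel]
    · cases i
      · refine ⟨D.flagEdge t (2 * j), List.mem_map.2 ⟨_, by simpa using hj, rfl⟩, ?_⟩
        simp [flagEdge, mainEdge, hmid, sideEdge, hu]
      · refine ⟨D.flagEdge t (2 * j + 1), List.mem_map.2 ⟨_, by simp; omega, rfl⟩, ?_⟩
        have e1 : (2 * j + 1) / 2 = j := by omega
        have e2 : (2 * j + 1) % 2 = 1 := by omega
        simp [flagEdge, hmid, sideEdge, hu, e1, e2]

variable (s t) in
/-- The vertex with a given label on path `i`. -/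
def unlabel (i : Bool) (x : ℕ) : Fin n :=
  if h : x < n then ⟨x, h⟩ else if x = start n i then s i else t i

variable (s t) in
/-- The label of a vertex on path `i`. -/
def vertexLabel (i : Bool) (v : Fin n) : ℕ :=
  if v = s i then start n i else if v = t i then goal s t i else v

theorem unlabel_start (i : Bool) : unlabel s t i (start n i) = s i := by
  have := start_ge (n := n) i
  simp [unlabel, not_lt.2 this]

theorem unlabel_goal (i : Bool) : unlabel s t i (goal s t i) = t i := by
  have := start_ge (n := n) i
  by_cases h : s i = t i
  · rw [goal, if_pos h, unlabel_start, h]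
  · have h1 : ¬ start n i + 2 < n := by omega
    simp [unlabel, goal, h, h1]

/-- The third conclusion lets disjointness of label lists be used for vertices: off the terminals,
labels and vertices are the same numbers. -/
theorem route_unlabel {i : Bool} {L : List ℕ}
    (h : IsRoute i (D.flagEdges t) (start n i) (goal s t i) L) :
    G.IsShortestPath (s i) (t i) (L.map (unlabel s t i)) ∧
      (∀ v ∈ internal (L.map (unlabel s t i)), ¬ IsTerminal s t v) ∧
      (∀ v ∈ L.map (unlabel s t i), ¬ IsTerminal s t v → (v : ℕ) ∈ L) := by
  obtain ⟨h1, h2, h3⟩ := h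
  simp only [exists_flag_iff] at h3
  refine ⟨(D.isDist i).isShortestPath_iff.2 ⟨?_, ?_, ?_⟩, ?_, ?_⟩
  · simp [h1, unlabel_start]
  · simp [h2, unlabel_goal]
  · rw [List.isChain_map]
    refine h3.imp ?_
    rintro x y ⟨j, hj, hu, rfl, rfl⟩
    obtain ⟨u, v, ht, hsu, hdv⟩ := (tightAt_iff hj).1 hu.1
    convert ht
    · unfold tailLabel
      split_ifs with h
      · rw [unlabel_start]; exact Fin.ext (by omega)
      · simp [unlabel, hsu]
    · unfold headLabel
      split_ifs with h
      · rw [unlabel_goal]; exact Fin.ext (by omega)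
      · simp [unlabel, hdv]
  · intro v hv
    rw [internal, ← List.map_tail, ← List.map_dropLast] at hv
    obtain ⟨x, hx, rfl⟩ := List.mem_map.1 hv
    obtain ⟨⟨y, j, hj, hu, -, hy⟩, ⟨z, j', hj', -, hz, -⟩⟩ := List.exists_of_mem_internal h3 hx
    -- An internal label is also the tail of an edge, and goals are not tails: ordinary tails lie
    -- below `n`, and start labels are excluded by `goal_ne_start`.
    have h4 : D.dst j ≠ t i := by
      intro h4
      rw [headLabel, if_pos h4, ← hz] at hy
      have := src_lt (D := D) hj'
      unfold tailLabel at hy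
      split_ifs at hy with h5
      · exact goal_ne_start hj hu.1 h4 hy
      · have := start_ge (n := n) i
        have : n ≤ goal s t i := by unfold goal; split_ifs <;> omega
        omega
    rw [headLabel, if_neg h4] at hy
    have := dst_lt (D := D) hj
    have h5 : (unlabel s t i x : ℕ) = D.dst j := by simp [unlabel, ← hy, this]
    rw [h5]
    exact hu.2.2.resolve_left h4
  · intro v hv hterm
    obtain ⟨x, hx, rfl⟩ := List.mem_map.1 hv
    by_cases hxn : x < n
    · simpa [unlabel, hxn] using hx
    · exfalso
      apply hterm
      unfold unlabel
      rw [dif_neg hxn]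
      split_ifs
      · exact ⟨i, .inl rfl⟩
      · exact ⟨i, .inr rfl⟩

theorem route_vertexLabel {i : Bool} {P : List (Fin n)} (h : G.IsShortestPath (s i) (t i) P)
    (hint : ∀ v ∈ internal P, ¬ IsTerminal s t v) :
    IsRoute i (D.flagEdges t) (start n i) (goal s t i) (P.map (vertexLabel s t i)) := by
  obtain ⟨h1, h2, h3⟩ := (D.isDist i).isShortestPath_iff.1 h
  refine ⟨by simp [h1, vertexLabel], ?_, ?_⟩
  · rw [List.getLast?_map, h2]
    by_cases hst : t i = s i
    · simp [vertexLabel, goal, hst]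
    · simp [vertexLabel, hst]
  · simp only [exists_flag_iff]
    rw [List.isChain_map]
    have hle := (length_of_tight h1 h2 h3).2
    have hmem : ∀ v ∈ P, v ≠ s i → v ≠ t i → ¬ IsTerminal s t v := fun v hv hs ht =>
      hint v (List.mem_internal h1 h2 hv hs ht)
    -- Membership in `P` is added to the relation on consecutive vertices, so that the edgewise
    -- argument below can use what is known about vertices of `P`.
    have h4 : P.IsChain fun u v => G.Tight (D.dist i) u v ∧ u ∈ P ∧ v ∈ P := by
      clear hle hmem h1 h2 hint h
      induction P with
      | nil => simp
      | cons a P ih =>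
        cases P with
        | nil => simp
        | cons b P =>
          rw [List.isChain_cons_cons] at h3 ⊢
          refine ⟨⟨h3.1, by simp, by simp⟩, (ih h3.2).imp ?_⟩
          rintro u v ⟨h, hu, hv⟩
          exact ⟨h, List.mem_cons_of_mem _ hu, List.mem_cons_of_mem _ hv⟩
    refine h4.imp ?_
    rintro u v ⟨ht, hu, hv⟩
    obtain ⟨j, hj, hsu, hdv⟩ := D.surj u v ht.1
    -- Distances increase strictly along tight edges and are bounded on `P` by that of the target,
    -- so no edge of `P` leaves the target.
    have hut : u ≠ t i := by
      rintro rfl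
      have := hle v hv
      have := G.weight_pos _ _ ht.1
      have := ht.2.2
      omega
    have hvs : v ≠ s i := by rintro rfl; exact (D.isDist i).not_tight_source u ht
    refine ⟨j, hj, ⟨(tightAt_iff hj).2 ⟨u, v, ht, hsu, hdv⟩, ?_, ?_⟩, ?_, ?_⟩
    · rw [hsu]
      by_cases h : u = s i
      · exact .inl (by rw [h])
      · exact .inr (hmem u hu h hut)
    · rw [hdv]
      by_cases h : v = t i
      · exact .inl (by rw [h])
      · exact .inr (hmem v hv hvs h)
    · rw [hsu]; simp [vertexLabel, tailLabel, hut, Fin.ext_iff]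
    · rw [hdv]; simp [vertexLabel, headLabel, hvs, Fin.ext_iff]

/-- The start and goal labels of different paths are distinct even when the terminals coincide, so
they never obstruct disjointness. An internal vertex of either path is no terminal at all: not its
own, as paths do not repeat vertices, and not one of the other path, as that would lie on the other
path. -/
theorem linked_iff_hasTwoDSP : Linked (goal s t) (D.flagEdges t) (start n false) (start n true) ↔
    G.HasTwoDSP (s false) (t false) (s true) (t true) := by
  rw [linked_iff sortedEdges]
  constructor
  · rintro ⟨P, Q, hP, hQ, hdisj⟩
    obtain ⟨p1, p2, p3⟩ := route_unlabel hP
    obtain ⟨q1, q2, q3⟩ := route_unlabel hQ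
    refine ⟨_, _, p1, q1, fun v hv hv' => ?_, fun v hv hv' => ?_⟩
    · have hm := List.mem_of_mem_tail (List.mem_of_mem_dropLast hv)
      exact hdisj _ (p3 v hm (p2 v hv)) (q3 v hv' (p2 v hv))
    · have hm := List.mem_of_mem_tail (List.mem_of_mem_dropLast hv)
      exact hdisj _ (p3 v hv' (q2 v hv)) (q3 v hm (q2 v hv))
  · rintro ⟨P, Q, hP, hQ, h1, h2⟩
    have ends : ∀ {i : Bool} {P : List (Fin n)}, G.IsPath (s i) (t i) P →
        ∀ v ∈ internal P, v ≠ s i ∧ v ≠ t i := by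
      intro i P hP v hv
      have hnd := hP.nodup
      have hh := hP.head
      have hl := hP.last
      cases P with
      | nil => simp [internal] at hv
      | cons a P =>
        simp only [List.head?_cons, Option.some.injEq] at hh
        subst hh
        rw [List.nodup_cons] at hnd
        simp only [internal, List.tail_cons] at hv
        refine ⟨fun h => hnd.1 (h ▸ List.mem_of_mem_dropLast hv), fun h => ?_⟩
        have hne : P ≠ [] := List.ne_nil_of_mem (List.mem_of_mem_dropLast hv)
        rw [List.getLast?_cons, List.getLast?_eq_some_getLast hne] at hl
        simp only [Option.getD_some, Option.some.injEq] at hl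
        have hnd2 := hnd.2
        rw [← List.dropLast_append_getLast hne, hl, List.nodup_append] at hnd2
        exact hnd2.2.2 v hv (t i) (by simp) h
    have memEnds : ∀ {i : Bool} {P : List (Fin n)}, G.IsPath (s i) (t i) P →
        s i ∈ P ∧ t i ∈ P := fun h =>
      ⟨List.mem_of_mem_head? (by simp [h.head]), List.mem_of_getLast? h.last⟩
    have intP : ∀ v ∈ internal P, ¬ IsTerminal s t v := by
      rintro v hv ⟨i, hi⟩
      have e1 := ends hP.1 v hv
      have e2 := memEnds hQ.1
      have e3 := h1 v hv
      cases i <;> rcases hi with hi | hi <;> rw [Fin.val_inj] at hi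
      · exact e1.1 hi
      · exact e1.2 hi
      · exact e3 (hi ▸ e2.1)
      · exact e3 (hi ▸ e2.2)
    have intQ : ∀ v ∈ internal Q, ¬ IsTerminal s t v := by
      rintro v hv ⟨i, hi⟩
      have e1 := ends hQ.1 v hv
      have e2 := memEnds hP.1
      have e3 := h2 v hv
      cases i <;> rcases hi with hi | hi <;> rw [Fin.val_inj] at hi
      · exact e3 (hi ▸ e2.1)
      · exact e3 (hi ▸ e2.2)
      · exact e1.1 hi
      · exact e1.2 hi
    refine ⟨_, _, route_vertexLabel hP intP, route_vertexLabel hQ intQ, ?_⟩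
    intro x hx hy
    obtain ⟨u, hu, rfl⟩ := List.mem_map.1 hx
    obtain ⟨v, hv, hvu⟩ := List.mem_map.1 hy
    have hun := u.2
    have hvn := v.2
    -- Private labels are at least `n` and differ between the paths. A common label can thus only
    -- come from a vertex internal to both, which is excluded.
    by_cases hu1 : u = s false
    · simp only [vertexLabel, hu1, if_true, goal, start] at hvu
      split_ifs at hvu <;> simp_all <;> omega
    by_cases hu2 : u = t false
    · simp only [vertexLabel, hu1, hu2, if_true, goal, start] at hvu
      split_ifs at hvu <;> simp_all
    by_cases hv1 : v = s true
    · simp only [vertexLabel, hu1, hu2, hv1, if_true, if_false, start] at hvu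
      omega
    by_cases hv2 : v = t true
    · simp only [vertexLabel, hu1, hu2, hv1, hv2, if_true, if_false, goal, start] at hvu
      split_ifs at hvu <;> omega
    · simp only [vertexLabel, hu1, hu2, hv1, hv2, if_false, Fin.val_inj] at hvu
      subst hvu
      exact h1 v (List.mem_internal hP.1.head hP.1.last hu hu1 hu2) hv

end Survey

namespace WordRAM

/-! ### Nim multiplication on the word RAM -/

/-- The product of two nimbers with `reg 10 * 2 ^ k` bits, with the help of a table for `reg 10`
bits in array 3 with rows of length `reg 9`. -/
def mulTerm : ℕ → Term → Term → Term
  | 0, x, y => .get 3 (.op .add (.op .mul x (.reg 9)) y)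
  | k + 1, x, y =>
    let h : Term := .op .mul (.reg 10) (.const (2 ^ k))
    let x₁ : Term := .op .shr x h
    let y₁ : Term := .op .shr y h
    let x₀ : Term := .op .mod x (.op .shl (.const 1) h)
    let y₀ : Term := .op .mod y (.op .shl (.const 1) h)
    let p := mulTerm k x₁ y₁
    let q := mulTerm k x₀ y₀
    let r := mulTerm k (.op .xor x₁ x₀) (.op .xor y₁ y₀)
    .op .add (.op .shl (.op .xor r q) h)
      (.op .xor q (mulTerm k (.op .shl (.const 1) (.op .sub h (.const 1))) p))

/-- The multiplication table for nimbers with `2 ^ i` bits is available. -/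
structure HasTable (n i : ℕ) (σ : State) : Prop where
  stride : σ.reg 9 = n + 1
  bits : σ.reg 10 = 2 ^ i
  table : ∀ x < 2 ^ 2 ^ i, ∀ y < 2 ^ 2 ^ i, σ.arr 3 (x * (n + 1) + y) = nimMul i x y

variable {w : ℕ} {ω : ℕ → ℕ}

/-- All intermediate values stay below 2^(2^(i+k)), which is at most 2^w, and table indices are
below 2^w by `hn`. Hence no operation wraps around and the term follows the recursion of `nimMul`.
-/
theorem eval_mulTerm {n i k : ℕ} {σ : State} (hT : HasTable n i σ)
    (hn : 2 ^ 2 ^ i * (n + 2) ≤ 2 ^ w) (hk : 2 ^ (i + k) ≤ w) {x y : Term}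
    (hx : x.eval w σ < 2 ^ 2 ^ (i + k)) (hy : y.eval w σ < 2 ^ 2 ^ (i + k)) :
    (mulTerm k x y).eval w σ = nimMul (i + k) (x.eval w σ) (y.eval w σ) := by
  induction k generalizing x y with
  | zero =>
    simp only [add_zero] at hx hy ⊢
    simp only [mulTerm, Term.eval, Op.apply, hT.stride]
    have h1 : x.eval w σ * (n + 1) + y.eval w σ < 2 ^ w := by
      have : x.eval w σ * (n + 1) ≤ 2 ^ 2 ^ i * (n + 1) := Nat.mul_le_mul_right _ hx.le
      have : 2 ^ 2 ^ i * (n + 2) = 2 ^ 2 ^ i * (n + 1) + 2 ^ 2 ^ i := by ring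
      omega
    rw [Nat.mod_eq_of_lt (a := x.eval w σ * (n + 1)) (by omega), Nat.mod_eq_of_lt h1,
      hT.table _ hx _ hy]
  | succ k ih =>
    have hpos := Nat.two_pow_pos (i + k)
    have hdbl : 2 ^ (i + (k + 1)) = 2 ^ (i + k) + 2 ^ (i + k) := by rw [← add_assoc, pow_succ]; ring
    have hk' : 2 ^ (i + k) ≤ w := by omega
    replace ih := fun {x y} => ih hk' (x := x) (y := y)
    set H := 2 ^ (i + k) with hH
    have hHw : H < w := by omega
    set S := 2 ^ H with hS
    have hSw : S < 2 ^ w := Nat.pow_lt_pow_right (by norm_num) hHw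
    have hSS : S * S ≤ 2 ^ w := by
      rw [hS, ← pow_add]; exact Nat.pow_le_pow_right (by norm_num) (by omega)
    have hSS' : 2 ^ 2 ^ (i + (k + 1)) = S * S := by rw [hdbl, hS, pow_add]
    have hS0 : 0 < S := by positivity
    have hww : w < 2 ^ w := Nat.lt_two_pow_self
    have hkw : 2 ^ k ≤ H := by rw [hH]; exact Nat.pow_le_pow_right (by norm_num) (by omega)
    have eh : (Term.op .mul (.reg 10) (.const (2 ^ k))).eval w σ = H := by
      simp only [Term.eval, Op.apply, hT.bits]
      rw [Nat.mod_eq_of_lt (a := 2 ^ k) (by omega), ← pow_add, Nat.mod_eq_of_lt (by omega)]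
    have h1w : 1 % 2 ^ w = 1 := Nat.mod_eq_of_lt (by omega)
    have eS : (Term.op .shl (.const 1) (.op .mul (.reg 10) (.const (2 ^ k)))).eval w σ = S := by
      rw [Term.eval, eh]
      simp only [Op.apply, Term.eval, h1w, one_mul, ← hS, Nat.mod_eq_of_lt hSw]
    have ediv : ∀ {z : Term}, z.eval w σ < S * S →
        (Term.op .shr z (.op .mul (.reg 10) (.const (2 ^ k)))).eval w σ = z.eval w σ / S ∧
        z.eval w σ / S < S := by
      intro z hz
      have := Nat.div_lt_of_lt_mul hz
      refine ⟨?_, this⟩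
      rw [Term.eval, eh]
      simp only [Op.apply, ← hS]
      exact Nat.mod_eq_of_lt (by omega)
    have emod : ∀ {z : Term}, (Term.op .mod z
        (.op .shl (.const 1) (.op .mul (.reg 10) (.const (2 ^ k))))).eval w σ = z.eval w σ % S ∧
        z.eval w σ % S < S := by
      intro z
      have := Nat.mod_lt (z.eval w σ) hS0
      refine ⟨?_, this⟩
      rw [Term.eval, eS]
      simp only [Op.apply]
      exact Nat.mod_eq_of_lt (by omega)
    have exor : ∀ {y z : Term} {a b : ℕ}, y.eval w σ = a → z.eval w σ = b → a < S → b < S →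
        (Term.op .xor y z).eval w σ = a ^^^ b ∧ a ^^^ b < S := by
      rintro y z a b rfl rfl ha hb
      have := Nat.xor_lt_two_pow ha hb
      refine ⟨?_, this⟩
      simp only [Term.eval, Op.apply]
      exact Nat.mod_eq_of_lt (by omega)
    have emul : ∀ {y z : Term} {a b : ℕ}, y.eval w σ = a → z.eval w σ = b → a < S → b < S →
        (mulTerm k y z).eval w σ = nimMul (i + k) a b ∧ nimMul (i + k) a b < S := by
      rintro y z a b rfl rfl ha hb
      exact ⟨ih ha hb, nimMul_lt _ ha hb⟩
    rw [hSS'] at hx hy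
    have ea : (Term.op .shl (.const 1)
        (.op .sub (.op .mul (.reg 10) (.const (2 ^ k))) (.const 1))).eval w σ = 2 ^ (H - 1) := by
      have e1 : (H + 2 ^ w - 1) % 2 ^ w = H - 1 := by
        rw [show H + 2 ^ w - 1 = H - 1 + 2 ^ w by omega, Nat.add_mod_right]
        exact Nat.mod_eq_of_lt (by omega)
      have e2 : (Term.op .sub (.op .mul (.reg 10) (.const (2 ^ k))) (.const 1)).eval w σ =
          H - 1 := by
        rw [Term.eval, eh]
        simp only [Op.apply, Term.eval, h1w, e1]
      rw [Term.eval, e2]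
      simp only [Op.apply, Term.eval, h1w, one_mul]
      exact Nat.mod_eq_of_lt (Nat.pow_lt_pow_right (by norm_num) (by omega))
    have ha : 2 ^ (H - 1) < S := Nat.pow_lt_pow_right (by norm_num) (by omega)
    obtain ⟨ex1, lx1⟩ := ediv hx
    obtain ⟨ey1, ly1⟩ := ediv hy
    obtain ⟨ex0, lx0⟩ := emod (z := x)
    obtain ⟨ey0, ly0⟩ := emod (z := y)
    obtain ⟨ep, lp⟩ := emul ex1 ey1 lx1 ly1
    obtain ⟨eq, lq⟩ := emul ex0 ey0 lx0 ly0
    obtain ⟨exx, lxx⟩ := exor ex1 ex0 lx1 lx0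
    obtain ⟨eyy, lyy⟩ := exor ey1 ey0 ly1 ly0
    obtain ⟨er, lr⟩ := emul exx eyy lxx lyy
    obtain ⟨eu, lu⟩ := exor er eq lr lq
    obtain ⟨es, ls⟩ := emul ea ep ha lp
    obtain ⟨ev, lv⟩ := exor eq es lq ls
    have hfin : ∀ {y z : Term} {a b : ℕ}, y.eval w σ = a → z.eval w σ = b → a < S → b < S →
        (Term.op .add (.op .shl y (.op .mul (.reg 10) (.const (2 ^ k)))) z).eval w σ =
          a * S + b := by
      rintro y z a b rfl rfl ha hb
      rw [Term.eval, Term.eval, eh]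
      simp only [Op.apply, ← hS]
      have : y.eval w σ * S + S ≤ S * S := by
        rw [← Nat.succ_mul]; exact Nat.mul_le_mul_right _ ha
      rw [Nat.mod_eq_of_lt (a := y.eval w σ * S) (by omega), Nat.mod_eq_of_lt (by omega)]
    exact hfin eu ev lu lv

/-- The row of cell number `reg 11` in a table of doubled size. -/
def tableRow : Term := .op .shr (.reg 11) (.op .mul (.const 2) (.reg 10))

/-- The column of cell number `reg 11` in a table of doubled size. -/
def tableCol : Term := .op .mod (.reg 11) (.op .shl (.const 1) (.op .mul (.const 2) (.reg 10)))

/-- Computing cell number `reg 11` in a table of doubled size. -/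
def tableCell : Prog :=
  .put 3 (.op .add (.op .mul tableRow (.reg 9)) tableCol) (mulTerm 1 tableRow tableCol)

/-- Doubling the number of bits of the multiplication table. -/
def tableStep : Prog :=
  .seq (.assign 12 (.op .shl (.const 1) (.op .mul (.const 4) (.reg 10))))
    (.seq (forUp 11 12 tableCell) (.assign 10 (.op .mul (.const 2) (.reg 10))))

/-- Building the multiplication table. -/
def tableProg : Prog :=
  .seq (.assign 9 (.op .add (.reg 0) (.const 1)))
    (.seq (.put 3 (.op .add (.reg 9) (.const 1)) (.const 1))
      (.seq (.assign 10 (.const 1))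
        (.loop (.op .lt (.op .shl (.const 1) (.op .mul (.const 4) (.reg 10))) (.reg 9)) tableStep)))

theorem mul_add_inj {x y x' y' s : ℕ} (hy : y < s) (hy' : y' < s) :
    x' * s + y' = x * s + y ↔ x' = x ∧ y' = y := by
  constructor
  · intro h
    have h1 := congrArg (· / s) h
    have h2 := congrArg (· % s) h
    have hs : 0 < s := by omega
    simp only [mul_comm _ s, Nat.mul_add_div hs, Nat.mul_add_mod, Nat.div_eq_of_lt hy,
      Nat.div_eq_of_lt hy', Nat.mod_eq_of_lt hy, Nat.mod_eq_of_lt hy', add_zero] at h1 h2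
    exact ⟨h1, h2⟩
  · rintro ⟨rfl, rfl⟩; rfl

/-- The time for computing a cell of the table. -/
def tableCost : ℕ := tableCell.maxCost + 20

/-- The row length is fixed at n + 1, so the table grows in place. Overwriting is harmless because
nim products do not depend on the level. -/
theorem runs_tableStep {n i : ℕ} {σ : State} (hT : HasTable n i σ)
    (hi : 2 ^ (2 ^ i * 4) < n + 1) (hn : (n + 2) * (n + 2) ≤ 2 ^ w) :
    Runs w ω tableStep σ ((2 ^ (2 ^ i * 4) + 1) * tableCost) (HasTable n (i + 1)) := by
  set H := 2 ^ i with hH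
  have hH1 : 1 ≤ H := Nat.one_le_two_pow
  set S := 2 ^ (H * 2) with hS
  have hSS : 2 ^ (H * 4) = S * S := by rw [hS, ← pow_add]; congr 1; ring
  have hS2 : 2 ^ 2 ^ (i + 1) = S := by rw [pow_succ, ← hH]
  have hS0 : 0 < S := by positivity
  have hSn : S < n + 1 := lt_of_le_of_lt (by nlinarith) (hSS ▸ hi)
  have hnw : n + 1 < 2 ^ w := by nlinarith
  have h4w : H * 4 < w := by
    rw [← Nat.pow_lt_pow_iff_right (a := 2) (by norm_num)]; omega
  have hww : w < 2 ^ w := Nat.lt_two_pow_self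
  have hSlow : 2 ^ 2 ^ i ≤ S := Nat.pow_le_pow_right (by norm_num) (by omega)
  have c1 : 1 % 2 ^ w = 1 := Nat.mod_eq_of_lt (by omega)
  have c2 : 2 % 2 ^ w = 2 := Nat.mod_eq_of_lt (by omega)
  have c4 : 4 % 2 ^ w = 4 := Nat.mod_eq_of_lt (by omega)
  have e1 : ((Term.op .shl (.const 1) (.op .mul (.const 4) (.reg 10))) : Term).eval w σ =
      S * S := by
    simp only [Term.eval, Op.apply, c1, c4, hT.bits, one_mul]
    rw [Nat.mod_eq_of_lt (a := 4 * 2 ^ i) (by omega), mul_comm 4, hSS,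
      Nat.mod_eq_of_lt (by nlinarith)]
  have key := (Runs.assign (w := w) (ω := ω) 12 (.op .shl (.const 1) (.op .mul (.const 4) (.reg 10))) σ).seq
    (q := .seq (forUp 11 12 tableCell) (.assign 10 (.op .mul (.const 2) (.reg 10))))
    (T' := (S * S + 1) * (tableCell.maxCost + 8) + 4) (Q' := HasTable n (i + 1)) ?_
  · refine key.mono ?_ (fun _ h => h)
    rw [tableCost, hSS]
    simp only [Term.cost]
    nlinarith
  rintro τ rfl
  rw [e1]
  have inner := (Runs.forUp (w := w) (ω := ω) (r := 11) (b := 12) (M := S * S)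
    (p := tableCell)
    rfl rfl rfl rfl (σ := σ.setReg 12 (S * S)) (by simp) (by omega)
    -- The first clause keeps the old table valid while it is being overwritten, as the new cells
    -- are computed from it; the second records the first `t` cells of the new table.
    (fun t τ => (∀ x < 2 ^ 2 ^ i, ∀ y < 2 ^ 2 ^ i, τ.arr 3 (x * (n + 1) + y) = nimMul i x y) ∧
      ∀ x < S, ∀ y < S, x * S + y < t → τ.arr 3 (x * (n + 1) + y) = nimMul (i + 1) x y)
    ⟨by simpa using hT.table, by simp⟩ ?_).frame
  · refine inner.seq fun τ ⟨hF, h1, h2⟩ => ?_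
    refine (Runs.assign _ _ _).mono (by simp [Term.cost]) ?_
    rintro _ rfl
    have f9 : τ.reg 9 = n + 1 := by rw [hF.reg 9 rfl]; simp [hT.stride]
    have f10 : τ.reg 10 = H := by rw [hF.reg 10 rfl]; simp [hT.bits, hH]
    refine ⟨by simp [f9], ?_, ?_⟩
    · simp only [State.setReg_reg, if_true, Term.eval, Op.apply, f10, c2]
      rw [Nat.mod_eq_of_lt (by omega), pow_succ]; omega
    · rw [hS2]
      intro x hx y hy
      refine h2 x hx y hy ?_
      have : x * S + S ≤ S * S := by rw [← Nat.succ_mul]; exact Nat.mul_le_mul_right _ hx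
      omega
  · rintro t ht τ hF hr ⟨h1, h2⟩
    have f9 : τ.reg 9 = n + 1 := by rw [hF.reg 9 rfl]; simp [hT.stride]
    have f10 : τ.reg 10 = 2 ^ i := by rw [hF.reg 10 rfl]; simp [hT.bits]
    have hT' : HasTable n i τ := ⟨f9, f10, h1⟩
    have hdiv : t / S < S := Nat.div_lt_of_lt_mul ht
    have hmod : t % S < S := Nat.mod_lt _ hS0
    have e2 : (2 * H) % 2 ^ w = H * 2 := by rw [Nat.mod_eq_of_lt (by omega), mul_comm]
    have ex : tableRow.eval w τ = t / S := by
      simp only [tableRow, Term.eval, Op.apply, c2, f10, hr, ← hH, e2, ← hS]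
      exact Nat.mod_eq_of_lt (by omega)
    have ey : tableCol.eval w τ = t % S := by
      simp only [tableCol, Term.eval, Op.apply, c1, c2, f10, hr, ← hH, e2, one_mul, ← hS]
      rw [Nat.mod_eq_of_lt (a := S) (by omega)]
      exact Nat.mod_eq_of_lt (by omega)
    have em := eval_mulTerm (w := w) (k := 1) hT' (by nlinarith)
      (by rw [pow_succ]; omega) (x := tableRow) (y := tableCol)
      (by rw [ex, hS2]; exact hdiv) (by rw [ey, hS2]; exact hmod)
    rw [ex, ey] at em
    have ei : (Term.op .add (.op .mul tableRow (.reg 9)) tableCol).eval w τ =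
        (t / S) * (n + 1) + t % S := by
      rw [Term.eval, ey, Term.eval, ex]
      simp only [Op.apply, Term.eval, f9]
      have : t / S * (n + 1) + t % S < 2 ^ w := by nlinarith
      rw [Nat.mod_eq_of_lt (a := t / S * (n + 1)) (by omega), Nat.mod_eq_of_lt this]
    have hsem : ∀ x, ∀ y < n + 1, (sem w ω tableCell τ).arr 3 (x * (n + 1) + y) =
        if x = t / S ∧ y = t % S then nimMul (i + 1) (t / S) (t % S)
        else τ.arr 3 (x * (n + 1) + y) := by
      intro x y hy
      rw [tableCell, sem, ei, em]
      simp only [State.setArr_arr, true_and, mul_add_inj (show t % S < n + 1 by omega) hy]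
    simp only [State.setReg_arr]
    constructor
    · intro x hx y hy
      rw [hsem x y (by omega)]
      split_ifs with h
      -- An old cell is rewritten with the same value.
      · rw [← h.1, ← h.2, nimMul_succ i hx hy]
      · exact h1 x hx y hy
    · intro x hx y hy hxy
      rw [hsem x y (by omega)]
      split_ifs with h
      · rw [h.1, h.2]
      · refine h2 x hx y hy ?_
        by_contra hlt
        apply h
        have e : x * S + y = t := by omega
        have := (mul_add_inj (s := S) (x := t / S) (y := t % S) (x' := x) (y' := y) hmod hy).1
          (by rw [e, Nat.div_add_mod'])
        exact this

/-- The side length of the table is squared in every round as long as the new number of cells is at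
most n. The costs grow so fast that their sum is linear. The two final inequalities place the table
size within a constant power of n, which controls both memory and the size of the field. -/
theorem runs_tableProg {n : ℕ} {σ : State} (h0 : σ.reg 0 = n) (hn : 1 ≤ n)
    (hw : (n + 2) ^ 4 ≤ 2 ^ w) (h3 : ∀ i, σ.arr 3 i = 0) :
    Runs w ω tableProg σ ((2 * (n + 5) + 1) * tableCost)
      (fun τ => ∃ i, HasTable n i τ ∧ n < 2 ^ (2 ^ i * 4) ∧ (i = 0 ∨ 2 ^ (2 ^ i * 2) ≤ n)) := by
  have hn4 : (n + 2) ^ 4 = ((n + 2) * (n + 2)) * ((n + 2) * (n + 2)) := by ring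
  have hn9 : 9 ≤ (n + 2) * (n + 2) := by nlinarith
  have hn2 : (n + 2) * (n + 2) * 9 ≤ 2 ^ w := by nlinarith
  have c1 : 1 % 2 ^ w = 1 := Nat.mod_eq_of_lt (by nlinarith)
  have hww : w < 2 ^ w := Nat.lt_two_pow_self
  have guard : ∀ i τ, HasTable n i τ → (i = 0 ∨ 2 ^ (2 ^ i * 2) ≤ n) →
      ((Term.op .lt (.op .shl (.const 1) (.op .mul (.const 4) (.reg 10))) (.reg 9)).eval w τ ≠ 0 ↔
        2 ^ (2 ^ i * 4) < n + 1) := by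
    intro i τ hT hi
    -- The guard itself must not overflow: it is 16 at the start and otherwise at most n².
    have h16 : 2 ^ (2 ^ i * 4) < 2 ^ w := by
      rcases hi with rfl | hi
      · norm_num; nlinarith
      · have : 2 ^ (2 ^ i * 4) = 2 ^ (2 ^ i * 2) * 2 ^ (2 ^ i * 2) := by rw [← pow_add]; congr 1; ring
        have := Nat.mul_le_mul hi hi
        nlinarith
    have h4w : 2 ^ i * 4 < w := by
      rwa [Nat.pow_lt_pow_iff_right (by norm_num)] at h16
    have : 1 ≤ 2 ^ i := Nat.one_le_two_pow
    have c4 : 4 % 2 ^ w = 4 := Nat.mod_eq_of_lt (by omega)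
    simp only [Term.eval, Op.apply, c1, c4, hT.bits, hT.stride, one_mul]
    rw [Nat.mod_eq_of_lt (a := 4 * 2 ^ i) (by omega), mul_comm 4, Nat.mod_eq_of_lt h16]
    split_ifs with h <;> simp [h, c1]
  have main : ∀ τ, HasTable n 0 τ → Runs w ω (.loop (.op .lt (.op .shl (.const 1)
      (.op .mul (.const 4) (.reg 10))) (.reg 9)) tableStep) τ ((2 * (n + 5)) * tableCost)
      (fun τ => ∃ i, HasTable n i τ ∧ n < 2 ^ (2 ^ i * 4) ∧ (i = 0 ∨ 2 ^ (2 ^ i * 2) ≤ n)) := by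
    intro τ hτ
    have key := Runs.loop (w := w) (ω := ω)
      (x := .op .lt (.op .shl (.const 1) (.op .mul (.const 4) (.reg 10))) (.reg 9))
      (p := tableStep) (fun τ => ∃ i, HasTable n i τ ∧ (i = 0 ∨ 2 ^ (2 ^ i * 2) ≤ n))
      -- With S = 2^(2 · bits), a round replaces S by S² and costs about S² cells. The potential
      -- drops by 2S² - 2S ≥ S² + 2, as S ≥ 4, which also pays for the loop test.
      (fun τ => (2 * (n + 5) - 2 * 2 ^ (τ.reg 10 * 2)) * tableCost) ?_ (σ := τ)
      ⟨0, hτ, .inl rfl⟩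
    · refine key.mono ?_ ?_
      · rw [hτ.bits]
        have e : 2 * (n + 5) - 2 * 2 ^ (2 ^ 0 * 2) = 2 * (n + 1) := by norm_num; omega
        rw [e]
        have : 20 ≤ tableCost := by simp [tableCost]
        simp only [Term.cost]
        nlinarith
      · rintro υ ⟨⟨i, hT, hi⟩, hx⟩
        refine ⟨i, hT, ?_, hi⟩
        have := (guard i υ hT hi).not
        simp only [hx, ne_eq, not_true_eq_false, not_false_eq_true, true_iff] at this
        omega
    · rintro υ ⟨i, hT, hi⟩ hx
      have hlt := (guard i υ hT hi).1 hx
      refine ⟨_, (runs_tableStep hT hlt (by omega)).mono le_rfl ?_⟩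
      intro τ' hT'
      have e : 2 ^ (2 ^ (i + 1) * 2) = 2 ^ (2 ^ i * 4) := by congr 1; rw [pow_succ]; ring
      refine ⟨⟨i + 1, hT', .inr (by rw [e]; omega)⟩, ?_⟩
      rw [hT'.bits, hT.bits, e]
      set S := 2 ^ (2 ^ i * 2) with hS
      have hSS : 2 ^ (2 ^ i * 4) = S * S := by rw [hS, ← pow_add]; congr 1; ring
      rw [hSS] at hlt ⊢
      have hS4 : 4 ≤ S := by
        have : 1 ≤ 2 ^ i := Nat.one_le_two_pow
        calc 4 = 2 ^ 2 := rfl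
          _ ≤ S := Nat.pow_le_pow_right (by norm_num) (by omega)
      obtain ⟨c, hc⟩ : ∃ c, n = S * S + c := ⟨n - S * S, by omega⟩
      have e1 : 2 * (n + 5) - 2 * (S * S) = 2 * (c + 5) := by omega
      have e2 : 2 * (n + 5) - 2 * S = 2 * (c + 5) + (2 * (S * S) - 2 * S) := by
        have : S ≤ S * S := Nat.le_mul_self S
        omega
      have e3 : S * S + 2 ≤ 2 * (S * S) - 2 * S := by
        have : 4 * S ≤ S * S := Nat.mul_le_mul_right _ hS4
        omega
      rw [e1, e2]
      have h20 : 20 ≤ tableCost := by simp [tableCost]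
      have := Nat.mul_le_mul_right tableCost e3
      simp only [Term.cost]
      rw [add_mul (2 * (c + 5))]
      nlinarith
  have r1 := (Runs.assign (w := w) (ω := ω) 9 (.op .add (.reg 0) (.const 1)) σ).seq
    fun τ hτ => (Runs.put (w := w) (ω := ω) 3 (.op .add (.reg 9) (.const 1)) (.const 1) τ).seq
    fun υ hυ => (Runs.assign (w := w) (ω := ω) 10 (.const 1) υ).seq
    fun ρ hρ => main ρ ?_
  · refine r1.mono ?_ (fun _ h => h)
    have h20 : 20 ≤ tableCost := by simp [tableCost]
    simp only [Term.cost]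
    nlinarith
  · subst hτ hυ hρ
    have e1 : (Term.op .add (.reg 0) (.const 1)).eval w σ = n + 1 := by
      simp only [Term.eval, Op.apply, h0, c1]
      exact Nat.mod_eq_of_lt (by nlinarith)
    have e2 : (Term.op .add (.reg 9) (.const 1)).eval w (σ.setReg 9 (n + 1)) = n + 2 := by
      simp only [Term.eval, Op.apply, State.setReg_reg, if_true, c1]
      exact Nat.mod_eq_of_lt (by nlinarith)
    rw [e1, e2]
    refine ⟨by simp, by simp [Term.eval, c1], ?_⟩
    intro x hx y hy
    simp only [pow_zero, pow_one] at hx hy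
    simp only [State.setReg_arr, State.setArr_arr, true_and, Term.eval, c1, h3, nimMul]
    interval_cases x <;> interval_cases y <;> simp <;> omega

end WordRAM

/-! ### Topological sorting -/

/-- One more than the last index below `i` with value `u`, or zero. -/
def lastOut (f : ℕ → ℕ) : ℕ → ℕ → ℕ
  | 0, _ => 0
  | i + 1, u => if f i = u then i + 1 else lastOut f i u

theorem lastOut_le (f : ℕ → ℕ) (i u : ℕ) : lastOut f i u ≤ i := by
  induction i with
  | zero => simp [lastOut]
  | succ i ih => simp only [lastOut]; split_ifs <;> omega

theorem lt_lastOut (f : ℕ → ℕ) {i j u : ℕ} (hj : j < i) (h : f j = u) : j < lastOut f i u := by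
  induction i with
  | zero => omega
  | succ i ih =>
    simp only [lastOut]
    split_ifs with hi
    · exact hj
    · refine ih (lt_of_le_of_ne (by omega) ?_)
      rintro rfl; exact hi h

theorem lastOut_spec (f : ℕ → ℕ) {i u : ℕ} (h : lastOut f i u ≠ 0) :
    f (lastOut f i u - 1) = u := by
  induction i with
  | zero => simp [lastOut] at h
  | succ i ih =>
    simp only [lastOut] at h ⊢
    split_ifs with hi
    · simpa using hi
    · rw [if_neg hi] at h; exact ih h

/-- The number of edges into `v` that are not among the first `c` edges in `ord`. -/
def inDegree (m : ℕ) (hd ord : ℕ → ℕ) (c v : ℕ) : ℕ :=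
  ((Finset.range m).filter fun e => hd e = v ∧ ∀ i < c, ord i ≠ e).card

/-- The state of Kahn's algorithm: `c` edges have been output to `ord`, of the `b` vertices in the
queue `Q` the first `a` have been removed, and the remaining edges out of the last one removed
are those with number less than `p`. -/
structure KahnInv (n m : ℕ) (tl hd : ℕ → ℕ) (c a b p : ℕ) (Q ord : ℕ → ℕ) : Prop where
  ord_lt : ∀ i < c, ord i < m
  ord_inj : ∀ i < c, ∀ j < c, ord i = ord j → i = j
  le : a ≤ b
  queue_lt : ∀ i < b, Q i < n
  queue_inj : ∀ i < b, ∀ j < b, Q i = Q j → i = j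
  done : ∀ e < m, (∃ i < c, ord i = e) ↔
    (∃ i, i + 1 < a ∧ Q i = tl e) ∨ (0 < a ∧ Q (a - 1) = tl e ∧ p ≤ e)
  ptr_le : p ≤ m
  ptr : p ≠ 0 → 0 < a ∧ tl (p - 1) = Q (a - 1)
  queue : ∀ v < n, inDegree m hd ord c v = 0 ↔ ∃ i < b, Q i = v
  sorted : ∀ i < c, ∀ f < m, hd f = tl (ord i) → ∃ j < i, ord j = f

theorem le_of_injOn_lt {f : ℕ → ℕ} {a b : ℕ} (h : ∀ i < a, f i < b)
    (h' : ∀ i < a, ∀ j < a, f i = f j → i = j) : a ≤ b := by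
  have := Finset.card_le_card_of_injOn (s := Finset.range a) (t := Finset.range b) f
    (fun i hi => by simpa using h i (by simpa using hi))
    (fun i hi j hj => h' i (by simpa using hi) j (by simpa using hj))
  simpa using this

theorem inDegree_eq_zero {m : ℕ} {hd ord : ℕ → ℕ} {c v : ℕ} :
    inDegree m hd ord c v = 0 ↔ ∀ e < m, hd e = v → ∃ i < c, ord i = e := by
  rw [inDegree, Finset.card_eq_zero, Finset.filter_eq_empty_iff]
  simp only [Finset.mem_range, not_and, not_forall, not_not, exists_prop]

namespace KahnInv

variable {n m : ℕ} {tl hd : ℕ → ℕ} {c a b p : ℕ} {Q ord : ℕ → ℕ}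

/-- The edge under the pointer leaves the vertex removed last, which occurs only once in the queue,
and its number is still below `p`. -/
theorem not_done (h : KahnInv n m tl hd c a b p Q ord) (hp : p ≠ 0) :
    ∀ i < c, ord i ≠ p - 1 := by
  intro i hi he
  have hle := h.ptr_le
  obtain ⟨ha, ht⟩ := h.ptr hp
  rcases (h.done (p - 1) (by omega)).1 ⟨i, hi, he⟩ with ⟨j, hj, hQ⟩ | ⟨-, -, hlt⟩
  · have hab := h.le
    have := h.queue_inj j (by omega) (a - 1) (by omega) (hQ.trans ht)
    omega
  · omega

theorem inDegree_succ (h : KahnInv n m tl hd c a b p Q ord) (hp : p ≠ 0) (v : ℕ) :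
    inDegree m hd ord c v =
      inDegree m hd (Function.update ord c (p - 1)) (c + 1) v + if hd (p - 1) = v then 1 else 0 := by
  have hle := h.ptr_le
  have key : ((Finset.range m).filter fun e => hd e = v ∧ ∀ i < c + 1,
      Function.update ord c (p - 1) i ≠ e) =
      ((Finset.range m).filter fun e => hd e = v ∧ ∀ i < c, ord i ≠ e).erase (p - 1) := by
    ext e
    simp only [Finset.mem_filter, Finset.mem_range, Finset.mem_erase]
    constructor
    · rintro ⟨he, hv, hi⟩
      refine ⟨?_, he, hv, fun i hic => ?_⟩
      · have := hi c (by omega)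
        simpa [eq_comm] using this
      · have := hi i (by omega)
        rwa [Function.update_of_ne (by omega)] at this
    · rintro ⟨hne, he, hv, hi⟩
      refine ⟨he, hv, fun i hic => ?_⟩
      by_cases hc : i = c
      · subst hc; simpa [eq_comm] using hne
      · rw [Function.update_of_ne hc]; exact hi i (by omega)
  rw [inDegree, inDegree, key, Finset.card_erase_eq_ite]
  by_cases hv : hd (p - 1) = v
  · have hmem : p - 1 ∈ (Finset.range m).filter fun e => hd e = v ∧ ∀ i < c, ord i ≠ e := by
      simp only [Finset.mem_filter, Finset.mem_range]
      exact ⟨by omega, hv, h.not_done hp⟩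
    have := Finset.card_pos.2 ⟨_, hmem⟩
    rw [if_pos hmem, if_pos hv]; omega
  · have hmem : p - 1 ∉ (Finset.range m).filter fun e => hd e = v ∧ ∀ i < c, ord i ≠ e := by
      simp [hv]
    rw [if_neg hmem, if_neg hv, add_zero]

/-- Outputting an edge lowers the in-degree of its head alone, so at most that vertex joins the
queue. The pointer moves to the previous edge with the same tail, and no edge out of the vertex is
skipped. -/
theorem edge (h : KahnInv n m tl hd c a b p Q ord) (hp : p ≠ 0) (hhd : ∀ e < m, hd e < n) :
    KahnInv n m tl hd (c + 1) a
      (if inDegree m hd (Function.update ord c (p - 1)) (c + 1) (hd (p - 1)) = 0 then b + 1 else b)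
      (lastOut tl (p - 1) (tl (p - 1)))
      (if inDegree m hd (Function.update ord c (p - 1)) (c + 1) (hd (p - 1)) = 0 then
        Function.update Q b (hd (p - 1)) else Q)
      (Function.update ord c (p - 1)) := by
  have hle := h.ptr_le
  have hab := h.le
  obtain ⟨ha, ht⟩ := h.ptr hp
  have hnd := h.not_done hp
  have hdeg := h.inDegree_succ hp
  set e := p - 1 with he
  set ord' := Function.update ord c e with hord'
  set b' := if inDegree m hd ord' (c + 1) (hd e) = 0 then b + 1 else b with hb'
  set Q' := if inDegree m hd ord' (c + 1) (hd e) = 0 then Function.update Q b (hd e) else Q with hQ'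
  have ordc : ord' c = e := by simp [hord']
  have ordlt : ∀ i < c, ord' i = ord i := fun i hi => by
    rw [hord', Function.update_of_ne (by omega)]
  have Qlt : ∀ i < b, Q' i = Q i := fun i hi => by
    rw [hQ']; split_ifs
    · rw [Function.update_of_ne (by omega)]
    · rfl
  have hbb : b ≤ b' := by rw [hb']; split_ifs <;> omega
  have Qnew : ∀ i, i < b' → ¬ i < b → i = b ∧ Q' i = hd e ∧
      inDegree m hd ord' (c + 1) (hd e) = 0 := by
    intro i hi hib
    rw [hb'] at hi
    split_ifs at hi with h0
    · obtain rfl : i = b := by omega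
      exact ⟨rfl, by simp [hQ', h0], h0⟩
    · omega
  -- The head still has the incoming edge `e` that has not been output, so its in-degree is positive
  -- and it was not queued before.
  have hnotq : ∀ i < b, Q i ≠ hd e := by
    intro i hi hQi
    have h1 := (h.queue (hd e) (hhd e (by omega))).2 ⟨i, hi, hQi⟩
    have h2 := hdeg (hd e)
    rw [if_pos rfl] at h2
    omega
  constructor
  · intro i hi
    by_cases hc : i < c
    · rw [ordlt i hc]; exact h.ord_lt i hc
    · obtain rfl : i = c := by omega
      rw [ordc]; omega
  · intro i hi j hj hij
    by_cases hc : i < c <;> by_cases hc' : j < c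
    · rw [ordlt i hc, ordlt j hc'] at hij; exact h.ord_inj i hc j hc' hij
    · obtain rfl : j = c := by omega
      rw [ordlt i hc, ordc] at hij; exact absurd hij (hnd i hc)
    · obtain rfl : i = c := by omega
      rw [ordlt j hc', ordc] at hij; exact absurd hij.symm (hnd j hc')
    · omega
  · omega
  · intro i hi
    by_cases hib : i < b
    · rw [Qlt i hib]; exact h.queue_lt i hib
    · obtain ⟨-, h2, -⟩ := Qnew i hi hib
      rw [h2]; exact hhd e (by omega)
  · intro i hi j hj hij
    by_cases hib : i < b <;> by_cases hjb : j < b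
    · rw [Qlt i hib, Qlt j hjb] at hij; exact h.queue_inj i hib j hjb hij
    · obtain ⟨-, h2, -⟩ := Qnew j hj hjb
      rw [Qlt i hib, h2] at hij; exact absurd hij (hnotq i hib)
    · obtain ⟨-, h2, -⟩ := Qnew i hi hib
      rw [Qlt j hjb, h2] at hij; exact absurd hij.symm (hnotq j hjb)
    · have := (Qnew i hi hib).1
      have := (Qnew j hj hjb).1
      omega
  · intro f hf
    have hab' : a - 1 < b := by omega
    have hle' : ∀ i, i + 1 < a → i < b := fun i hi => by omega
    have e1 : (∃ i < c + 1, ord' i = f) ↔ (∃ i < c, ord i = f) ∨ f = e := by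
      constructor
      · rintro ⟨i, hi, hif⟩
        by_cases hc : i < c
        · exact .inl ⟨i, hc, by rw [← ordlt i hc]; exact hif⟩
        · obtain rfl : i = c := by omega
          exact .inr (by rw [← hif, ordc])
      · rintro (⟨i, hi, hif⟩ | rfl)
        · exact ⟨i, by omega, by rw [ordlt i hi]; exact hif⟩
        · exact ⟨c, by omega, ordc⟩
    rw [e1, h.done f hf, Qlt (a - 1) hab']
    have e2 : (∃ i, i + 1 < a ∧ Q' i = tl f) ↔ ∃ i, i + 1 < a ∧ Q i = tl f := by
      refine exists_congr fun i => and_congr_right fun hi => ?_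
      rw [Qlt i (hle' i hi)]
    rw [e2, or_assoc]
    refine or_congr_right ?_
    clear e1 e2
    constructor
    · rintro (⟨h1, h2, h3⟩ | rfl)
      · exact ⟨h1, h2, le_trans (lastOut_le _ _ _) (by omega)⟩
      · exact ⟨ha, ht.symm, lastOut_le _ _ _⟩
    · rintro ⟨h1, h2, h3⟩
      by_cases hfe : f = e
      · exact .inr hfe
      · refine .inl ⟨h1, h2, ?_⟩
        by_contra hlt
        have := lt_lastOut tl (i := e) (j := f) (u := tl e) (by omega) (by rw [← h2, ht])
        omega
  · exact le_trans (lastOut_le _ _ _) (by omega)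
  · intro h0
    exact ⟨ha, by rw [lastOut_spec tl h0, Qlt _ (by omega), ht]⟩
  · intro v hv
    have h1 := h.queue v hv
    have h2 := hdeg v
    by_cases hve : hd e = v
    · subst hve
      constructor
      · intro h0
        exact ⟨b, by simp [hb', h0], by simp [hQ', h0]⟩
      · rintro ⟨i, hi, hQi⟩
        by_cases hib : i < b
        · rw [Qlt i hib] at hQi; exact absurd hQi (hnotq i hib)
        · exact (Qnew i hi hib).2.2
    · rw [if_neg hve, add_zero] at h2
      rw [← h2, h1]
      constructor
      · rintro ⟨i, hi, hQi⟩
        exact ⟨i, by omega, by rw [Qlt i hi]; exact hQi⟩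
      · rintro ⟨i, hi, hQi⟩
        by_cases hib : i < b
        · exact ⟨i, hib, by rw [← Qlt i hib]; exact hQi⟩
        · exact absurd ((Qnew i hi hib).2.1.symm.trans hQi) hve
  · intro i hi f hf hft
    by_cases hc : i < c
    · rw [ordlt i hc] at hft
      obtain ⟨j, hj, hjf⟩ := h.sorted i hc f hf hft
      exact ⟨j, hj, by rw [ordlt j (by omega)]; exact hjf⟩
    · obtain rfl : i = c := by omega
      rw [ordc, ht] at hft
      -- The tail of the new edge was queued, so its in-degree is zero and all edges into it have
      -- already been output.
      have hq := (h.queue (Q (a - 1)) (h.queue_lt _ (by omega))).2 ⟨a - 1, by omega, rfl⟩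
      obtain ⟨j, hj, hjf⟩ := inDegree_eq_zero.1 hq f hf hft
      exact ⟨j, hj, by rw [ordlt j hj]; exact hjf⟩

/-- A zero pointer means that the vertex removed before has no edges left; its edges move to the
first alternative of `done`. -/
theorem vertex (h : KahnInv n m tl hd c a b 0 Q ord) (hab : a < b) :
    KahnInv n m tl hd c (a + 1) b (lastOut tl m (Q a)) Q ord := by
  refine ⟨h.ord_lt, h.ord_inj, hab, h.queue_lt, h.queue_inj, ?_, lastOut_le _ _ _, ?_, h.queue,
    h.sorted⟩
  · intro e he
    rw [h.done e he]
    simp only [Nat.zero_le, and_true, Nat.add_sub_cancel]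
    constructor
    · rintro (⟨i, hi, hQ⟩ | ⟨ha, hQ⟩)
      · exact .inl ⟨i, by omega, hQ⟩
      · exact .inl ⟨a - 1, by omega, hQ⟩
    · rintro (⟨i, hi, hQ⟩ | ⟨-, hQ, hle⟩)
      · by_cases hia : i + 1 < a
        · exact .inl ⟨i, hia, hQ⟩
        · obtain rfl : i = a - 1 := by omega
          exact .inr ⟨by omega, hQ⟩
      · have := lt_lastOut tl he hQ.symm
        omega
  · intro h0
    exact ⟨by omega, by rw [lastOut_spec tl h0, Nat.add_sub_cancel]⟩

theorem count_le (h : KahnInv n m tl hd c a b p Q ord) : c ≤ m := le_of_injOn_lt h.ord_lt h.ord_inj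

theorem queue_le (h : KahnInv n m tl hd c a b p Q ord) : b ≤ n :=
  le_of_injOn_lt h.queue_lt h.queue_inj

/-- When the queue is empty all edges of an acyclic graph have been output. -/
theorem complete (h : KahnInv n m tl hd c a a 0 Q ord) (htl : ∀ e < m, tl e < n)
    (hac : ∀ v, ¬ Relation.TransGen (fun u v => ∃ e < m, tl e = u ∧ hd e = v) v v) :
    c = m ∧ ∀ e < m, ∃ i < m, ord i = e := by
  have hdone : ∀ e < m, (∃ i < a, Q i = tl e) → ∃ i < c, ord i = e := by
    rintro e he ⟨i, hi, hQ⟩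
    rw [h.done e he]
    by_cases hia : i + 1 < a
    · exact .inl ⟨i, hia, hQ⟩
    · obtain rfl : i = a - 1 := by omega
      exact .inr ⟨by omega, hQ, Nat.zero_le _⟩
  let r : Fin n → Fin n → Prop := fun x y =>
    Relation.TransGen (fun u v => ∃ e < m, tl e = u ∧ hd e = v) (x : ℕ) y
  have : IsTrans (Fin n) r := ⟨fun _ _ _ h1 h2 => h1.trans h2⟩
  have : Std.Irrefl r := ⟨fun x => hac x⟩
  have wf : WellFounded r := Finite.wellFounded_of_trans_of_irrefl r
  -- Well-founded induction along reachability: if every edge out of each predecessor of `u` was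
  -- output, then `u` has in-degree zero, was queued, and had its own edges output.
  have all : ∀ u : Fin n, ∀ e < m, tl e = u → ∃ i < c, ord i = e := by
    intro u
    induction u using wf.induction with
    | _ u ih =>
      intro e he hu
      refine hdone e he ((h.queue (tl e) (htl e he)).1 (inDegree_eq_zero.2 ?_))
      intro f hf hft
      exact ih ⟨tl f, htl f hf⟩ (.single ⟨f, hf, rfl, hft.trans hu⟩) f hf rfl
  have all' : ∀ e < m, ∃ i < c, ord i = e := fun e he => all ⟨tl e, htl e he⟩ e he rfl
  have hcm : c = m := by
    refine le_antisymm h.count_le ?_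
    choose! g hg using all'
    refine le_of_injOn_lt (f := g) (fun e he => (hg e he).1) fun e he f hf hef => ?_
    rw [← (hg e he).2, ← (hg f hf).2, hef]
  exact ⟨hcm, fun e he => by rw [← hcm]; exact all' e he⟩

end KahnInv

/-! ### Kahn's algorithm on the word RAM -/

namespace WordRAM

variable {w : ℕ} {ω : ℕ → ℕ}

theorem sub_mod_eq {a b W : ℕ} (h : b ≤ a) (ha : a < W) : (a + W - b) % W = a - b := by
  rw [show a + W - b = a - b + W by omega, Nat.add_mod_right, Nat.mod_eq_of_lt (by omega)]

/-- Recording edge number `reg 11` in the adjacency lists. -/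
def adjacencyStep : Prog :=
  .seq (.put 5 (.reg 11) (.get 4 (.get 0 (.reg 11))))
    (.seq (.put 4 (.get 0 (.reg 11)) (.op .add (.reg 11) (.const 1)))
      (.put 6 (.get 1 (.reg 11)) (.op .add (.get 6 (.get 1 (.reg 11))) (.const 1))))

/-- Computing adjacency lists (arrays 4 and 5) and the numbers of incoming edges (array 6). -/
def adjacencyProg : Prog := forUp 11 1 adjacencyStep

/-- Adjacency lists are threaded backwards: array 4 points to the last edge out of a vertex, array 5
from an edge to the previous one with the same tail. Pointers are shifted by one so that zero ends a
list. -/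
theorem runs_adjacencyProg {m : ℕ} {σ : State} (hm : σ.reg 1 = m) (hmw : m < 2 ^ w)
    (h4 : ∀ i, σ.arr 4 i = 0) (h6 : ∀ i, σ.arr 6 i = 0) :
    Runs w ω adjacencyProg σ ((m + 1) * (adjacencyStep.maxCost + 8)) (fun τ =>
      (∀ u, τ.arr 4 u = lastOut (σ.arr 0) m u) ∧
      (∀ e < m, τ.arr 5 e = lastOut (σ.arr 0) e (σ.arr 0 e)) ∧
      ∀ v, τ.arr 6 v = inDegree m (σ.arr 1) 0 0 v) := by
  refine Runs.forUp rfl rfl rfl rfl hm hmw (fun i τ =>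
      (∀ u, τ.arr 4 u = lastOut (σ.arr 0) i u) ∧
      (∀ e < i, τ.arr 5 e = lastOut (σ.arr 0) e (σ.arr 0 e)) ∧
      ∀ v, τ.arr 6 v = inDegree i (σ.arr 1) 0 0 v) ?_ ?_
  · simp [lastOut, inDegree, h4, h6]
  · rintro i hi τ hF hr ⟨i4, i5, i6⟩
    have f0 : τ.arr 0 = σ.arr 0 := hF.arr 0 rfl
    have f1 : τ.arr 1 = σ.arr 1 := hF.arr 1 rfl
    have c1 : 1 % 2 ^ w = 1 := Nat.mod_eq_of_lt (by omega)
    have hle : ∀ v, inDegree i (σ.arr 1) 0 0 v ≤ i := fun v => by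
      refine (Finset.card_filter_le _ _).trans (by simp)
    have e1 : (i + 1) % 2 ^ w = i + 1 := Nat.mod_eq_of_lt (by omega)
    have e2 : ∀ v, (inDegree i (σ.arr 1) 0 0 v + 1) % 2 ^ w = inDegree i (σ.arr 1) 0 0 v + 1 :=
      fun v => Nat.mod_eq_of_lt (by have := hle v; omega)
    simp only [adjacencyStep, sem, Term.eval, Op.apply, State.setReg_arr, State.setArr_arr,
      State.setArr_reg, hr, f0, f1, c1, e1, i4, i6]
    refine ⟨fun u => ?_, fun e he => ?_, fun v => ?_⟩
    · simp [lastOut, eq_comm]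
    · by_cases hei : e = i
      · simp [hei]
      · simp [hei, i5 e (by omega)]
    · have hstep : inDegree (i + 1) (σ.arr 1) 0 0 v =
          inDegree i (σ.arr 1) 0 0 v + if σ.arr 1 i = v then 1 else 0 := by
        simp only [inDegree, Finset.range_add_one, Finset.filter_insert]
        by_cases hv : σ.arr 1 i = v <;> simp [hv]
      rw [hstep]
      by_cases hv : v = σ.arr 1 i
      · simp [hv, e2]
      · simp [hv, Ne.symm hv]

/-- Adding vertex number `reg 11` to the queue if it has no incoming edges. -/
def queueStep : Prog :=
  .ite (.get 6 (.reg 11)) (.assign 16 (.const 0))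
    (.seq (.put 7 (.reg 12) (.reg 11)) (.assign 12 (.op .add (.reg 12) (.const 1))))

/-- Collecting the vertices without incoming edges in the queue (array 7). -/
def queueProg : Prog := forUp 11 0 queueStep

/-- The invariant bounds the queue entries by the loop counter, which makes each new entry distinct
from the old ones. The output order is arbitrary because nothing has been output yet. -/
theorem runs_queueProg {n m : ℕ} {σ : State} {tl hd ord : ℕ → ℕ} (hn : σ.reg 0 = n)
    (hnw : n < 2 ^ w) (h12 : σ.reg 12 = 0) (h6 : ∀ v, σ.arr 6 v = inDegree m hd 0 0 v) :
    Runs w ω queueProg σ ((n + 1) * (queueStep.maxCost + 8)) (fun τ =>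
      KahnInv n m tl hd 0 0 (τ.reg 12) 0 (τ.arr 7) ord) := by
  have hind : ∀ v, inDegree m hd ord 0 v = σ.arr 6 v := fun v => by
    rw [h6]; simp [inDegree]
  have key : Runs w ω queueProg σ ((n + 1) * (queueStep.maxCost + 8)) (fun τ =>
      τ.reg 12 ≤ n ∧ (∀ i < τ.reg 12, τ.arr 7 i < n) ∧
      (∀ i < τ.reg 12, ∀ j < τ.reg 12, τ.arr 7 i = τ.arr 7 j → i = j) ∧
      ∀ v < n, σ.arr 6 v = 0 ↔ ∃ i < τ.reg 12, τ.arr 7 i = v) := by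
    refine Runs.forUp rfl rfl rfl rfl hn hnw (fun t τ =>
      τ.reg 12 ≤ t ∧ (∀ i < τ.reg 12, τ.arr 7 i < t) ∧
      (∀ i < τ.reg 12, ∀ j < τ.reg 12, τ.arr 7 i = τ.arr 7 j → i = j) ∧
      ∀ v < t, σ.arr 6 v = 0 ↔ ∃ i < τ.reg 12, τ.arr 7 i = v) ?_ ?_
    · simp [h12]
    · rintro t ht τ hF hr ⟨i1, i2, i3, i4⟩
      have f6 : τ.arr 6 = σ.arr 6 := hF.arr 6 rfl
      by_cases h0 : σ.arr 6 t = 0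
      · have c1 : 1 % 2 ^ w = 1 := Nat.mod_eq_of_lt (by omega)
        have e1 : (τ.reg 12 + 1) % 2 ^ w = τ.reg 12 + 1 := Nat.mod_eq_of_lt (by omega)
        simp only [queueStep, sem, Term.eval, Op.apply, hr, f6, h0, ne_eq, not_true_eq_false,
          if_false, State.setReg_arr, State.setArr_arr, State.setReg_reg, State.setArr_reg, c1, e1,
          true_and]
        norm_num
        have old : ∀ i < τ.reg 12, i ≠ τ.reg 12 := fun i hi => hi.ne
        refine ⟨i1, ?_, ?_, ?_⟩
        · intro i hi
          split_ifs with hc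
          · omega
          · have := i2 i (by omega); omega
        · intro i hi j hj
          split_ifs with hc hc' hc'
          · omega
          · intro h; have := i2 j (by omega); omega
          · intro h; have := i2 i (by omega); omega
          · exact i3 i (by omega) j (by omega)
        · intro v hv
          by_cases hvt : v = t
          · subst hvt
            simp only [h0, true_iff]
            exact ⟨τ.reg 12, by omega, by simp⟩
          · rw [i4 v (by omega)]
            constructor
            · rintro ⟨i, hi, h⟩
              exact ⟨i, by omega, by rw [if_neg (by omega)]; exact h⟩
            · rintro ⟨i, hi, h⟩
              split_ifs at h with hc
              · omega
              · exact ⟨i, by omega, h⟩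
      · simp only [queueStep, sem, Term.eval, hr, f6, h0, ne_eq, not_false_eq_true,
          if_true, State.setReg_arr, State.setReg_reg]
        norm_num
        refine ⟨by omega, fun i hi => by have := i2 i hi; omega, i3, fun v hv => ?_⟩
        by_cases hvt : v = t
        · subst hvt
          simp only [h0, false_iff, not_exists, not_and]
          intro i hi h
          have := i2 i hi
          omega
        · exact i4 v (by omega)
  refine key.mono le_rfl ?_
  rintro τ ⟨-, i2, i3, i4⟩
  refine ⟨by simp, by simp, by omega, i2, i3, by simp, by omega, by simp, ?_, by simp⟩
  intro v hv
  rw [hind]; exact i4 v hv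

/-- Outputting the next edge out of the current vertex. -/
def kahnEdge : Prog :=
  .seq (.put 8 (.reg 14) (.op .sub (.reg 15) (.const 1)))
    (.seq (.assign 14 (.op .add (.reg 14) (.const 1)))
    (.seq (.assign 16 (.get 1 (.op .sub (.reg 15) (.const 1))))
    (.seq (.put 6 (.reg 16) (.op .sub (.get 6 (.reg 16)) (.const 1)))
    (.seq (.assign 15 (.get 5 (.op .sub (.reg 15) (.const 1))))
    (.ite (.get 6 (.reg 16)) (.assign 16 (.const 0))
      (.seq (.put 7 (.reg 12) (.reg 16)) (.assign 12 (.op .add (.reg 12) (.const 1)))))))))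

theorem sem_kahnEdge {τ : State} {e c v d b q : ℕ} (h1 : 1 % 2 ^ w = 1)
    (he : (τ.reg 15 + 2 ^ w - 1) % 2 ^ w = e) (hc : (τ.reg 14 + 1) % 2 ^ w = c)
    (hv : τ.arr 1 e = v) (hd : (τ.arr 6 v + 2 ^ w - 1) % 2 ^ w = d)
    (hb : (τ.reg 12 + 1) % 2 ^ w = b) (hq : τ.arr 5 e = q) :
    sem w ω kahnEdge τ =
      if d = 0 then
        (((((((τ.setArr 8 (τ.reg 14) e).setReg 14 c).setReg 16 v).setArr 6 v d).setReg 15 q).setArr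
          7 (τ.reg 12) v).setReg 12 b)
      else
        (((((τ.setArr 8 (τ.reg 14) e).setReg 14 c).setReg 16 v).setArr 6 v d).setReg 15 q).setReg
          16 0 := by
  by_cases h0 : d = 0 <;>
  simp [kahnEdge, sem, Term.eval, Op.apply, h1, he, hc, hv, hd, hb, hq, h0]

/-- Removing the next vertex from the queue. -/
def kahnVertex : Prog :=
  .seq (.assign 15 (.get 4 (.get 7 (.reg 13)))) (.assign 13 (.op .add (.reg 13) (.const 1)))

/-- Topological sorting: the sorted list of edges is put into array 8. -/
def kahnProg : Prog :=
  .loop (.op .add (.reg 15) (.op .lt (.reg 13) (.reg 12))) (.ite (.reg 15) kahnEdge kahnVertex)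

/-- The time for a step of the topological sorting. -/
def kahnCost : ℕ := (Prog.ite (.reg 15) kahnEdge kahnVertex).maxCost + 10

/-- Each round outputs an edge or removes a vertex, so (m - outputs) + (n - removals) drops by one
and pays for the round. The guard vanishes only when no edge is pending and the queue is empty,
which is the situation of `KahnInv.complete`. -/
theorem runs_kahnProg {n m : ℕ} {σ : State} {tl hd : ℕ → ℕ}
    (hn : n + 1 < 2 ^ w) (hm : m + 1 < 2 ^ w) (h1 : σ.arr 1 = hd)
    (htl : ∀ e < m, tl e < n) (hhd : ∀ e < m, hd e < n)
    (hac : ∀ v, ¬ Relation.TransGen (fun u v => ∃ e < m, tl e = u ∧ hd e = v) v v)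
    (h4 : ∀ u, σ.arr 4 u = lastOut tl m u) (h5 : ∀ e < m, σ.arr 5 e = lastOut tl e (tl e))
    (h6 : ∀ v, σ.arr 6 v = inDegree m hd 0 0 v) (h13 : σ.reg 13 = 0) (h14 : σ.reg 14 = 0)
    (h15 : σ.reg 15 = 0) (hq : KahnInv n m tl hd 0 0 (σ.reg 12) 0 (σ.arr 7) (σ.arr 8)) :
    Runs w ω kahnProg σ ((m + n + 1) * kahnCost) (fun τ =>
      (∀ i < m, τ.arr 8 i < m) ∧ (∀ e < m, ∃ i < m, τ.arr 8 i = e) ∧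
      (∀ i < m, ∀ j < m, τ.arr 8 i = τ.arr 8 j → i = j) ∧
      ∀ i < m, ∀ f < m, hd f = tl (τ.arr 8 i) → ∃ j < i, τ.arr 8 j = f) := by
  let I : State → Prop := fun τ => KahnInv n m tl hd (τ.reg 14) (τ.reg 13) (τ.reg 12) (τ.reg 15)
    (τ.arr 7) (τ.arr 8) ∧ (∀ v, τ.arr 6 v = inDegree m hd (τ.arr 8) (τ.reg 14) v) ∧
    τ.arr 1 = hd ∧ (∀ u, τ.arr 4 u = lastOut tl m u) ∧ ∀ e < m, τ.arr 5 e = lastOut tl e (tl e)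
  have hI : I σ := by
    refine ⟨by rw [h13, h14, h15]; exact hq, fun v => ?_, h1, h4, h5⟩
    rw [h6, h14]; simp [inDegree]
  have c1 : 1 % 2 ^ w = 1 := Nat.mod_eq_of_lt (by omega)
  have guard : ∀ τ, I τ → (Term.op .add (.reg 15) (.op .lt (.reg 13) (.reg 12))).eval w τ =
      τ.reg 15 + if τ.reg 13 < τ.reg 12 then 1 else 0 := by
    rintro τ ⟨hK, -⟩
    have := hK.ptr_le
    by_cases h : τ.reg 13 < τ.reg 12
    · simp only [Term.eval, Op.apply, h, if_true, c1]
      exact Nat.mod_eq_of_lt (by omega)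
    · simp only [Term.eval, Op.apply, h, if_false, Nat.zero_mod, add_zero]
      exact Nat.mod_eq_of_lt (by omega)
  have key := Runs.loop (w := w) (ω := ω)
    (x := .op .add (.reg 15) (.op .lt (.reg 13) (.reg 12)))
    (p := .ite (.reg 15) kahnEdge kahnVertex) I
    (fun τ => ((m - τ.reg 14) + (n - τ.reg 13)) * kahnCost) ?_ hI
  · refine key.mono ?_ ?_
    · rw [h13, h14, Nat.sub_zero, Nat.sub_zero, add_mul _ 1]
      simp only [Term.cost, kahnCost]
      omega
    · rintro τ ⟨hτ, hx⟩
      rw [guard τ hτ] at hx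
      obtain ⟨hK, -⟩ := hτ
      have e15 : τ.reg 15 = 0 := by omega
      have hle := hK.le
      have e12 : τ.reg 12 = τ.reg 13 := by
        split_ifs at hx <;> omega
      rw [e15, e12] at hK
      obtain ⟨e14, hall⟩ := hK.complete htl hac
      rw [e14] at hK
      exact ⟨hK.ord_lt, hall, hK.ord_inj, hK.sorted⟩
  · intro τ hτ hx
    rw [guard τ hτ] at hx
    obtain ⟨hK, k6, k1, k4, k5⟩ := hτ
    refine ⟨_, (runs_sem (w := w) (ω := ω) (p := .ite (.reg 15) kahnEdge kahnVertex) rfl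
      (Q := fun τ' => I τ' ∧ (m - τ'.reg 14) + (n - τ'.reg 13) + 1 ≤
        (m - τ.reg 14) + (n - τ.reg 13)) ?_).mono le_rfl ?_⟩
    · have hcm := hK.count_le
      have hbn := hK.queue_le
      have hab := hK.le
      by_cases hp : τ.reg 15 = 0
      · have hlt : τ.reg 13 < τ.reg 12 := by
          by_contra hlt; simp [hp, hlt] at hx
        have e1 : (τ.reg 13 + 1) % 2 ^ w = τ.reg 13 + 1 := Nat.mod_eq_of_lt (by omega)
        rw [hp] at hK
        have hK' := hK.vertex hlt
        simp only [sem, Term.eval, hp, ne_eq, not_true_eq_false, if_false, kahnVertex, I,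
          State.setReg_reg, State.setReg_arr, Op.apply, c1]
        norm_num
        rw [e1, k4]
        exact ⟨⟨hK', k6, k1, k4, k5⟩, by omega⟩
      · have hK' := hK.edge hp hhd
        -- The bound for the next state shows that the potential can still decrease: truncated
        -- subtraction has not reached zero.
        have hcm' := hK'.count_le
        have hbn' := hK'.queue_le
        have hpm := hK.ptr_le
        have hdeg := hK.inDegree_succ hp
        have hnd := hdeg (hd (τ.reg 15 - 1))
        rw [if_pos rfl] at hnd
        have hdm : inDegree m hd (τ.arr 8) (τ.reg 14) (hd (τ.reg 15 - 1)) ≤ m :=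
          (Finset.card_filter_le _ _).trans (by simp)
        have e1 : (τ.reg 15 + 2 ^ w - 1) % 2 ^ w = τ.reg 15 - 1 :=
          sub_mod_eq (by omega) (by omega)
        have e2 : (τ.reg 14 + 1) % 2 ^ w = τ.reg 14 + 1 := Nat.mod_eq_of_lt (by omega)
        have e3 : (inDegree m hd (τ.arr 8) (τ.reg 14) (hd (τ.reg 15 - 1)) + 2 ^ w - 1) % 2 ^ w =
            inDegree m hd (Function.update (τ.arr 8) (τ.reg 14) (τ.reg 15 - 1)) (τ.reg 14 + 1)
              (hd (τ.reg 15 - 1)) := by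
          rw [sub_mod_eq (by omega) (by omega)]; omega
        have e4 : (τ.reg 12 + 1) % 2 ^ w = τ.reg 12 + 1 := Nat.mod_eq_of_lt (by omega)
        have h5' := k5 (τ.reg 15 - 1) (by omega)
        have hs := sem_kahnEdge (w := w) (ω := ω) (τ := τ) c1 e1 e2 (congrFun k1 _)
          ((congrArg (fun x => (x + 2 ^ w - 1) % 2 ^ w) (k6 _)).trans e3) e4 h5'
        have hite : sem w ω (.ite (.reg 15) kahnEdge kahnVertex) τ = sem w ω kahnEdge τ := by
          simp only [sem, Term.eval, ne_eq, hp, not_false_eq_true, if_true]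
        rw [hite, hs]
        clear hite hs
        have hfun : ∀ (f : ℕ → ℕ) (i v : ℕ), (fun x => if x = i then v else f x) =
            Function.update f i v := fun f i v => by
          funext x; rw [Function.update_apply]
        have k6' : ∀ v, (if v = hd (τ.reg 15 - 1) then
            inDegree m hd (Function.update (τ.arr 8) (τ.reg 14) (τ.reg 15 - 1)) (τ.reg 14 + 1)
              (hd (τ.reg 15 - 1)) else τ.arr 6 v) =
            inDegree m hd (Function.update (τ.arr 8) (τ.reg 14) (τ.reg 15 - 1)) (τ.reg 14 + 1) v := by
          intro v
          split_ifs with hv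
          · rw [hv]
          · have := hdeg v
            rw [if_neg (Ne.symm hv), add_zero] at this
            rw [k6, this]
        by_cases h0 : inDegree m hd (Function.update (τ.arr 8) (τ.reg 14) (τ.reg 15 - 1))
            (τ.reg 14 + 1) (hd (τ.reg 15 - 1)) = 0
        · rw [if_pos h0] at hK' ⊢
          rw [if_pos h0] at hK'
          refine ⟨⟨?_, ?_, ?_, ?_, ?_⟩, ?_⟩
          · simpa [State.setArr, State.setReg, Function.update_apply, hfun] using hK'
          · simpa [State.setArr, State.setReg, Function.update_apply, hfun] using k6'
          · simpa [State.setArr, State.setReg, Function.update_apply] using k1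
          · simpa [State.setArr, State.setReg, Function.update_apply] using k4
          · simpa [State.setArr, State.setReg, Function.update_apply] using k5
          · simp only [State.setReg_reg, State.setArr_reg]
            norm_num
            omega
        · rw [if_neg h0] at hK' ⊢
          rw [if_neg h0] at hK'
          refine ⟨⟨?_, ?_, ?_, ?_, ?_⟩, ?_⟩
          · simpa [State.setArr, State.setReg, Function.update_apply, hfun] using hK'
          · simpa [State.setArr, State.setReg, Function.update_apply, hfun] using k6'
          · simpa [State.setArr, State.setReg, Function.update_apply] using k1
          · simpa [State.setArr, State.setReg, Function.update_apply] using k4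
          · simpa [State.setArr, State.setReg, Function.update_apply] using k5
          · simp only [State.setReg_reg, State.setArr_reg]
            norm_num
            omega
    · rintro τ' ⟨hI', hlt⟩
      refine ⟨hI', ?_⟩
      have := Nat.mul_le_mul_right kahnCost hlt
      rw [add_mul _ 1] at this
      simp only [Term.cost]
      have : kahnCost = (Prog.ite (.reg 15) kahnEdge kahnVertex).maxCost + 10 := rfl
      omega

end WordRAM

/-! ### Distances in a directed acyclic graph -/

/-- Relaxing an edge from `u` to `v` of length `l`; the value 0 stands for infinity. -/
def relaxEdge (N : ℕ → ℕ) (u v l : ℕ) : ℕ → ℕ :=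
  if N u ≠ 0 ∧ (N v = 0 ∨ N u + l < N v) then Function.update N v (N u + l) else N

/-- The tentative distances after relaxing the first `j` edges, offset by `base`. -/
def relaxUpTo (s base : ℕ) (src dst len : ℕ → ℕ) : ℕ → ℕ → ℕ
  | 0 => Function.update 0 s base
  | j + 1 => relaxEdge (relaxUpTo s base src dst len j) (src j) (dst j) (len j)

theorem relaxEdge_of_ne {N : ℕ → ℕ} {u v l x : ℕ} (h : v ≠ x) : relaxEdge N u v l x = N x := by
  unfold relaxEdge; split_ifs
  · rw [Function.update_of_ne h.symm]
  · rfl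

theorem relaxEdge_cases (N : ℕ → ℕ) (u v l x : ℕ) :
    relaxEdge N u v l x = N x ∨
      (x = v ∧ N u ≠ 0 ∧ relaxEdge N u v l x = N u + l ∧ (N x = 0 ∨ N u + l < N x)) := by
  unfold relaxEdge; split_ifs with h
  · by_cases hx : x = v
    · subst hx; exact .inr ⟨rfl, h.1, by simp, h.2⟩
    · exact .inl (by rw [Function.update_of_ne hx])
  · exact .inl rfl

theorem relaxEdge_le {N : ℕ → ℕ} {u v l x : ℕ} (h : N x ≠ 0) :
    relaxEdge N u v l x ≤ N x := by
  rcases relaxEdge_cases N u v l x with h' | ⟨-, -, h1, h2⟩ <;> omega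

theorem relaxEdge_ne_zero {N : ℕ → ℕ} {u v l x : ℕ} (h : N x ≠ 0) :
    relaxEdge N u v l x ≠ 0 := by
  rcases relaxEdge_cases N u v l x with h' | ⟨-, h0, h1, h2⟩ <;> omega

theorem relaxEdge_self {N : ℕ → ℕ} {u v l : ℕ} (h : N u ≠ 0) :
    relaxEdge N u v l v ≠ 0 ∧ relaxEdge N u v l v ≤ N u + l := by
  unfold relaxEdge; split_ifs with h'
  · simp only [Function.update_self]; omega
  · simp only [h, ne_eq, not_false_eq_true, true_and, not_or, not_lt] at h'
    exact h'

/-- Every defined value is at least `base`, so no relaxation can improve the value at the source. -/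
theorem relaxUpTo_source {s base : ℕ} {src dst len : ℕ → ℕ} (hb : 0 < base) (j : ℕ) :
    relaxUpTo s base src dst len j s = base ∧
      ∀ v, relaxUpTo s base src dst len j v ≠ 0 → base ≤ relaxUpTo s base src dst len j v := by
  induction j with
  | zero =>
    simp only [relaxUpTo, Function.update_self, true_and]
    intro v hv
    by_cases h : v = s
    · simp [h]
    · simp [Function.update_of_ne h] at hv
  | succ j ih =>
    simp only [relaxUpTo]
    set N := relaxUpTo s base src dst len j
    constructor
    · rcases relaxEdge_cases N (src j) (dst j) (len j) s with h | ⟨-, h1, -, h2⟩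
      · rw [h, ih.1]
      · have := ih.2 _ h1
        have := ih.1
        omega
    · intro v hv
      rcases relaxEdge_cases N (src j) (dst j) (len j) v with h | ⟨-, h1, h3, h2⟩
      · rw [h] at hv ⊢; exact ih.2 v hv
      · have := ih.2 _ h1
        omega

/-- One pass suffices in topological order: when an edge is relaxed, the value at its tail is
already final. Both the relaxation inequalities and the predecessor equations therefore persist. -/
theorem relaxUpTo_edges {s base m : ℕ} {src dst len : ℕ → ℕ}
    (hs : ∀ i j, i ≤ j → j < m → dst j ≠ src i) {j : ℕ} (hj : j ≤ m) :
    (∀ i < j, relaxUpTo s base src dst len j (src i) ≠ 0 →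
      relaxUpTo s base src dst len j (dst i) ≠ 0 ∧
      relaxUpTo s base src dst len j (dst i) ≤ relaxUpTo s base src dst len j (src i) + len i) ∧
    ∀ v, relaxUpTo s base src dst len j v ≠ 0 → v = s ∨ ∃ i < j, dst i = v ∧
      relaxUpTo s base src dst len j (src i) ≠ 0 ∧
      relaxUpTo s base src dst len j v = relaxUpTo s base src dst len j (src i) + len i := by
  induction j with
  | zero =>
    refine ⟨by simp, fun v hv => .inl ?_⟩
    by_contra h
    simp [relaxUpTo, Function.update_of_ne h] at hv
  | succ j ih =>
    obtain ⟨i1, i2⟩ := ih (by omega)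
    simp only [relaxUpTo]
    set N := relaxUpTo s base src dst len j
    -- Relaxing edge `j` changes only its head, which is the tail of no edge up to and including
    -- `j`.
    have hsrc : ∀ i ≤ j, relaxEdge N (src j) (dst j) (len j) (src i) = N (src i) := fun i hi =>
      relaxEdge_of_ne (hs i j hi (by omega))
    constructor
    · intro i hi h
      rw [hsrc i (by omega)] at h ⊢
      by_cases hij : i = j
      · subst hij; exact relaxEdge_self h
      · obtain ⟨h1, h2⟩ := i1 i (by omega) h
        exact ⟨relaxEdge_ne_zero h1, (relaxEdge_le h1).trans h2⟩
    · intro v hv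
      rcases relaxEdge_cases N (src j) (dst j) (len j) v with h | ⟨hx, h1, h3, h2⟩
      · rw [h] at hv ⊢
        rcases i2 v hv with h' | ⟨i, hi, h4, h5, h6⟩
        · exact .inl h'
        · exact .inr ⟨i, by omega, h4, by rw [hsrc i (by omega)]; exact ⟨h5, h6⟩⟩
      · exact .inr ⟨j, by omega, hx.symm, by rw [hsrc j le_rfl]; exact ⟨h1, h3⟩⟩

theorem isDist_relaxUpTo {n m : ℕ} {G : WeightedDAG n} (s : Fin n) {base : ℕ}
    {src dst len : ℕ → ℕ} (hb : 0 < base)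
    (edge : ∀ j < m, ∃ u v : Fin n, G.graph.Adj u v ∧ src j = u ∧ dst j = v ∧
      len j = G.weight u v)
    (surj : ∀ u v : Fin n, G.graph.Adj u v → ∃ j < m, src j = u ∧ dst j = v)
    (sorted : ∀ i j, i ≤ j → j < m → dst j ≠ src i) :
    G.IsDist s base (relaxUpTo s base src dst len m) := by
  obtain ⟨h1, h2⟩ := relaxUpTo_edges (s := s) (base := base) (len := len) sorted le_rfl
  obtain ⟨h3, h4⟩ := relaxUpTo_source (s := s) (src := src) (dst := dst) (len := len) hb m
  refine ⟨hb, h3, fun v => h4 v, ?_, ?_⟩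
  · intro u v huv hu
    obtain ⟨j, hj, hju, hjv⟩ := surj u v huv
    obtain ⟨u', v', -, hu', hv', hl⟩ := edge j hj
    obtain rfl : u' = u := Fin.ext (by omega)
    obtain rfl : v' = v := Fin.ext (by omega)
    rw [← hju] at hu
    have := h1 j hj hu
    rwa [hjv, hju, hl] at this
  · intro v hv
    rcases h2 v hv with h | ⟨j, hj, hjv, hj0, hjl⟩
    · exact .inl (Fin.ext h)
    · obtain ⟨u', v', hadj, hu', hv', hl⟩ := edge j hj
      obtain rfl : v' = v := Fin.ext (by omega)
      rw [hu'] at hj0 hjl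
      exact .inr ⟨u', hadj, hj0, by rw [hjl, hl]⟩

/-! ### Two-word distances on the word RAM -/

namespace WordRAM

variable {w : ℕ} {ω : ℕ → ℕ}

/-- The two-word numbers with high words (at most `B`) in array `hi` and low words in array
`lo`. -/
structure Wide (w : ℕ) (σ : State) (hi lo B : ℕ) (N : ℕ → ℕ) : Prop where
  val : ∀ v, N v = σ.arr hi v * 2 ^ w + σ.arr lo v
  lo_lt : ∀ v, σ.arr lo v < 2 ^ w
  hi_le : ∀ v, σ.arr hi v ≤ B
  zero : ∀ v, σ.arr hi v = 0 → σ.arr lo v = 0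

theorem Wide.eq_zero {σ : State} {hi lo B : ℕ} {N : ℕ → ℕ} (h : Wide w σ hi lo B N) (v : ℕ) :
    N v = 0 ↔ σ.arr hi v = 0 := by
  rw [h.val]
  constructor
  · intro h0
    have := Nat.two_pow_pos w
    by_contra h1
    have : 0 < σ.arr hi v * 2 ^ w := Nat.mul_pos (by omega) this
    omega
  · intro h0; rw [h0, h.zero v h0]; simp

theorem Wide.congr {σ τ : State} {hi lo B : ℕ} {N : ℕ → ℕ} (h : Wide w σ hi lo B N)
    (hhi : τ.arr hi = σ.arr hi) (hlo : τ.arr lo = σ.arr lo) : Wide w τ hi lo B N :=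
  ⟨by rw [hhi, hlo]; exact h.val, by rw [hlo]; exact h.lo_lt, by rw [hhi]; exact h.hi_le,
    by rw [hhi, hlo]; exact h.zero⟩

theorem lex_lt {a b x y W : ℕ} (hx : x < W) (hy : y < W) :
    a * W + x < b * W + y ↔ a < b ∨ a = b ∧ x < y := by
  constructor
  · intro h
    rcases lt_trichotomy a b with h1 | h1 | h1
    · exact .inl h1
    · subst h1; exact .inr ⟨rfl, by omega⟩
    · have := Nat.mul_le_mul_right W h1
      rw [Nat.succ_mul] at this
      omega
  · rintro (h1 | ⟨rfl, h1⟩)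
    · have := Nat.mul_le_mul_right W h1
      rw [Nat.succ_mul] at this
      omega
    · omega

theorem lex_eq {a b x y W : ℕ} (hx : x < W) (hy : y < W) :
    a * W + x = b * W + y ↔ a = b ∧ x = y := by
  constructor
  · intro h
    have h1 := (lex_lt (a := a) (b := b) hx hy).not.1 (by omega)
    have h2 := (lex_lt (a := b) (b := a) hy hx).not.1 (by omega)
    omega
  · rintro ⟨rfl, rfl⟩; rfl

/-- Adding with carry. -/
theorem add_carry {x y W : ℕ} (hx : x < W) (hy : y < W) :
    x + y = (if (x + y) % W < y then 1 else 0) * W + (x + y) % W := by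
  by_cases h : x + y < W
  · rw [Nat.mod_eq_of_lt h, if_neg (by omega)]; omega
  · have : (x + y) % W = x + y - W := by
      rw [Nat.mod_eq_sub_mod (by omega), Nat.mod_eq_of_lt (by omega)]
    rw [this, if_pos (by omega)]; omega

/-- Storing the tentative distance for `reg 18`. -/
def distPut (hi lo : ℕ) : Prog :=
  .seq (.put hi (.reg 18) (.reg 20)) (.put lo (.reg 18) (.reg 19))

/-- Relaxing edge number `reg 11` of the sorted list. -/
def distStep (hi lo : ℕ) : Prog :=
  .seq (.assign 16 (.get 8 (.reg 11)))
  (.seq (.assign 17 (.get 0 (.reg 16)))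
  (.seq (.assign 18 (.get 1 (.reg 16)))
  (.seq (.assign 19 (.op .add (.get lo (.reg 17)) (.get 2 (.reg 16))))
  (.seq (.assign 20 (.op .add (.get hi (.reg 17)) (.op .lt (.reg 19) (.get 2 (.reg 16)))))
  (.ite (.get hi (.reg 17))
    (.ite (.get hi (.reg 18))
      (.ite (.op .lt (.reg 20) (.get hi (.reg 18))) (distPut hi lo)
        (.ite (.op .eq (.reg 20) (.get hi (.reg 18)))
          (.ite (.op .lt (.reg 19) (.get lo (.reg 18))) (distPut hi lo) (.assign 16 (.const 0)))
          (.assign 16 (.const 0))))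
      (distPut hi lo))
    (.assign 16 (.const 0)))))))

theorem arr_sem_distStep {τ : State} {hi lo e u v l L H : ℕ} (c1 : 1 % 2 ^ w = 1)
    (he : τ.arr 8 (τ.reg 11) = e) (hu : τ.arr 0 e = u) (hv : τ.arr 1 e = v) (hl : τ.arr 2 e = l)
    (hL : (τ.arr lo u + l) % 2 ^ w = L)
    (hH : (τ.arr hi u + if L < l then 1 else 0) % 2 ^ w = H) :
    (sem w ω (distStep hi lo) τ).arr =
      if τ.arr hi u ≠ 0 ∧ (τ.arr hi v = 0 ∨ H < τ.arr hi v ∨ H = τ.arr hi v ∧ L < τ.arr lo v) then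
        ((τ.setArr hi v H).setArr lo v L).arr
      else τ.arr := by
  have hH' : (τ.arr hi u + (if L < l then 1 else 0) % 2 ^ w) % 2 ^ w = H := by
    rw [← hH]; congr 2; split_ifs <;> simp [c1]
  have hb : ∀ P : Prop, [Decidable P] → ((if P then 1 else 0) % 2 ^ w ≠ 0 ↔ P) := by
    intro P _; split_ifs with h <;> simp [c1, h]
  have key : ∀ τ' : State, τ'.arr = τ.arr → τ'.reg 17 = u → τ'.reg 18 = v → τ'.reg 19 = L →
      τ'.reg 20 = H → (sem w ω (.ite (.get hi (.reg 17))
    (.ite (.get hi (.reg 18))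
      (.ite (.op .lt (.reg 20) (.get hi (.reg 18))) (distPut hi lo)
        (.ite (.op .eq (.reg 20) (.get hi (.reg 18)))
          (.ite (.op .lt (.reg 19) (.get lo (.reg 18))) (distPut hi lo) (.assign 16 (.const 0)))
          (.assign 16 (.const 0))))
      (distPut hi lo))
    (.assign 16 (.const 0))) τ').arr = if τ.arr hi u ≠ 0 ∧
      (τ.arr hi v = 0 ∨ H < τ.arr hi v ∨ H = τ.arr hi v ∧ L < τ.arr lo v) then
        ((τ.setArr hi v H).setArr lo v L).arr
      else τ.arr := by
    intro τ' ha h17 h18 h19 h20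
    have hput : (sem w ω (distPut hi lo) τ').arr = ((τ.setArr hi v H).setArr lo v L).arr := by
      simp [distPut, sem, Term.eval, h18, h19, h20, State.setArr, ha]
    have hskip : (sem w ω (.assign 16 (.const 0)) τ').arr = τ.arr := by simp [sem, ha]
    simp only [sem, Term.eval, Op.apply, h17, h18, h19, h20, ha, hb] at hput hskip ⊢
    by_cases h1 : τ.arr hi u = 0
    · simp [h1, ha]
    by_cases h2 : τ.arr hi v = 0
    · simp [h1, h2, hput]
    by_cases h3 : H < τ.arr hi v
    · simp [h1, h2, h3, hput]
    by_cases h4 : H = τ.arr hi v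
    · by_cases h5 : L < τ.arr lo v
      · simp [h1, h2, h4, h5, hput]
      · simp [h1, h2, h4, h5, ha]
    · simp [h1, h2, h3, h4, ha]
  simp only [distStep, sem] at key ⊢
  apply key
  · simp
  · simp [Term.eval, he, hu]
  · simp [Term.eval, he, hv]
  · simp [Term.eval, Op.apply, he, hu, hl, hL]
  · simp [Term.eval, Op.apply, he, hu, hl, hL, hH']

/-- A weight fits into one word, so an addition carries at most 1 into the high word. The bound thus
grows by one per edge, and two words suffice for the whole pass. -/
theorem wide_distStep {τ : State} {hi lo B e u v l : ℕ} {N : ℕ → ℕ} (hne : hi ≠ lo)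
    (hN : Wide w τ hi lo B N) (hB : B + 1 < 2 ^ w) (he : τ.arr 8 (τ.reg 11) = e)
    (hu : τ.arr 0 e = u) (hv : τ.arr 1 e = v) (hl : τ.arr 2 e = l) (hlw : l < 2 ^ w) :
    Wide w (sem w ω (distStep hi lo) τ) hi lo (B + 1) (relaxEdge N u v l) := by
  have c1 : 1 % 2 ^ w = 1 := Nat.mod_eq_of_lt (by omega)
  set L := (τ.arr lo u + l) % 2 ^ w with hL
  set H := (τ.arr hi u + if L < l then 1 else 0) % 2 ^ w with hH
  have hHe : H = τ.arr hi u + if L < l then 1 else 0 := by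
    have := hN.hi_le u
    rw [hH]; apply Nat.mod_eq_of_lt; split_ifs <;> omega
  have hLw : L < 2 ^ w := Nat.mod_lt _ (by positivity)
  have hsum : N u + l = H * 2 ^ w + L := by
    have := add_carry (hN.lo_lt u) hlw
    rw [← hL] at this
    rw [hN.val u, hHe, add_mul]
    omega
  have ha := arr_sem_distStep (ω := ω) c1 he hu hv hl hL.symm hH.symm
  have hcond : (N u ≠ 0 ∧ (N v = 0 ∨ N u + l < N v)) ↔ (τ.arr hi u ≠ 0 ∧
      (τ.arr hi v = 0 ∨ H < τ.arr hi v ∨ H = τ.arr hi v ∧ L < τ.arr lo v)) := by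
    rw [ne_eq, hN.eq_zero, hN.eq_zero, hsum, hN.val v, lex_lt hLw (hN.lo_lt v)]
  by_cases hc : N u ≠ 0 ∧ (N v = 0 ∨ N u + l < N v)
  · rw [if_pos (hcond.1 hc)] at ha
    have hu0 := (hcond.1 hc).1
    have hhi : ∀ x, (sem w ω (distStep hi lo) τ).arr hi x = if x = v then H else τ.arr hi x := by
      intro x; rw [ha]; simp [hne]
    have hlo : ∀ x, (sem w ω (distStep hi lo) τ).arr lo x = if x = v then L else τ.arr lo x := by
      intro x; rw [ha]; simp [hne.symm]
    have hr : relaxEdge N u v l = Function.update N v (N u + l) := by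
      rw [relaxEdge, if_pos hc]
    refine ⟨fun x => ?_, fun x => ?_, fun x => ?_, fun x => ?_⟩
    · rw [hhi, hlo, hr, Function.update_apply]
      split_ifs
      · exact hsum
      · exact hN.val x
    · rw [hlo]; split_ifs
      · exact hLw
      · exact hN.lo_lt x
    · have := hN.hi_le x
      have := hN.hi_le u
      rw [hhi]; split_ifs
      · rw [hHe]; split_ifs <;> omega
      · omega
    · rw [hhi, hlo]; split_ifs
      · omega
      · exact hN.zero x
  · rw [if_neg (hcond.not.1 hc)] at ha
    rw [relaxEdge, if_neg hc]
    exact ⟨by rw [ha]; exact hN.val, by rw [ha]; exact hN.lo_lt,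
      fun x => by rw [ha]; exact (hN.hi_le x).trans (by omega), by rw [ha]; exact hN.zero⟩

/-- Computing the distances from the vertex in register `r`. -/
def distProg (r hi lo : ℕ) : Prog :=
  .seq (.put hi (.reg r) (.const 1)) (forUp 11 1 (distStep hi lo))

/-- The source starts with high word 1 and low word 0, which is the offset 2^w. Every defined
distance then has a nonzero high word, so definedness is tested on that word alone. -/
theorem runs_distProg {r hi lo m : ℕ} {σ : State} {src dst len : ℕ → ℕ} (hne : hi ≠ lo)
    (hm : σ.reg 1 = m) (hmw : m + 1 < 2 ^ w)
    (w0 : (distProg r hi lo).warr 0 = false) (w1 : (distProg r hi lo).warr 1 = false)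
    (w2 : (distProg r hi lo).warr 2 = false) (w8 : (distProg r hi lo).warr 8 = false)
    (hhi : ∀ v, σ.arr hi v = 0) (hlo : ∀ v, σ.arr lo v = 0)
    (hsrc : ∀ j < m, σ.arr 0 (σ.arr 8 j) = src j) (hdst : ∀ j < m, σ.arr 1 (σ.arr 8 j) = dst j)
    (hlen : ∀ j < m, σ.arr 2 (σ.arr 8 j) = len j) (hlw : ∀ j < m, len j < 2 ^ w) :
    Runs w ω (distProg r hi lo) σ ((m + 1) * ((distStep hi lo).maxCost + 8) + 3) (fun τ =>
      Wide w τ hi lo (m + 1) (relaxUpTo (σ.reg r) (2 ^ w) src dst len m)) := by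
  have c1 : 1 % 2 ^ w = 1 := Nat.mod_eq_of_lt (by omega)
  refine ((Runs.put hi (.reg r) (.const 1) σ).seq
    (T' := (m + 1) * ((distStep hi lo).maxCost + 8)) ?_).mono ?_ (fun _ h => h)
  · rintro ρ rfl
    have hFseq : ∀ {τ}, Frame (forUp 11 1 (distStep hi lo))
        (σ.setArr hi (Term.eval w σ (.reg r)) (Term.eval w σ (.const 1))) τ →
        Frame (distProg r hi lo) σ τ := fun h =>
      (Frame.seq_left (Exec.put (w := w) (ω := ω) hi (.reg r) (.const 1) σ).frame).trans
        (Frame.seq_right h)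
    refine Runs.forUp rfl rfl rfl rfl (M := m)
      (σ := σ.setArr hi (Term.eval w σ (.reg r)) (Term.eval w σ (.const 1))) hm (Nat.lt_of_succ_lt hmw) (fun j τ =>
      Wide w τ hi lo (j + 1) (relaxUpTo (σ.reg r) (2 ^ w) src dst len j)) ?_ ?_
    · refine ⟨fun v => ?_, fun v => ?_, fun v => ?_, fun v => ?_⟩
      · simp only [relaxUpTo, State.setReg_arr, State.setArr_arr, Term.eval, c1, hhi, hlo, hne,
          hne.symm, Function.update_apply]
        by_cases h : v = σ.reg r <;> simp [h]
      · simp [hlo, hne.symm]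
      · simp only [State.setReg_arr, State.setArr_arr, Term.eval, c1, hhi]
        split_ifs <;> simp
      · simp [hlo, hne.symm]
    · intro j hj τ hF hr hI
      have hF' := hFseq hF
      refine ⟨?_, ?_, ?_, ?_⟩
      all_goals
        have h := wide_distStep (ω := ω) (e := σ.arr 8 j) (u := src j) (v := dst j) (l := len j) hne
          hI (by omega) (by rw [hr, hF'.arr 8 w8]) (by rw [hF'.arr 0 w0, hsrc j hj])
          (by rw [hF'.arr 1 w1, hdst j hj]) (by rw [hF'.arr 2 w2, hlen j hj]) (hlw j hj)
      · exact h.val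
      · exact h.lo_lt
      · exact h.hi_le
      · exact h.zero
  · simp [Term.cost]; omega

end WordRAM

/-! ### Computing the edges with labels as vertices -/

namespace WordRAM

variable {w : ℕ} {ω : ℕ → ℕ}

theorem sem_ite_pos {x : Term} (p q : Prog) {σ : State} (h : x.eval w σ ≠ 0) :
    sem w ω (.ite x p q) σ = sem w ω p σ := by simp [sem, h]

theorem sem_ite_neg {x : Term} (p q : Prog) {σ : State} (h : ¬ x.eval w σ ≠ 0) :
    sem w ω (.ite x p q) σ = sem w ω q σ := if_neg h

/-- The term computes the truth value of the proposition. -/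
def Decides (w : ℕ) (σ : State) (x : Term) (P : Prop) : Prop :=
  (P → x.eval w σ = 1) ∧ (¬ P → x.eval w σ = 0)

namespace Decides

variable {σ : State} {x y : Term} {P Q : Prop}

theorem eval_eq [Decidable P] (h : Decides w σ x P) : x.eval w σ = if P then 1 else 0 := by
  split_ifs with hP
  · exact h.1 hP
  · exact h.2 hP

theorem ne_zero (h : Decides w σ x P) : x.eval w σ ≠ 0 ↔ P := by
  classical
  rw [h.eval_eq]; split_ifs with hP <;> simp [hP]

theorem congr (h : Decides w σ x P) (hPQ : P ↔ Q) : Decides w σ x Q :=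
  ⟨fun hQ => h.1 (hPQ.2 hQ), fun hQ => h.2 (hPQ.not.2 hQ)⟩

theorem and (c1 : 1 % 2 ^ w = 1) (h : Decides w σ x P) (h' : Decides w σ y Q) :
    Decides w σ (.op .and x y) (P ∧ Q) := by
  classical
  have e := h.eval_eq
  have e' := h'.eval_eq
  by_cases hP : P <;> by_cases hQ : Q <;> simp [Decides, Term.eval, Op.apply, e, e', hP, hQ, c1]

theorem or (c1 : 1 % 2 ^ w = 1) (h : Decides w σ x P) (h' : Decides w σ y Q) :
    Decides w σ (.op .or x y) (P ∨ Q) := by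
  classical
  have e := h.eval_eq
  have e' := h'.eval_eq
  by_cases hP : P <;> by_cases hQ : Q <;> simp [Decides, Term.eval, Op.apply, e, e', hP, hQ, c1]

theorem eq (c1 : 1 % 2 ^ w = 1) {a b : ℕ} (h : x.eval w σ = a) (h' : y.eval w σ = b) :
    Decides w σ (.op .eq x y) (a = b) := by
  by_cases hab : a = b <;> simp [Decides, Term.eval, Op.apply, h, h', hab, c1]

theorem lt (c1 : 1 % 2 ^ w = 1) {a b : ℕ} (h : x.eval w σ = a) (h' : y.eval w σ = b) :
    Decides w σ (.op .lt x y) (a < b) := by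
  by_cases hab : a < b <;> simp [Decides, Term.eval, Op.apply, h, h', hab, c1]

theorem not (c1 : 1 % 2 ^ w = 1) (h : Decides w σ x P) :
    Decides w σ (.op .eq x (.const 0)) (¬ P) := by
  classical
  have e := h.eval_eq
  by_cases hP : P <;> simp [Decides, Term.eval, Op.apply, e, hP, c1]

end Decides

/-- Choosing `y` or `x` depending on whether `c` is 1 or 0. -/
def selectTerm (c x y : Term) : Term := .op .add x (.op .mul c (.op .sub y x))

theorem eval_selectTerm {σ : State} {c x y : Term} {P : Prop} [Decidable P] {a b : ℕ}
    (hc : Decides w σ c P) (hx : x.eval w σ = a) (hy : y.eval w σ = b) (hab : a ≤ b)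
    (hb : b < 2 ^ w) : (selectTerm c x y).eval w σ = if P then b else a := by
  have e := hc.eval_eq
  simp only [selectTerm, Term.eval, Op.apply, hx, hy, e]
  rw [sub_mod_eq hab hb]
  split_ifs
  · rw [one_mul, Nat.mod_eq_of_lt (a := b - a) (by omega), Nat.mod_eq_of_lt (by omega)]; omega
  · simp only [zero_mul, Nat.zero_mod, add_zero]; exact Nat.mod_eq_of_lt (by omega)

/-- Terms that do not read arrays. -/
def Term.regOnly : Term → Bool
  | .const _ => true
  | .reg _ => true
  | .get _ _ => false
  | .op _ x y => x.regOnly && y.regOnly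

theorem Term.eval_congr_reg {x : Term} (hx : x.regOnly = true) {σ τ : State}
    (h : σ.reg = τ.reg) : x.eval w σ = x.eval w τ := by
  induction x with
  | const c => rfl
  | reg r => simp [eval, h]
  | get a i => simp [regOnly] at hx
  | op o x y ihx ihy =>
    simp only [regOnly, Bool.and_eq_true] at hx
    simp only [eval, ihx hx.1, ihy hx.2]

/-- The edge with number `k` in arrays 13 to 16. -/
structure EdgeAt (σ : State) (k : ℕ) (f : FlagEdge) : Prop where
  tail : σ.arr 13 k = f.tail
  head : σ.arr 14 k = f.head
  flag_false : σ.arr 15 k = (f.flag false).toNat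
  flag_true : σ.arr 16 k = (f.flag true).toNat

/-- Storing an edge as number `k`. -/
def writeEdge (k x y a b : Term) : Prog :=
  .seq (.put 13 k x) (.seq (.put 14 k y) (.seq (.put 15 k a) (.put 16 k b)))

/-- The four stores happen one after another, so terms evaluated after a store must not read arrays;
`x` is exempt because it is evaluated before the first store. -/
theorem sem_writeEdge {σ : State} {k x y a b : Term} (hk : k.regOnly = true)
    (hy : y.regOnly = true) (ha : a.regOnly = true) (hb : b.regOnly = true) :
    sem w ω (writeEdge k x y a b) σ =
      (((σ.setArr 13 (k.eval w σ) (x.eval w σ)).setArr 14 (k.eval w σ) (y.eval w σ)).setArr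
        15 (k.eval w σ) (a.eval w σ)).setArr 16 (k.eval w σ) (b.eval w σ) := by
  have e : ∀ {z : Term}, z.regOnly = true → ∀ (τ : State) (a i v : ℕ),
      z.eval w (τ.setArr a i v) = z.eval w τ := fun hz _ _ _ _ => Term.eval_congr_reg hz rfl
  simp only [writeEdge, sem, e hk, e hy, e ha, e hb]

theorem edgeAt_writeEdge {σ : State} {k x y a b : Term} (hk : k.regOnly = true)
    (hy : y.regOnly = true) (ha : a.regOnly = true) (hb : b.regOnly = true) {i : ℕ}
    {f : FlagEdge} (hi : k.eval w σ = i) (hx' : x.eval w σ = f.tail) (hy' : y.eval w σ = f.head)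
    (ha' : a.eval w σ = (f.flag false).toNat) (hb' : b.eval w σ = (f.flag true).toNat) :
    (sem w ω (writeEdge k x y a b) σ).reg = σ.reg ∧ EdgeAt (sem w ω (writeEdge k x y a b) σ) i f ∧
    ∀ j ≠ i, ∀ g, EdgeAt σ j g → EdgeAt (sem w ω (writeEdge k x y a b) σ) j g := by
  rw [sem_writeEdge hk hy ha hb, hi, hx', hy', ha', hb']
  refine ⟨rfl, ⟨by simp, by simp, by simp, by simp⟩, fun j hj g hg => ?_⟩
  obtain ⟨g1, g2, g3, g4⟩ := hg
  exact ⟨by simp [hj, g1], by simp [hj, g2], by simp [hj, g3], by simp [hj, g4]⟩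

/-- The register with the source of path `i`. -/
def sourceReg (i : Bool) : ℕ := if i then 4 else 2

/-- The register with the target of path `i`. -/
def targetReg (i : Bool) : ℕ := if i then 5 else 3

/-- The array with the high words of the distances for path `i`. -/
def hiArr (i : Bool) : ℕ := if i then 11 else 9

/-- The array with the low words of the distances for path `i`. -/
def loArr (i : Bool) : ℕ := if i then 12 else 10

/-- The label of the source of path `i`. -/
def startTerm (i : Bool) : Term := .op .add (.reg 0) (.const i.toNat)

/-- The label of the target of path `i`. -/
def goalTerm (i : Bool) : Term :=
  selectTerm (.op .eq (.op .eq (.reg (sourceReg i)) (.reg (targetReg i))) (.const 0))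
    (startTerm i) (.op .add (startTerm i) (.const 2))

/-- Whether the vertex in register `r` is a terminal. -/
def terminalTerm (r : ℕ) : Term :=
  .op .or (.op .or (.op .eq (.reg r) (.reg 2)) (.op .eq (.reg r) (.reg 3)))
    (.op .or (.op .eq (.reg r) (.reg 4)) (.op .eq (.reg r) (.reg 5)))

/-- Whether the edge from `reg 17` to `reg 18` of length `reg 19` is tight for path `i`. -/
def tightTerm (i : Bool) : Term :=
  let l : Term := .op .add (.get (loArr i) (.reg 17)) (.reg 19)
  .op .and (.op .lt (.const 0) (.get (hiArr i) (.reg 17)))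
    (.op .and (.op .eq (.get (hiArr i) (.reg 18))
        (.op .add (.get (hiArr i) (.reg 17)) (.op .lt l (.reg 19))))
      (.op .eq (.get (loArr i) (.reg 18)) l))

/-- The register that holds whether the edge is tight for path `i`. -/
def tightReg (i : Bool) : ℕ := if i then 28 else 27

/-- The register with the number of the edge for path `i`. -/
def numberReg (i : Bool) : ℕ := if i then 30 else 29

/-- Whether path `i` may use the edge. -/
def usableTerm (i : Bool) : Term :=
  .op .and (.reg (tightReg i))
    (.op .and (.op .or (.op .eq (.reg 17) (.reg (sourceReg i))) (.op .eq (.reg 25) (.const 0)))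
      (.op .or (.op .eq (.reg 18) (.reg (targetReg i))) (.op .eq (.reg 26) (.const 0))))

/-- Storing an edge that is useless. -/
def writeDummy (i : Bool) : Prog :=
  writeEdge (.reg (numberReg i)) (.op .add (.reg 0) (.const 4)) (.op .add (.reg 0) (.const 5))
    (.const 0) (.const 0)

/-- Storing an edge at a terminal for path `i`. -/
def writeSide (i : Bool) : Prog :=
  .ite (usableTerm i)
    (writeEdge (.reg (numberReg i))
      (selectTerm (.op .eq (.reg 17) (.reg (sourceReg i))) (.reg 17) (startTerm i))
      (selectTerm (.op .eq (.reg 18) (.reg (targetReg i))) (.reg 18) (goalTerm i))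
      (.const (!i).toNat) (.const i.toNat))
    (writeDummy i)

/-- Storing the two edges for edge number `reg 11` of the sorted list. -/
def writeFlags : Prog :=
  .ite (.op .or (.reg 25) (.reg 26)) (.seq (writeSide false) (writeSide true))
    (.seq (writeEdge (.reg 29) (.reg 17) (.reg 18) (.reg 27) (.reg 28)) (writeDummy true))

/-- Loading edge number `reg 11` of the sorted list. -/
def loadEdge : Prog :=
  .seq (.assign 16 (.get 8 (.reg 11)))
  (.seq (.assign 17 (.get 0 (.reg 16)))
  (.seq (.assign 18 (.get 1 (.reg 16)))
  (.seq (.assign 19 (.get 2 (.reg 16)))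
  (.seq (.assign 25 (terminalTerm 17))
  (.seq (.assign 26 (terminalTerm 18))
  (.seq (.assign 27 (tightTerm false))
  (.seq (.assign 28 (tightTerm true))
  (.seq (.assign 29 (.op .add (.reg 11) (.reg 11)))
  (.assign 30 (.op .add (.reg 29) (.const 1)))))))))))

open Survey

section

variable {n m : ℕ} {G : WeightedDAG n} {s t : Bool → Fin n} {D : Survey G s m}

/-- The registers describe the instance. -/
structure HasTerminals (n : ℕ) (s t : Bool → Fin n) (σ : State) : Prop where
  size : σ.reg 0 = n
  source : ∀ i, σ.reg (sourceReg i) = s i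
  target : ∀ i, σ.reg (targetReg i) = t i

theorem HasTerminals.congr {σ τ : State} (h : HasTerminals n s t σ)
    (h' : ∀ r < 6, τ.reg r = σ.reg r) : HasTerminals n s t τ :=
  ⟨by rw [h' 0 (by omega), h.size],
    fun i => by rw [h' _ (by cases i <;> simp [sourceReg]), h.source],
    fun i => by rw [h' _ (by cases i <;> simp [targetReg]), h.target]⟩

theorem HasTerminals.decides_terminal {σ : State} (h : HasTerminals n s t σ)
    (c1 : 1 % 2 ^ w = 1) {r v : ℕ} (hr : σ.reg r = v) :
    Decides w σ (terminalTerm r) (IsTerminal s t v) := by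
  have h2 : σ.reg 2 = s false := h.source false
  have h3 : σ.reg 3 = t false := h.target false
  have h4 : σ.reg 4 = s true := h.source true
  have h5 : σ.reg 5 = t true := h.target true
  have key := ((Decides.eq (σ := σ) c1 (x := .reg r) (y := .reg 2) hr h2).or c1
    (Decides.eq c1 (x := .reg r) (y := .reg 3) hr h3)).or c1
    ((Decides.eq c1 (x := .reg r) (y := .reg 4) hr h4).or c1
    (Decides.eq c1 (x := .reg r) (y := .reg 5) hr h5))
  exact key.congr (by simp [IsTerminal, Bool.exists_bool])

theorem HasTerminals.eval_startTerm {σ : State} (h : HasTerminals n s t σ) (hn : n + 6 < 2 ^ w)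
    (i : Bool) : (startTerm i).eval w σ = start n i := by
  cases i
  · simp only [startTerm, Term.eval, Op.apply, h.size, start, Bool.toNat_false, Nat.zero_mod,
      add_zero]
    exact Nat.mod_eq_of_lt (by omega)
  · have c1 : 1 % 2 ^ w = 1 := Nat.mod_eq_of_lt (by omega)
    simp only [startTerm, Term.eval, Op.apply, h.size, start, Bool.toNat_true, c1, if_true]
    exact Nat.mod_eq_of_lt (by omega)

theorem HasTerminals.eval_goalTerm {σ : State} (h : HasTerminals n s t σ) (hn : n + 6 < 2 ^ w)
    (i : Bool) : (goalTerm i).eval w σ = goal s t i := by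
  have c1 : 1 % 2 ^ w = 1 := Nat.mod_eq_of_lt (by omega)
  have hs : start n i ≤ n + 1 := by cases i <;> simp [start]
  have hst := h.eval_startTerm hn i
  have h2 : (Term.op .add (startTerm i) (.const 2)).eval w σ = start n i + 2 := by
    simp only [Term.eval, Op.apply, hst]
    rw [Nat.mod_eq_of_lt (a := 2) (by omega), Nat.mod_eq_of_lt (by omega)]
  rw [goalTerm, eval_selectTerm ((Decides.eq c1 (x := .reg _) (y := .reg _) (h.source i)
    (h.target i)).not c1) hst h2 (by omega) (by omega), goal]
  simp only [Fin.val_inj, ite_not]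

theorem goal_le (i : Bool) : n ≤ goal s t i ∧ goal s t i ≤ n + 3 := by
  cases i <;> simp only [goal, start] <;> split_ifs <;> simp_all <;> omega

/-- Edge number `j` has been loaded. -/
structure Loaded (D : Survey G s m) (t : Bool → Fin n) (j : ℕ) (σ : State) : Prop where
  terminals : HasTerminals n s t σ
  src : σ.reg 17 = D.src j
  dst : σ.reg 18 = D.dst j
  src_terminal : Decides w σ (.reg 25) (IsTerminal s t (D.src j))
  dst_terminal : Decides w σ (.reg 26) (IsTerminal s t (D.dst j))
  tight : ∀ i, Decides w σ (.reg (tightReg i)) (D.TightAt i j)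
  number : ∀ i, σ.reg (numberReg i) = 2 * j + i.toNat

theorem Loaded.congr {j : ℕ} {σ τ : State} (h : Loaded (w := w) D t j σ) (h' : τ.reg = σ.reg) :
    Loaded (w := w) D t j τ := by
  have hD : ∀ {r P}, Decides w σ (.reg r) P → Decides w τ (.reg r) P := fun h => by
    simpa [Decides, Term.eval, h'] using h
  exact ⟨h.terminals.congr fun r _ => by rw [h'], by rw [h', h.src], by rw [h', h.dst],
    hD h.src_terminal, hD h.dst_terminal, fun i => hD (h.tight i), fun i => by rw [h', h.number]⟩

/-- The program stores `f` as edge number `k` and changes nothing else. -/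
def Stores (w : ℕ) (ω : ℕ → ℕ) (p : Prog) (σ : State) (k : ℕ) (f : FlagEdge) : Prop :=
  (sem w ω p σ).reg = σ.reg ∧ EdgeAt (sem w ω p σ) k f ∧
    ∀ j ≠ k, ∀ g, EdgeAt σ j g → EdgeAt (sem w ω p σ) j g

theorem Loaded.dummy {j : ℕ} {σ : State} (h : Loaded (w := w) D t j σ) (hn : n + 6 < 2 ^ w)
    (i : Bool) : Stores w ω (writeDummy i) σ (2 * j + i.toNat)
      ⟨n + 4, n + 5, 0, fun _ => false⟩ := by
  refine edgeAt_writeEdge rfl rfl rfl rfl (h.number i) ?_ ?_ ?_ ?_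
  · simp only [Term.eval, Op.apply, h.terminals.size]
    rw [Nat.mod_eq_of_lt (a := 4) (by omega), Nat.mod_eq_of_lt (by omega)]
  · simp only [Term.eval, Op.apply, h.terminals.size]
    rw [Nat.mod_eq_of_lt (a := 5) (by omega), Nat.mod_eq_of_lt (by omega)]
  · simp [Term.eval]
  · simp [Term.eval]

theorem Loaded.side {j : ℕ} {σ : State} (h : Loaded (w := w) D t j σ) (hn : n + 6 < 2 ^ w)
    (hj : j < m) (hmid : ¬ D.Mid t j) (i : Bool) :
    Stores w ω (writeSide i) σ (2 * j + i.toNat) (D.sideEdge t i j) := by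
  have c1 : 1 % 2 ^ w = 1 := Nat.mod_eq_of_lt (by omega)
  have hu : Decides w σ (usableTerm i) (D.Usable t i j) :=
    (h.tight i).and c1 (((Decides.eq c1 (x := .reg _) (y := .reg _) h.src
      (h.terminals.source i)).or c1 (h.src_terminal.not c1)).and c1
      ((Decides.eq c1 (x := .reg _) (y := .reg _) h.dst (h.terminals.target i)).or c1
        (h.dst_terminal.not c1)))
  have l1 := src_lt (D := D) hj
  have l2 := dst_lt (D := D) hj
  have l3 : n ≤ start n i ∧ start n i ≤ n + 1 := by cases i <;> simp [start]
  have l4 := goal_le (s := s) (t := t) i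
  by_cases hU : D.Usable t i j
  · have e1 : D.sideEdge t i j =
        ⟨tailLabel s i (D.src j), headLabel s t i (D.dst j), D.len j, fun i' => i' == i⟩ := by
      rw [sideEdge, if_pos ⟨hmid, hU⟩]
    have e2 : sem w ω (writeSide i) σ = sem w ω (writeEdge (.reg (numberReg i))
      (selectTerm (.op .eq (.reg 17) (.reg (sourceReg i))) (.reg 17) (startTerm i))
      (selectTerm (.op .eq (.reg 18) (.reg (targetReg i))) (.reg 18) (goalTerm i))
      (.const (!i).toNat) (.const i.toNat)) σ := by
      exact sem_ite_pos _ _ (hu.ne_zero.2 hU)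
    rw [Stores, e1, e2]
    refine edgeAt_writeEdge rfl rfl rfl rfl (h.number i) ?_ ?_ ?_ ?_
    · exact eval_selectTerm (Decides.eq c1 (x := .reg _) (y := .reg _) h.src
        (h.terminals.source i)) h.src (h.terminals.eval_startTerm hn i) (by omega) (by omega)
    · exact eval_selectTerm (Decides.eq c1 (x := .reg _) (y := .reg _) h.dst
        (h.terminals.target i)) h.dst (h.terminals.eval_goalTerm hn i) (by omega) (by omega)
    · cases i <;> simp [Term.eval, c1]
    · cases i <;> simp [Term.eval, c1]
  · have e1 : D.sideEdge t i j = ⟨n + 4, n + 5, 0, fun _ => false⟩ := by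
      rw [sideEdge, if_neg (fun h' => hU h'.2)]
    have e2 : sem w ω (writeSide i) σ = sem w ω (writeDummy i) σ := by
      exact sem_ite_neg _ _ (hu.ne_zero.not.2 hU)
    rw [Stores, e1, e2]
    exact h.dummy hn i

theorem Loaded.writeFlags {j : ℕ} {σ : State} (h : Loaded (w := w) D t j σ) (hn : n + 6 < 2 ^ w)
    (hj : j < m) (hσ : ∀ k < 2 * j, EdgeAt σ k (D.flagEdge t k)) :
    ∀ k < 2 * (j + 1), EdgeAt (sem w ω writeFlags σ) k (D.flagEdge t k) := by
  have c1 : 1 % 2 ^ w = 1 := Nat.mod_eq_of_lt (by omega)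
  have f0 : D.flagEdge t (2 * j) = D.mainEdge t j := by simp [flagEdge]
  have f1 : D.flagEdge t (2 * j + 1) = D.sideEdge t true j := by
    rw [flagEdge, if_neg (by omega), show (2 * j + 1) / 2 = j by omega]
  have comb : ∀ p q, Stores w ω p σ (2 * j) (D.mainEdge t j) →
      Stores w ω q (sem w ω p σ) (2 * j + 1) (D.sideEdge t true j) →
      ∀ k < 2 * (j + 1), EdgeAt (sem w ω (.seq p q) σ) k (D.flagEdge t k) := by
    rintro p q ⟨-, p1, p2⟩ ⟨-, q1, q2⟩ k hk
    rw [sem]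
    by_cases h1 : k = 2 * j + 1
    · subst h1; rw [f1]; exact q1
    · refine q2 k h1 _ ?_
      by_cases h0 : k = 2 * j
      · subst h0; rw [f0]; exact p1
      · exact p2 k h0 _ (hσ k (by omega))
  have hor := h.src_terminal.or c1 h.dst_terminal
  by_cases hmid : D.Mid t j
  · have e1 : sem w ω WordRAM.writeFlags σ = sem w ω (.seq (writeEdge (.reg 29) (.reg 17) (.reg 18)
        (.reg 27) (.reg 28)) (writeDummy true)) σ := by
      exact sem_ite_neg _ _ (hor.ne_zero.not.2 (not_or.2 hmid))
    have hmain : D.mainEdge t j =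
        ⟨D.src j, D.dst j, D.len j, fun i => @decide (D.TightAt i j) (Classical.propDecidable _)⟩ := by
      rw [mainEdge, if_pos hmid]
    have hside : D.sideEdge t true j = ⟨n + 4, n + 5, 0, fun _ => false⟩ := by
      rw [sideEdge, if_neg (fun h' => h'.1 hmid)]
    have tb : ∀ i, (Term.reg (tightReg i)).eval w σ =
        (@decide (D.TightAt i j) (Classical.propDecidable _)).toNat := by
      intro i
      by_cases hP : D.TightAt i j
      · rw [(h.tight i).1 hP]; simp [hP]
      · rw [(h.tight i).2 hP]; simp [hP]
    rw [e1]
    have p1 : Stores w ω (writeEdge (.reg 29) (.reg 17) (.reg 18) (.reg 27) (.reg 28)) σ (2 * j)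
        (D.mainEdge t j) := by
      rw [hmain]
      exact edgeAt_writeEdge rfl rfl rfl rfl (h.number false) h.src h.dst (tb false) (tb true)
    refine comb _ _ p1 ?_
    rw [hside]
    exact (h.congr p1.1).dummy hn true
  · have e1 : sem w ω WordRAM.writeFlags σ = sem w ω (.seq (writeSide false) (writeSide true)) σ := by
      have : IsTerminal s t (D.src j) ∨ IsTerminal s t (D.dst j) := by
        by_contra h'; exact hmid (not_or.1 h')
      exact sem_ite_pos _ _ (hor.ne_zero.2 this)
    have hmain : D.mainEdge t j = D.sideEdge t false j := by rw [mainEdge, if_neg hmid]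
    rw [e1]
    have p1 : Stores w ω (writeSide false) σ (2 * j) (D.mainEdge t j) := by
      rw [hmain]; exact h.side hn hj hmid false
    exact comb _ _ p1 ((h.congr p1.1).side hn hj hmid true)

/-- The distances are available. -/
def HasDist (w : ℕ) (D : Survey G s m) (σ : State) : Prop :=
  ∀ i, Wide w σ (hiArr i) (loArr i) (m + 1) (D.dist i)

/-- Equality of two-word numbers is equality of both words, because low words are below 2^w; the
carry is recovered from the comparison in `add_carry`. -/
theorem HasDist.decides_tight {σ : State} (h : HasDist w D σ) (hm : m + 2 < 2 ^ w) {j : ℕ}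
    (h17 : σ.reg 17 = D.src j) (h18 : σ.reg 18 = D.dst j) (h19 : σ.reg 19 = D.len j)
    (hl : D.len j < 2 ^ w) (i : Bool) : Decides w σ (tightTerm i) (D.TightAt i j) := by
  have c1 : 1 % 2 ^ w = 1 := Nat.mod_eq_of_lt (by omega)
  have hN := h i
  set L := (σ.arr (loArr i) (D.src j) + D.len j) % 2 ^ w with hL
  have hLw : L < 2 ^ w := Nat.mod_lt _ (by positivity)
  have el : (Term.op .add (.get (loArr i) (.reg 17)) (.reg 19)).eval w σ = L := by
    simp only [Term.eval, Op.apply, h17, h19, hL]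
  have eh : (Term.op .add (.get (hiArr i) (.reg 17)) (.op .lt (.op .add (.get (loArr i) (.reg 17))
      (.reg 19)) (.reg 19))).eval w σ = σ.arr (hiArr i) (D.src j) + if L < D.len j then 1 else 0 := by
    have := (Decides.lt c1 el (y := .reg 19) h19).eval_eq
    rw [Term.eval, this]
    simp only [Term.eval, h17, Op.apply]
    have := hN.hi_le (D.src j)
    apply Nat.mod_eq_of_lt; split_ifs <;> omega
  have e0 : (Term.const 0).eval w σ = 0 := by simp [Term.eval]
  have eg : ∀ a r v, σ.reg r = v → (Term.get a (.reg r)).eval w σ = σ.arr a v := fun a r v hv => by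
    simp [Term.eval, hv]
  refine ((Decides.lt c1 e0 (eg (hiArr i) 17 _ h17)).and c1
    ((Decides.eq c1 (eg (hiArr i) 18 _ h18) eh).and c1
      (Decides.eq c1 (eg (loArr i) 18 _ h18) el))).congr ?_
  rw [TightAt, ne_eq, hN.eq_zero, hN.val (D.dst j)]
  have hsum : D.dist i (D.src j) + D.len j =
      (σ.arr (hiArr i) (D.src j) + if L < D.len j then 1 else 0) * 2 ^ w + L := by
    have := add_carry (hN.lo_lt (D.src j)) hl
    rw [← hL] at this
    rw [hN.val, add_mul]; omega
  rw [hsum, lex_eq (hN.lo_lt _) hLw, Nat.pos_iff_ne_zero]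

theorem HasDist.congr {σ τ : State} (h : HasDist w D σ)
    (h' : ∀ i, τ.arr (hiArr i) = σ.arr (hiArr i) ∧ τ.arr (loArr i) = σ.arr (loArr i)) :
    HasDist w D τ := fun i => (h i).congr (h' i).1 (h' i).2

theorem loaded_loadEdge {σ : State} {j : ℕ} (hT : HasTerminals n s t σ) (hD : HasDist w D σ)
    (hm : 2 * m + 2 < 2 ^ w) (hj : j < m) (h11 : σ.reg 11 = j)
    (hu : σ.arr 0 (σ.arr 8 j) = D.src j) (hv : σ.arr 1 (σ.arr 8 j) = D.dst j)
    (hl : σ.arr 2 (σ.arr 8 j) = D.len j) (hlw : D.len j < 2 ^ w) :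
    Loaded (w := w) D t j (sem w ω loadEdge σ) ∧ (sem w ω loadEdge σ).arr = σ.arr := by
  have c1 : 1 % 2 ^ w = 1 := Nat.mod_eq_of_lt (by omega)
  have e1 : (j + j) % 2 ^ w = 2 * j := by rw [Nat.mod_eq_of_lt (by omega)]; omega
  have e2 : (2 * j + 1) % 2 ^ w = 2 * j + 1 := Nat.mod_eq_of_lt (by omega)
  set τ := (((σ.setReg 16 (σ.arr 8 j)).setReg 17 (D.src j)).setReg 18 (D.dst j)).setReg 19
    (D.len j) with hτ
  have t17 : τ.reg 17 = D.src j := by simp [hτ]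
  have t18 : τ.reg 18 = D.dst j := by simp [hτ]
  have t19 : τ.reg 19 = D.len j := by simp [hτ]
  have t11 : τ.reg 11 = j := by simp [hτ, h11]
  have hTτ : HasTerminals n s t τ := hT.congr fun r hr => by
    simp only [hτ, State.setReg_reg]
    rw [if_neg (by omega), if_neg (by omega), if_neg (by omega), if_neg (by omega)]
  have hDτ : HasDist w D τ := hD.congr fun i => ⟨rfl, rfl⟩
  set τ5 := τ.setReg 25 ((terminalTerm 17).eval w τ) with hτ5
  set τ6 := τ5.setReg 26 ((terminalTerm 18).eval w τ5) with hτ6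
  set τ7 := τ6.setReg 27 ((tightTerm false).eval w τ6) with hτ7
  set τ8 := τ7.setReg 28 ((tightTerm true).eval w τ7) with hτ8
  have hs : sem w ω loadEdge σ = (τ8.setReg 29 (2 * j)).setReg 30 (2 * j + 1) := by
    have h1 : sem w ω loadEdge σ = sem w ω (.seq (.assign 25 (terminalTerm 17))
      (.seq (.assign 26 (terminalTerm 18))
      (.seq (.assign 27 (tightTerm false))
      (.seq (.assign 28 (tightTerm true))
      (.seq (.assign 29 (.op .add (.reg 11) (.reg 11)))
      (.assign 30 (.op .add (.reg 29) (.const 1)))))))) τ := by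
      simp only [loadEdge, sem]
      simp [Term.eval, h11, hu, hv, hl, hτ]
    rw [h1]
    simp only [sem, ← hτ5, ← hτ6, ← hτ7, ← hτ8]
    have t8 : τ8.reg 11 = j := by simp [hτ8, hτ7, hτ6, hτ5, t11]
    simp [Term.eval, Op.apply, t8, e1, e2, c1]
  have d5 := hTτ.decides_terminal (w := w) c1 t17
  have d6 : Decides w τ5 (terminalTerm 18) (IsTerminal s t (D.dst j)) :=
    HasTerminals.decides_terminal (hTτ.congr fun r hr => by
      simp only [hτ5, State.setReg_reg]; rw [if_neg (by omega)]) c1 (by simp [hτ5, t18])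
  have d7 : Decides w τ6 (tightTerm false) (D.TightAt false j) :=
    HasDist.decides_tight (hDτ.congr fun i => ⟨rfl, rfl⟩) (by omega) (by simp [hτ6, hτ5, t17])
      (by simp [hτ6, hτ5, t18]) (by simp [hτ6, hτ5, t19]) hlw false
  have d8 : Decides w τ7 (tightTerm true) (D.TightAt true j) :=
    HasDist.decides_tight (hDτ.congr fun i => ⟨rfl, rfl⟩) (by omega)
      (by simp [hτ7, hτ6, hτ5, t17]) (by simp [hτ7, hτ6, hτ5, t18])
      (by simp [hτ7, hτ6, hτ5, t19]) hlw true
  have conv : ∀ {ρ ρ' : State} {x : Term} {r : ℕ} {P : Prop}, Decides w ρ x P →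
      ρ'.reg r = x.eval w ρ → Decides w ρ' (.reg r) P := by
    intro ρ ρ' x r P h h'
    simpa [Decides, Term.eval, h'] using h
  rw [hs]
  refine ⟨⟨?_, ?_, ?_, ?_, ?_, ?_, ?_⟩, rfl⟩
  · refine hTτ.congr fun r hr => ?_
    simp only [hτ8, hτ7, hτ6, hτ5, State.setReg_reg]
    rw [if_neg (by omega), if_neg (by omega), if_neg (by omega), if_neg (by omega),
      if_neg (by omega), if_neg (by omega)]
  · simp [hτ8, hτ7, hτ6, hτ5, t17]
  · simp [hτ8, hτ7, hτ6, hτ5, t18]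
  · exact conv d5 (by simp [hτ8, hτ7, hτ6, hτ5])
  · exact conv d6 (by simp [hτ8, hτ7, hτ6])
  · intro i
    cases i
    · exact conv d7 (by simp [tightReg, hτ8, hτ7])
    · exact conv d8 (by simp [tightReg, hτ8])
  · intro i; cases i <;> simp [numberReg]

/-- Storing the two edges for edge number `reg 11` of the sorted list. -/
def flagStep : Prog := .seq loadEdge writeFlags

/-- Computing the edges with labels as vertices. -/
def flagProg : Prog := forUp 11 1 flagStep

theorem runs_flagProg {σ : State} (hT : HasTerminals n s t σ) (hD : HasDist w D σ)
    (hm : σ.reg 1 = m) (hmw : 2 * m + 2 < 2 ^ w) (hn : n + 6 < 2 ^ w)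
    (hu : ∀ j < m, σ.arr 0 (σ.arr 8 j) = D.src j) (hv : ∀ j < m, σ.arr 1 (σ.arr 8 j) = D.dst j)
    (hl : ∀ j < m, σ.arr 2 (σ.arr 8 j) = D.len j) (hlw : ∀ j < m, D.len j < 2 ^ w) :
    Runs w ω flagProg σ ((m + 1) * (flagStep.maxCost + 8)) (fun τ =>
      ∀ k < 2 * m, EdgeAt τ k (D.flagEdge t k)) := by
  refine Runs.forUp rfl rfl rfl rfl hm (by omega) (fun j τ =>
    ∀ k < 2 * j, EdgeAt τ k (D.flagEdge t k)) (by simp) ?_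
  intro j hj τ hF hr hI
  have f0 : τ.arr 0 = σ.arr 0 := hF.arr 0 rfl
  have f1 : τ.arr 1 = σ.arr 1 := hF.arr 1 rfl
  have f2 : τ.arr 2 = σ.arr 2 := hF.arr 2 rfl
  have f8 : τ.arr 8 = σ.arr 8 := hF.arr 8 rfl
  obtain ⟨h1, h2⟩ := loaded_loadEdge (ω := ω) (σ := τ) (t := t) (D := D) (j := j)
    (hT.congr fun r hr => hF.reg r (by interval_cases r <;> rfl))
    (hD.congr fun i => ⟨hF.arr _ (by cases i <;> rfl), hF.arr _ (by cases i <;> rfl)⟩)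
    hmw hj hr (by rw [f8, f0, hu j hj]) (by rw [f8, f1, hv j hj]) (by rw [f8, f2, hl j hj])
    (hlw j hj)
  have key := h1.writeFlags (ω := ω) hn hj (fun k hk => by
    obtain ⟨a, b, c, d⟩ := hI k hk
    exact ⟨by rw [h2, a], by rw [h2, b], by rw [h2, c], by rw [h2, d]⟩)
  intro k hk
  obtain ⟨a, b, c, d⟩ := key k hk
  exact ⟨a, b, c, d⟩

end

end WordRAM

/-! ### Computing the path sums -/

namespace FlagEdge

variable {K : Type} [Field K]

/-- The recursion of `pathSum` prepends edges, which suits sums to a fixed target. Appending is the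
counterpart for sums from a fixed source; it needs no topological order since paths use edges in
list order. -/
theorem pathSum_concat (i : Bool) (l : List (FlagEdge × K)) (e : FlagEdge × K) (a b : ℕ) :
    pathSum i (l ++ [e]) a b =
      pathSum i l a b + if b = e.1.head then coef i e * pathSum i l a e.1.tail else 0 := by
  induction l generalizing a with
  | nil =>
    simp only [List.nil_append, pathSum]
    by_cases h1 : b = e.1.head <;> by_cases h2 : a = e.1.tail <;> simp [h1, h2, eq_comm]
  | cons f l ih =>
    simp only [List.cons_append, pathSum, ih]
    by_cases h1 : b = e.1.head <;> by_cases h2 : a = f.1.tail <;> simp [h1, h2] <;> ring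

theorem label_map_range (f : ℕ → FlagEdge) (x : ℕ → K) (M : ℕ) :
    label ((List.range M).map f) x = (List.range M).map fun k => (f k, x k) := by
  simp only [label]
  apply List.ext_getElem <;> simp

end FlagEdge

/-! ### Path sums in nim arithmetic on the word RAM -/

namespace WordRAM

open FlagEdge

variable {w : ℕ} {ω : ℕ → ℕ} {K : Type} [Field K] {φ : ℕ → K}

theorem frame_sem {p : Prog} (hp : p.straight = true) (σ : State) : Frame p σ (sem w ω p σ) := by
  obtain ⟨k, -, h⟩ := exec_sem w ω p hp σ
  exact h.frame

/-- The word `x` represents the field element `κ`. -/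
def RepAt (I : ℕ) (φ : ℕ → K) (x : ℕ) (κ : K) : Prop := x < 2 ^ 2 ^ I ∧ φ x = κ

/-- Nimbers with `2 ^ (i + k)` bits form a field and can be multiplied with tables for `2 ^ i`
bits. -/
structure NimContext (w n i k : ℕ) (K : Type) [Field K] (φ : ℕ → K) : Prop where
  table_le : 2 ^ 2 ^ i * (n + 2) ≤ 2 ^ w
  bits_lt : 2 ^ (i + k) < w
  field : IsNimField (i + k) K φ

section

variable {n i k : ℕ} {σ : State} {x y : Term} {κ κ' : K}

theorem NimContext.mul (h : NimContext w n i k K φ) (hT : HasTable n i σ)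
    (hx : RepAt (i + k) φ (x.eval w σ) κ) (hy : RepAt (i + k) φ (y.eval w σ) κ') :
    RepAt (i + k) φ ((mulTerm k x y).eval w σ) (κ * κ') := by
  rw [eval_mulTerm hT h.table_le h.bits_lt.le hx.1 hy.1, ← hx.2, ← hy.2]
  exact ⟨h.field.mul_lt _ hx.1 _ hy.1, h.field.mul _ hx.1 _ hy.1⟩

theorem NimContext.size_lt (h : NimContext w n i k K φ) : 2 ^ 2 ^ (i + k) < 2 ^ w :=
  Nat.pow_lt_pow_right (by norm_num) h.bits_lt

theorem NimContext.xor (h : NimContext w n i k K φ)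
    (hx : RepAt (i + k) φ (x.eval w σ) κ) (hy : RepAt (i + k) φ (y.eval w σ) κ') :
    RepAt (i + k) φ ((Term.op .xor x y).eval w σ) (κ + κ') := by
  have := Nat.xor_lt_two_pow hx.1 hy.1
  have := h.size_lt
  rw [Term.eval, Op.apply, Nat.mod_eq_of_lt (by omega), ← hx.2, ← hy.2]
  exact ⟨Nat.xor_lt_two_pow hx.1 hy.1, h.field.xor _ hx.1 _ hy.1⟩

theorem HasTable.congr {τ : State} (h : HasTable n i σ) (h9 : τ.reg 9 = σ.reg 9)
    (h10 : τ.reg 10 = σ.reg 10) (h3 : τ.arr 3 = σ.arr 3) : HasTable n i τ :=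
  ⟨by rw [h9, h.stride], by rw [h10, h.bits], by rw [h3]; exact h.table⟩

theorem HasTable.frame {p : Prog} {τ : State} (h : HasTable n i σ) (hF : Frame p σ τ)
    (h9 : p.wreg 9 = false) (h10 : p.wreg 10 = false) (h3 : p.warr 3 = false) :
    HasTable n i τ := h.congr (hF.reg 9 h9) (hF.reg 10 h10) (hF.arr 3 h3)

/-- Adding `c[reg j] * a[reg u]` to `a[reg v]`. -/
def addMul (k a c j u v : ℕ) : Prog :=
  .put a (.reg v) (.op .xor (.get a (.reg v)) (mulTerm k (.get c (.reg j)) (.get a (.reg u))))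

theorem rep_addMul (h : NimContext w n i k K φ) (hT : HasTable n i σ) {a c j u v : ℕ} {g : ℕ → K}
    (hg : ∀ x, RepAt (i + k) φ (σ.arr a x) (g x))
    (hc : RepAt (i + k) φ (σ.arr c (σ.reg j)) κ) (x : ℕ) :
    RepAt (i + k) φ ((sem w ω (addMul k a c j u v) σ).arr a x)
      (g x + if x = σ.reg v then κ * g (σ.reg u) else 0) := by
  have key := h.xor (x := .get a (.reg v)) (σ := σ) (hg (σ.reg v))
    (h.mul (x := .get c (.reg j)) (y := .get a (.reg u)) hT hc (hg (σ.reg u)))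
  simp only [addMul, sem, State.setArr_arr, true_and, Term.eval]
  split_ifs with hx
  · rw [hx]; exact key
  · rw [add_zero]; exact hg x

/-- The array with the coefficients of the edges for path `i`. -/
def coefArr (i : Bool) : ℕ := if i then 18 else 17

/-- The array with the path sums from the source of path `i`. -/
def fwdArr (i : Bool) : ℕ := if i then 20 else 19

/-- The array with the path sums to the target of path `i`. -/
def bwdArr (i : Bool) : ℕ := if i then 22 else 21

/-- The array with the flags for path `i`. -/
def flagArr (i : Bool) : ℕ := if i then 16 else 15

/-- Drawing the variable for edge number `reg 11`. -/
def drawStep (k : ℕ) : Prog :=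
  .seq (.rand 16)
  (.seq (.assign 16 (.op .mod (.reg 16) (.op .shl (.const 1) (.op .mul (.reg 10) (.const (2 ^ k))))))
  (.seq (.put (coefArr false) (.reg 11) (.op .mul (.get (flagArr false) (.reg 11)) (.reg 16)))
  (.seq (.put (coefArr true) (.reg 11) (.op .mul (.get (flagArr true) (.reg 11)) (.reg 16)))
  (.seq (.assign 17 (.get 13 (.reg 11)))
  (.assign 18 (.get 14 (.reg 11)))))))

/-- One random word serves both paths on an edge. The same variable for both is what makes the
exchange of pieces preserve the weight. -/
theorem rep_drawStep (h : NimContext w n i k K φ) (hT : HasTable n i σ) {f : FlagEdge}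
    (hf : EdgeAt σ (σ.reg 11) f) :
    (∀ b, RepAt (i + k) φ ((sem w ω (drawStep k) σ).arr (coefArr b) (σ.reg 11))
      (coef b (f, φ (ω σ.pos % 2 ^ 2 ^ (i + k))))) ∧
    (∀ b, ∀ j ≠ σ.reg 11, (sem w ω (drawStep k) σ).arr (coefArr b) j = σ.arr (coefArr b) j) ∧
    (sem w ω (drawStep k) σ).reg 17 = f.tail ∧ (sem w ω (drawStep k) σ).reg 18 = f.head ∧
    (sem w ω (drawStep k) σ).pos = σ.pos + 1 := by
  have hb := h.bits_lt
  have hs := h.size_lt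
  have hww : w < 2 ^ w := Nat.lt_two_pow_self
  have z0 : (0 : ℕ) < 2 ^ 2 ^ (i + k) := by positivity
  have c1 : 1 % 2 ^ w = 1 := Nat.mod_eq_of_lt (by omega)
  have hki : 2 ^ k ≤ 2 ^ (i + k) := Nat.pow_le_pow_right (by norm_num) (by omega)
  have e1 : (2 ^ i * (2 ^ k % 2 ^ w)) % 2 ^ w = 2 ^ (i + k) := by
    rw [Nat.mod_eq_of_lt (a := 2 ^ k) (by omega), ← pow_add, Nat.mod_eq_of_lt (by omega)]
  rw [Nat.mul_mod_mod] at e1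
  have e2 : 2 ^ 2 ^ (i + k) % 2 ^ w = 2 ^ 2 ^ (i + k) := Nat.mod_eq_of_lt hs
  set X := ω σ.pos % 2 ^ 2 ^ (i + k) with hX
  have hXl : X < 2 ^ 2 ^ (i + k) := Nat.mod_lt _ (by positivity)
  have e3 : X % 2 ^ w = X := Nat.mod_eq_of_lt (by omega)
  have e4 : ∀ b : Bool, (b.toNat * X) % 2 ^ w = if b then X else 0 := by
    intro b; cases b <;> simp [e3]
  have hrep : ∀ b, RepAt (i + k) φ (if f.flag b then X else 0) (coef b (f, φ X)) := by
    intro b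
    by_cases hfb : f.flag b = true
    · simp [RepAt, coef, hfb, hXl]
    · simp [RepAt, coef, hfb, h.field.zero]
  have hs : sem w ω (drawStep k) σ = ((((({σ with pos := σ.pos + 1} : State).setReg 16 X).setArr 17 (σ.reg 11)
      (if f.flag false then X else 0)).setArr 18 (σ.reg 11) (if f.flag true then X else 0)).setReg 17
      f.tail).setReg 18 f.head := by
    have g1 := hf.tail
    have g2 := hf.head
    have g3 := hf.flag_false
    have g4 := hf.flag_true
    simp only [drawStep, sem, Term.eval, Op.apply, coefArr, flagArr]
    simp only [State.setReg, State.mk.injEq]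
    simp [c1, g1, g2, g3, g4, hT.bits, e1, e2, ← hX, e3, e4]
  rw [hs]
  refine ⟨fun b => ?_, fun b j hj => ?_, by simp, by simp, by simp⟩
  · cases b <;> simpa [coefArr] using hrep _
  · cases b <;> simp [coefArr, hj]

/-- Drawing the variable for edge number `reg 11` and updating the sums from the sources. -/
def fwdStep (k : ℕ) : Prog :=
  .seq (drawStep k) (.seq (addMul k 19 17 11 17 18) (addMul k 20 18 11 17 18))

/-- Computing the path sums from the sources. -/
def fwdProg (k : ℕ) : Prog := forUp 11 31 (fwdStep k)

/-- The first `M` edges with the variables given by the random words. -/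
def drawn (φ : ℕ → K) (I : ℕ) (ω : ℕ → ℕ) (f : ℕ → FlagEdge) (M : ℕ) : List (FlagEdge × K) :=
  (List.range M).map fun j => (f j, φ (ω j % 2 ^ 2 ^ I))

theorem runs_fwdProg (h : NimContext w n i k K φ) (hT : HasTable n i σ) {f : ℕ → FlagEdge} {M : ℕ}
    (hM : σ.reg 31 = M) (hMw : M < 2 ^ w) (hf : ∀ j < M, EdgeAt σ j (f j)) (hpos : σ.pos = 0)
    {a : Bool → ℕ}
    (ha : ∀ b v, RepAt (i + k) φ (σ.arr (fwdArr b) v) (if a b = v then 1 else 0)) :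
    Runs w ω (fwdProg k) σ ((M + 1) * ((fwdStep k).maxCost + 8)) (fun τ => ∀ b,
      (∀ j < M, RepAt (i + k) φ (τ.arr (coefArr b) j)
        (coef b (f j, φ (ω j % 2 ^ 2 ^ (i + k))))) ∧
      ∀ v, RepAt (i + k) φ (τ.arr (fwdArr b) v)
        (pathSum b (drawn φ (i + k) ω f M) (a b) v)) := by
  -- The tape position belongs to the invariant: exactly one word is drawn per edge, so variable `j`
  -- is the random word number `j`.
  refine (Runs.forUp rfl rfl rfl rfl hM hMw (fun M τ => τ.pos = M ∧ ∀ b,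
      (∀ j < M, RepAt (i + k) φ (τ.arr (coefArr b) j)
        (coef b (f j, φ (ω j % 2 ^ 2 ^ (i + k))))) ∧
      ∀ v, RepAt (i + k) φ (τ.arr (fwdArr b) v)
        (pathSum b (drawn φ (i + k) ω f M) (a b) v)) ?_ ?_).mono le_rfl (fun _ h => h.2)
  · exact ⟨hpos, fun b => ⟨by simp, fun v => ha b v⟩⟩
  · rintro j hj τ hF hr ⟨hp, hI⟩
    have hTτ := hT.frame hF rfl rfl rfl
    have hfj : EdgeAt τ (τ.reg 11) (f j) := by
      obtain ⟨g1, g2, g3, g4⟩ := hf j hj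
      rw [hr]
      exact ⟨by rw [hF.arr 13 rfl, g1], by rw [hF.arr 14 rfl, g2], by rw [hF.arr 15 rfl, g3],
        by rw [hF.arr 16 rfl, g4]⟩
    obtain ⟨d1, d2, d3, d4, d5⟩ := rep_drawStep (ω := ω) h hTτ hfj
    rw [hr] at d1 d2
    rw [hp] at d1 d5
    have F1 := frame_sem (w := w) (ω := ω) (p := drawStep k) rfl τ
    set τ1 := sem w ω (drawStep k) τ
    have F2 := frame_sem (w := w) (ω := ω) (p := addMul k 19 17 11 17 18) rfl τ1
    have r1 : τ1.reg 11 = j := by rw [F1.reg 11 rfl, hr]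
    have T1 := hTτ.frame F1 rfl rfl rfl
    have A1 := rep_addMul (ω := ω) h T1 (a := 19) (c := 17) (j := 11) (u := 17) (v := 18)
      (g := pathSum false (drawn φ (i + k) ω f j) (a false))
      (fun x => by rw [F1.arr 19 rfl]; exact (hI false).2 x) (by rw [r1]; exact d1 false)
    set τ2 := sem w ω (addMul k 19 17 11 17 18) τ1
    have F3 := frame_sem (w := w) (ω := ω) (p := addMul k 20 18 11 17 18) rfl τ2
    have A2 := rep_addMul (ω := ω) h (T1.frame F2 rfl rfl rfl) (a := 20) (c := 18) (j := 11)
      (u := 17) (v := 18) (g := pathSum true (drawn φ (i + k) ω f j) (a true))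
      (fun x => by rw [F2.arr 20 rfl, F1.arr 20 rfl]; exact (hI true).2 x)
      (by rw [F2.reg 11 rfl, F2.arr 18 rfl, r1]; exact d1 true)
    have hfin : sem w ω (fwdStep k) τ = sem w ω (addMul k 20 18 11 17 18) τ2 := rfl
    rw [hfin]
    set τ3 := sem w ω (addMul k 20 18 11 17 18) τ2
    have hd : drawn φ (i + k) ω f (j + 1) =
        drawn φ (i + k) ω f j ++ [(f j, φ (ω j % 2 ^ 2 ^ (i + k)))] := by
      simp [drawn, List.range_succ]
    refine ⟨?_, fun b => ⟨fun j' hj' => ?_, fun v => ?_⟩⟩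
    · rw [State.setReg_pos, F3.pos rfl, F2.pos rfl, d5]
    · have : τ3.arr (coefArr b) j' = τ1.arr (coefArr b) j' := by
        cases b
        · rw [F3.arr _ rfl, F2.arr _ rfl]
        · rw [F3.arr _ rfl, F2.arr _ rfl]
      rw [State.setReg_arr, this]
      by_cases hjj : j' = j
      · subst hjj; exact d1 b
      · rw [d2 b j' hjj]; exact (hI b).1 j' (by omega)
    · rw [State.setReg_arr, hd, pathSum_concat]
      cases b
      · have := A1 v
        rw [d3, d4] at this
        rw [show τ3.arr (fwdArr false) = τ2.arr 19 from F3.arr _ rfl]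
        exact this
      · have := A2 v
        rw [F2.reg 17 rfl, F2.reg 18 rfl, d3, d4] at this
        exact this

/-- Updating the sums to the targets for the edge that is number `reg 11` from the end. -/
def bwdStep (k : ℕ) : Prog :=
  .seq (.assign 16 (.op .sub (.op .sub (.reg 31) (.const 1)) (.reg 11)))
  (.seq (.assign 17 (.get 13 (.reg 16)))
  (.seq (.assign 18 (.get 14 (.reg 16)))
  (.seq (addMul k 21 17 16 18 17) (addMul k 22 18 16 18 17))))

/-- Computing the path sums to the targets. -/
def bwdProg (k : ℕ) : Prog := forUp 11 31 (bwdStep k)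

theorem runs_bwdProg (h : NimContext w n i k K φ) (hT : HasTable n i σ) {f : ℕ → FlagEdge} {M : ℕ}
    (hM : σ.reg 31 = M) (hMw : M < 2 ^ w) (hf : ∀ j < M, EdgeAt σ j (f j)) {x : ℕ → K}
    {t : Bool → ℕ} (hc : ∀ b, ∀ j < M, RepAt (i + k) φ (σ.arr (coefArr b) j) (coef b (f j, x j)))
    (ht : ∀ b v, RepAt (i + k) φ (σ.arr (bwdArr b) v) (if v = t b then 1 else 0)) :
    Runs w ω (bwdProg k) σ ((M + 1) * ((bwdStep k).maxCost + 8)) (fun τ => ∀ b v,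
      RepAt (i + k) φ (τ.arr (bwdArr b) v)
        (pathSum b ((List.range M).map fun j => (f j, x j)) v (t b))) := by
  -- After `j` rounds the arrays hold the sums for the last `j` edges; the next edge is prepended.
  refine (Runs.forUp rfl rfl rfl rfl hM hMw (fun j τ => ∀ b v,
      RepAt (i + k) φ (τ.arr (bwdArr b) v)
        (pathSum b ((List.range' (M - j) j).map fun j => (f j, x j)) v (t b))) ?_ ?_).mono le_rfl
        (fun _ h => ?_)
  · exact fun b v => ht b v
  · rintro j hj τ hF hr hI
    have hTτ := hT.frame hF rfl rfl rfl
    have c1 : 1 % 2 ^ w = 1 := Nat.mod_eq_of_lt (by omega)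
    have e1 : (M + 2 ^ w - 1) % 2 ^ w = M - 1 := sub_mod_eq (by omega) (by omega)
    have e2 : (M - 1 + 2 ^ w - j) % 2 ^ w = M - 1 - j := sub_mod_eq (by omega) (by omega)
    have hMτ : τ.reg 31 = M := by rw [hF.reg 31 rfl, hM]
    obtain ⟨g1, g2, -, -⟩ := hf (M - 1 - j) (by omega)
    set τ1 := ((τ.setReg 16 (M - 1 - j)).setReg 17 (f (M - 1 - j)).tail).setReg 18
      (f (M - 1 - j)).head with hτ1
    have hfin : sem w ω (bwdStep k) τ =
        sem w ω (addMul k 22 18 16 18 17) (sem w ω (addMul k 21 17 16 18 17) τ1) := by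
      simp only [bwdStep, sem, Term.eval, Op.apply]
      simp [hMτ, hr, c1, e1, e2, hF.arr 13 rfl, hF.arr 14 rfl, g1, g2, hτ1]
    have r16 : τ1.reg 16 = M - 1 - j := by simp [hτ1]
    have r17 : τ1.reg 17 = (f (M - 1 - j)).tail := by simp [hτ1]
    have r18 : τ1.reg 18 = (f (M - 1 - j)).head := by simp [hτ1]
    have a1 : τ1.arr = τ.arr := rfl
    have T1 : HasTable n i τ1 := hTτ.congr rfl rfl rfl
    have F2 := frame_sem (w := w) (ω := ω) (p := addMul k 21 17 16 18 17) rfl τ1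
    have A1 := rep_addMul (ω := ω) h T1 (a := 21) (c := 17) (j := 16) (u := 18) (v := 17)
      (g := fun v => pathSum false ((List.range' (M - j) j).map fun j => (f j, x j)) v (t false))
      (fun x => by rw [a1]; exact hI false x)
      (by rw [r16, a1, hF.arr 17 rfl]; exact hc false _ (by omega))
    set τ2 := sem w ω (addMul k 21 17 16 18 17) τ1
    have F3 := frame_sem (w := w) (ω := ω) (p := addMul k 22 18 16 18 17) rfl τ2
    have A2 := rep_addMul (ω := ω) h (T1.frame F2 rfl rfl rfl) (a := 22) (c := 18) (j := 16)
      (u := 18) (v := 17)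
      (g := fun v => pathSum true ((List.range' (M - j) j).map fun j => (f j, x j)) v (t true))
      (fun x => by rw [F2.arr 22 rfl, a1]; exact hI true x)
      (by rw [F2.reg 16 rfl, F2.arr 18 rfl, r16, a1, hF.arr 18 rfl]; exact hc true _ (by omega))
    rw [hfin]
    set τ3 := sem w ω (addMul k 22 18 16 18 17) τ2
    have hd : List.range' (M - (j + 1)) (j + 1) = (M - 1 - j) :: List.range' (M - j) j := by
      rw [List.range'_succ, show M - (j + 1) + 1 = M - j by omega,
        show M - (j + 1) = M - 1 - j by omega]
    intro b v
    rw [State.setReg_arr, hd, List.map_cons, pathSum]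
    cases b
    · have := A1 v
      rw [r17, r18] at this
      rw [show τ3.arr (bwdArr false) = τ2.arr 21 from F3.arr _ rfl]
      exact this
    · have := A2 v
      rw [F2.reg 17 rfl, F2.reg 18 rfl, r17, r18] at this
      exact this
  · rw [List.range_eq_range']
    simpa using h

/-- The product of the entries of two arrays. -/
def pairTerm (k a b : ℕ) (x : Term) : Term := mulTerm k (.get a x) (.get b x)

theorem NimContext.pair (h : NimContext w n i k K φ) (hT : HasTable n i σ) {a b v : ℕ} {x : Term}
    (hx : x.eval w σ = v) (ha : RepAt (i + k) φ (σ.arr a v) κ)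
    (hb : RepAt (i + k) φ (σ.arr b v) κ') :
    RepAt (i + k) φ ((pairTerm k a b x).eval w σ) (κ * κ') := by
  subst hx; exact h.mul hT (x := .get a x) (y := .get b x) ha hb

/-- Adding the contribution of vertex `reg 11`. -/
def vertexStep (k : ℕ) : Prog :=
  .assign 33 (.op .xor (.reg 33) (mulTerm k (pairTerm k 19 20 (.reg 11)) (pairTerm k 21 22 (.reg 11))))

/-- Adding the contribution of edge `reg 11`. -/
def edgeStep (k : ℕ) : Prog :=
  .seq (.assign 17 (.get 13 (.reg 11)))
  (.seq (.assign 18 (.get 14 (.reg 11)))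
  (.assign 33 (.op .xor (.reg 33) (mulTerm k (pairTerm k 19 20 (.reg 17))
    (mulTerm k (pairTerm k 17 18 (.reg 11)) (pairTerm k 21 22 (.reg 18)))))))

/-- Adding up the contributions of vertices and edges. -/
def meetProg (k : ℕ) : Prog := .seq (forUp 11 32 (vertexStep k)) (forUp 11 31 (edgeStep k))

theorem runs_meetProg (h : NimContext w n i k K φ) (hT : HasTable n i σ) {f : ℕ → FlagEdge}
    {M N : ℕ} (hM : σ.reg 31 = M) (hMw : M < 2 ^ w) (hN : σ.reg 32 = N) (hNw : N < 2 ^ w)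
    (hf : ∀ j < M, EdgeAt σ j (f j)) {x : ℕ → K} {p r : Bool → ℕ → K}
    (hc : ∀ b, ∀ j < M, RepAt (i + k) φ (σ.arr (coefArr b) j) (coef b (f j, x j)))
    (hp : ∀ b v, RepAt (i + k) φ (σ.arr (fwdArr b) v) (p b v))
    (hr : ∀ b v, RepAt (i + k) φ (σ.arr (bwdArr b) v) (r b v))
    (h33 : RepAt (i + k) φ (σ.reg 33) κ) :
    Runs w ω (meetProg k) σ
      ((N + 1) * ((vertexStep k).maxCost + 8) + (M + 1) * ((edgeStep k).maxCost + 8)) (fun τ =>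
      RepAt (i + k) φ (τ.reg 33) (κ + meetSum (Finset.range N) r
        ((List.range M).map fun j => (f j, x j)) (p false) (p true))) := by
  have first : Runs w ω (forUp 11 32 (vertexStep k)) σ ((N + 1) * ((vertexStep k).maxCost + 8))
      (fun τ => RepAt (i + k) φ (τ.reg 33)
        (κ + ∑ v ∈ Finset.range N, p false v * p true v * (r false v * r true v))) := by
    refine Runs.forUp rfl rfl rfl rfl hN hNw (fun N τ => RepAt (i + k) φ (τ.reg 33)
      (κ + ∑ v ∈ Finset.range N, p false v * p true v * (r false v * r true v))) ?_ ?_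
    · simpa using h33
    · intro j hj τ hF hrj hI
      have hTτ := hT.frame hF rfl rfl rfl
      have m1 := h.pair hTτ (x := .reg 11) hrj (a := 19) (b := 20)
        (by rw [hF.arr 19 rfl]; exact hp false j) (by rw [hF.arr 20 rfl]; exact hp true j)
      have m2 := h.pair hTτ (x := .reg 11) hrj (a := 21) (b := 22)
        (by rw [hF.arr 21 rfl]; exact hr false j) (by rw [hF.arr 22 rfl]; exact hr true j)
      have m3 := h.xor (x := .reg 33) hI (h.mul hTτ m1 m2)
      rw [Finset.sum_range_succ, ← add_assoc]
      simpa [vertexStep, sem] using m3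
  refine first.frame.seq fun τ ⟨F, hτ⟩ => ?_
  set κ' := κ + ∑ v ∈ Finset.range N, p false v * p true v * (r false v * r true v)
  refine (Runs.forUp (p := edgeStep k) rfl rfl rfl rfl (by rw [F.reg 31 rfl]; exact hM) hMw
    (fun M τ => RepAt (i + k) φ (τ.reg 33) (κ' + (((List.range M).map fun j => (f j, x j)).map
      fun e => p false e.1.tail * p true e.1.tail *
      (coef false e * coef true e * (r false e.1.head * r true e.1.head))).sum)) ?_ ?_).mono le_rfl
      (fun _ h => ?_)
  · simpa using hτ
  · intro j hj υ hF hrj hI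
    have hTυ := (hT.frame F rfl rfl rfl).frame hF rfl rfl rfl
    obtain ⟨g1, g2, -, -⟩ := hf j hj
    set υ1 := (υ.setReg 17 (f j).tail).setReg 18 (f j).head with hυ1
    have T1 : HasTable n i υ1 := hTυ.congr rfl rfl rfl
    have r11 : υ1.reg 11 = j := by simp [hυ1, hrj]
    have r17 : υ1.reg 17 = (f j).tail := by simp [hυ1]
    have r18 : υ1.reg 18 = (f j).head := by simp [hυ1]
    have r33 : υ1.reg 33 = υ.reg 33 := by simp [hυ1]
    have arr : ∀ a, (forUp 11 31 (edgeStep k)).warr a = false →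
        (forUp 11 32 (vertexStep k)).warr a = false → υ1.arr a = σ.arr a := fun a h1 h2 =>
      (hF.arr a h1).trans (F.arr a h2)
    have hs : sem w ω (edgeStep k) υ = sem w ω (.assign 33 (.op .xor (.reg 33)
        (mulTerm k (pairTerm k 19 20 (.reg 17)) (mulTerm k (pairTerm k 17 18 (.reg 11))
        (pairTerm k 21 22 (.reg 18)))))) υ1 := by
      have e13 : υ.arr 13 j = (f j).tail := by rw [hF.arr 13 rfl, F.arr 13 rfl, g1]
      have e14 : υ.arr 14 j = (f j).head := by rw [hF.arr 14 rfl, F.arr 14 rfl, g2]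
      simp only [edgeStep, sem, Term.eval, State.setReg_reg, State.setReg_arr, hrj, e13, e14, hυ1]
      norm_num
      simp [hrj, e14]
    have m1 := h.pair T1 (x := .reg 17) r17 (a := 19) (b := 20)
      (by rw [arr 19 rfl rfl]; exact hp false _) (by rw [arr 20 rfl rfl]; exact hp true _)
    have m2 := h.pair T1 (x := .reg 18) r18 (a := 21) (b := 22)
      (by rw [arr 21 rfl rfl]; exact hr false _) (by rw [arr 22 rfl rfl]; exact hr true _)
    have m3 := h.pair T1 (x := .reg 11) r11 (a := 17) (b := 18)
      (by rw [arr 17 rfl rfl]; exact hc false _ hj) (by rw [arr 18 rfl rfl]; exact hc true _ hj)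
    have m4 := h.xor (x := .reg 33) (σ := υ1) (κ := κ' + _) (by rw [Term.eval, r33]; exact hI)
      (h.mul T1 m1 (h.mul T1 m3 m2))
    rw [hs, List.range_succ]
    simp only [List.map_append, List.map_cons, List.map_nil, List.sum_append, List.sum_cons,
      List.sum_nil, add_zero, ← add_assoc]
    simpa [sem] using m4
  · rw [meetSum, ← add_assoc]; exact h

end

end WordRAM

/-! ### Evaluating the generating function of pairs of disjoint paths -/

namespace WordRAM

open FlagEdge Survey

variable {w : ℕ} {ω : ℕ → ℕ} {K : Type} [Field K] {φ : ℕ → K}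

/-- Preparing the sums from the sources. -/
def startProg : Prog :=
  .seq (.assign 31 (.op .add (.reg 1) (.reg 1)))
  (.seq (.assign 32 (.op .add (.reg 0) (.const 6)))
  (.seq (.put 19 (startTerm false) (.const 1)) (.put 20 (startTerm true) (.const 1))))

/-- Preparing the sums to the targets. -/
def goalProg : Prog :=
  .seq (.put 21 (goalTerm false) (.const 1)) (.put 22 (goalTerm true) (.const 1))

/-- The product of the path sums. -/
def productProg (k : ℕ) : Prog :=
  .assign 33 (mulTerm k (.get 19 (goalTerm false)) (.get 20 (goalTerm true)))

/-- Evaluating the generating function of pairs of disjoint paths in random field elements. -/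
def algebraProg (k : ℕ) : Prog :=
  .seq startProg (.seq (fwdProg k) (.seq goalProg (.seq (bwdProg k)
    (.seq (productProg k) (.seq (meetProg k) (.assign 0 (.reg 33)))))))

/-- The time for the evaluation, up to the size of the graph. -/
def algebraCost (k : ℕ) : ℕ :=
  startProg.maxCost + 2 * ((fwdStep k).maxCost + 8) + goalProg.maxCost +
    2 * ((bwdStep k).maxCost + 8) + (productProg k).maxCost + 8 * ((vertexStep k).maxCost + 8) +
    2 * ((edgeStep k).maxCost + 8) + 2

section

variable {n m i k : ℕ} {G : WeightedDAG n} {s t : Bool → Fin n} {D : Survey G s m} {σ : State}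

theorem HasTerminals.frame {p : Prog} {τ : State} (h : HasTerminals n s t σ) (hF : Frame p σ τ)
    (hp : ∀ r < 6, p.wreg r = false) : HasTerminals n s t τ :=
  h.congr fun r hr => hF.reg r (hp r hr)

theorem EdgeAt.frame {p : Prog} {τ : State} {j : ℕ} {f : FlagEdge} (h : EdgeAt σ j f)
    (hF : Frame p σ τ) (h13 : p.warr 13 = false) (h14 : p.warr 14 = false)
    (h15 : p.warr 15 = false) (h16 : p.warr 16 = false) : EdgeAt τ j f :=
  ⟨by rw [hF.arr 13 h13, h.tail], by rw [hF.arr 14 h14, h.head],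
    by rw [hF.arr 15 h15, h.flag_false], by rw [hF.arr 16 h16, h.flag_true]⟩

/-- The identity of `meetSum_pathSum` solved for the disjoint pairs: the product of the path sums
occurs twice and cancels. The right-hand side is what the machine evaluates. -/
theorem disjointSum_eq_meetSum (two : (1 + 1 : K) = 0) (x : ℕ → K) :
    disjointSum (goal s t) (label (D.flagEdges t) x) (start n false) (start n true) =
      pathSum false (label (D.flagEdges t) x) (start n false) (goal s t false) *
        pathSum true (label (D.flagEdges t) x) (start n true) (goal s t true) +
      meetSum (Finset.range (n + 6))
        (fun b v => pathSum b (label (D.flagEdges t) x) v (goal s t b))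
        (label (D.flagEdges t) x) (pathSum false (label (D.flagEdges t) x) (start n false))
        (pathSum true (label (D.flagEdges t) x) (start n true)) := by
  have mem : ∀ e ∈ label (D.flagEdges t) x, e.1 ∈ D.flagEdges t := by
    intro e he
    obtain ⟨j, hj, rfl⟩ := List.mem_iff_getElem.1 he
    simp [label]
  have hs := sorted_label (K := K) (sortedEdges (D := D) (t := t)) x
  have h := meetSum_pathSum two (goal s t) (Finset.range (n + 6)) (label (D.flagEdges t) x)
    (fun e he => mem_labels (mem e he)) hs
    (allCommuting_of_potential (fun e he => potential_flagEdges (mem e he)) hs)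
    (start n false) (start n true) (by simp [start]) (by simp [start])
  rw [h, ← add_assoc]
  set A := pathSum false (label (D.flagEdges t) x) (start n false) (goal s t false) *
    pathSum true (label (D.flagEdges t) x) (start n true) (goal s t true)
  have : A + A = 0 := by
    have := congrArg (A * ·) two
    simpa [mul_add] using this
  rw [this, zero_add]

theorem runs_algebraProg (h : NimContext w n i k K φ) (hT : HasTable n i σ)
    (hσ : HasTerminals n s t σ) (hm : σ.reg 1 = m) (hpos : σ.pos = 0)
    (hf : ∀ j < 2 * m, EdgeAt σ j (D.flagEdge t j))
    (hz : ∀ a, 19 ≤ a → a ≤ 22 → ∀ v, σ.arr a v = 0)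
    (hn : n + 6 < 2 ^ w) (hn1 : 1 ≤ n) (hmw : 2 * m + 2 < 2 ^ w) :
    Runs w ω (algebraProg k) σ ((m + n) * algebraCost k) (fun τ =>
      RepAt (i + k) φ (τ.reg 0) (disjointSum (goal s t)
        (label (D.flagEdges t) fun j => φ (ω j % 2 ^ 2 ^ (i + k)))
        (start n false) (start n true))) := by
  have c1 : 1 % 2 ^ w = 1 := Nat.mod_eq_of_lt (by omega)
  have rep0 : RepAt (i + k) φ 0 0 := ⟨by positivity, h.field.zero⟩
  have rep1 : RepAt (i + k) φ 1 1 := ⟨Nat.one_lt_two_pow (by positivity), h.field.one⟩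
  have repIf : ∀ (P : Prop) [Decidable P],
      RepAt (i + k) φ (if P then 1 else 0) (if P then 1 else 0) := fun P _ => by
    split_ifs
    · exact rep1
    · exact rep0
  have hl : label (D.flagEdges t) (fun j => φ (ω j % 2 ^ 2 ^ (i + k))) =
      drawn φ (i + k) ω (D.flagEdge t) (2 * m) := label_map_range _ _ _
  have small : ∀ {p : Prog}, (∀ r < 6, p.wreg r = false) ↔ (p.wreg 0 = false ∧ p.wreg 1 = false ∧
      p.wreg 2 = false ∧ p.wreg 3 = false ∧ p.wreg 4 = false ∧ p.wreg 5 = false) := by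
    intro p
    constructor
    · intro h; exact ⟨h 0 (by omega), h 1 (by omega), h 2 (by omega), h 3 (by omega),
        h 4 (by omega), h 5 (by omega)⟩
    · rintro ⟨h0, h1, h2, h3, h4, h5⟩ r hr
      interval_cases r <;> assumption
  -- preparing the sums from the sources
  obtain ⟨τ₁, k₁, x₁, b₁, F₁, p31, p32, p19, p20⟩ := (runs_sem (w := w) (ω := ω) (p := startProg) rfl
    (σ := σ) (Q := fun τ => τ.reg 31 = 2 * m ∧ τ.reg 32 = n + 6 ∧
      (∀ v, τ.arr 19 v = if start n false = v then 1 else 0) ∧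
      ∀ v, τ.arr 20 v = if start n true = v then 1 else 0) (by
    set σ1 := (σ.setReg 31 (2 * m)).setReg 32 (n + 6) with hσ1
    have e1 : (m + m) % 2 ^ w = 2 * m := by rw [Nat.mod_eq_of_lt (by omega)]; omega
    have e2 : (n + 6 % 2 ^ w) % 2 ^ w = n + 6 := by
      rw [Nat.mod_eq_of_lt (a := 6) (by omega), Nat.mod_eq_of_lt (by omega)]
    have t1 : HasTerminals n s t σ1 := hσ.congr fun r hr => by
      simp only [hσ1, State.setReg_reg]; rw [if_neg (by omega), if_neg (by omega)]
    have hs : sem w ω startProg σ = (σ1.setArr 19 (start n false) 1).setArr 20 (start n true) 1 := by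
      have t2 : HasTerminals n s t (σ1.setArr 19 (start n false) 1) := t1.congr fun r hr => rfl
      have q1 := t1.eval_startTerm hn false
      have q2 := t2.eval_startTerm hn true
      have : sem w ω startProg σ = sem w ω (.seq (.put 19 (startTerm false) (.const 1))
          (.put 20 (startTerm true) (.const 1))) σ1 := by
        simp only [startProg, sem]
        simp [Term.eval, Op.apply, hm, hσ.size, e1, hσ1]
        rw [← Nat.add_mod_mod, e2]
      rw [this]
      simp only [sem, q1, Term.eval, c1, q2]
    rw [hs]
    refine ⟨by simp [hσ1], by simp [hσ1], fun v => ?_, fun v => ?_⟩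
    · simp [hσ1, hz 19, eq_comm]
    · simp [hσ1, hz 20, eq_comm])).frame
  have T₁ := hT.frame F₁ rfl rfl rfl
  have S₁ := hσ.frame F₁ (small.2 ⟨rfl, rfl, rfl, rfl, rfl, rfl⟩)
  have E₁ := fun j hj => (hf j hj).frame F₁ rfl rfl rfl rfl
  -- the sums from the sources
  obtain ⟨τ₂, k₂, x₂, b₂, F₂, h₂⟩ := (runs_fwdProg (ω := ω) (a := start n) h T₁ p31 (by omega) E₁
    (by rw [F₁.pos rfl, hpos]) (fun b v => by
      cases b
      · exact (congrArg (RepAt (i + k) φ · _) (p19 v)).mpr (repIf _)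
      · exact (congrArg (RepAt (i + k) φ · _) (p20 v)).mpr (repIf _))).frame
  have T₂ := T₁.frame F₂ rfl rfl rfl
  have S₂ := S₁.frame F₂ (small.2 ⟨rfl, rfl, rfl, rfl, rfl, rfl⟩)
  have E₂ := fun j hj => (E₁ j hj).frame F₂ rfl rfl rfl rfl
  -- preparing the sums to the targets
  obtain ⟨τ₃, k₃, x₃, b₃, F₃, p21, p22⟩ := (runs_sem (w := w) (ω := ω) (p := goalProg) rfl (σ := τ₂)
    (Q := fun τ => (∀ v, τ.arr 21 v = if v = goal s t false then 1 else 0) ∧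
      ∀ v, τ.arr 22 v = if v = goal s t true then 1 else 0) (by
    have t2 : HasTerminals n s t (τ₂.setArr 21 (goal s t false) 1) := S₂.congr fun r hr => rfl
    have q1 := S₂.eval_goalTerm hn false
    have q2 := t2.eval_goalTerm hn true
    have z : ∀ a, 21 ≤ a → a ≤ 22 → ∀ v, τ₂.arr a v = 0 := by
      intro a h1 h2 v
      interval_cases a
      · rw [F₂.arr 21 rfl, F₁.arr 21 rfl, hz 21 (by omega) (by omega)]
      · rw [F₂.arr 22 rfl, F₁.arr 22 rfl, hz 22 (by omega) (by omega)]
    simp only [goalProg, sem, q1, Term.eval, c1, q2]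
    refine ⟨fun v => ?_, fun v => ?_⟩
    · simp [z 21]
    · simp [z 22])).frame
  have T₃ := T₂.frame F₃ rfl rfl rfl
  have S₃ := S₂.frame F₃ (small.2 ⟨rfl, rfl, rfl, rfl, rfl, rfl⟩)
  have E₃ := fun j hj => (E₂ j hj).frame F₃ rfl rfl rfl rfl
  have C₃ : ∀ b, ∀ j < 2 * m, RepAt (i + k) φ (τ₃.arr (coefArr b) j)
      (coef b (D.flagEdge t j, φ (ω j % 2 ^ 2 ^ (i + k)))) := fun b j hj => by
    rw [F₃.arr _ (by cases b <;> rfl)]; exact (h₂ b).1 j hj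
  -- the sums to the targets
  obtain ⟨τ₄, k₄, x₄, b₄, F₄, h₄⟩ := (runs_bwdProg (ω := ω) (t := goal s t) h T₃
    (by rw [F₃.reg 31 rfl, F₂.reg 31 rfl, p31]) (by omega) E₃ C₃ (fun b v => by
      cases b
      · exact (congrArg (RepAt (i + k) φ · _) (p21 v)).mpr (repIf _)
      · exact (congrArg (RepAt (i + k) φ · _) (p22 v)).mpr (repIf _))).frame
  have T₄ := T₃.frame F₄ rfl rfl rfl
  have S₄ := S₃.frame F₄ (small.2 ⟨rfl, rfl, rfl, rfl, rfl, rfl⟩)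
  have E₄ := fun j hj => (E₃ j hj).frame F₄ rfl rfl rfl rfl
  have L₄ : ∀ b v, RepAt (i + k) φ (τ₄.arr (fwdArr b) v)
      (pathSum b (drawn φ (i + k) ω (D.flagEdge t) (2 * m)) (start n b) v) := fun b v => by
    rw [F₄.arr _ (by cases b <;> rfl), F₃.arr _ (by cases b <;> rfl)]; exact (h₂ b).2 v
  -- the product
  obtain ⟨τ₅, k₅, x₅, b₅, F₅, h₅⟩ := (runs_sem (w := w) (ω := ω) (p := productProg k) rfl (σ := τ₄)
    (Q := fun τ => RepAt (i + k) φ (τ.reg 33)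
      (pathSum false (drawn φ (i + k) ω (D.flagEdge t) (2 * m)) (start n false) (goal s t false) *
        pathSum true (drawn φ (i + k) ω (D.flagEdge t) (2 * m)) (start n true) (goal s t true))) (by
    have q1 := S₄.eval_goalTerm hn false
    have q2 := S₄.eval_goalTerm hn true
    have := h.mul T₄ (x := .get 19 (goalTerm false)) (y := .get 20 (goalTerm true))
      (by rw [Term.eval, q1]; exact L₄ false _) (by rw [Term.eval, q2]; exact L₄ true _)
    simpa [productProg, sem] using this)).frame
  -- the sum over meetings
  obtain ⟨τ₆, k₆, x₆, b₆, h₆⟩ := runs_meetProg (ω := ω) h (T₄.frame F₅ rfl rfl rfl)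
    (M := 2 * m) (N := n + 6)
    (p := fun b => pathSum b (drawn φ (i + k) ω (D.flagEdge t) (2 * m)) (start n b))
    (r := fun b v => pathSum b (drawn φ (i + k) ω (D.flagEdge t) (2 * m)) v (goal s t b))
    (by rw [F₅.reg 31 rfl, F₄.reg 31 rfl, F₃.reg 31 rfl, F₂.reg 31 rfl, p31]) (by omega)
    (by rw [F₅.reg 32 rfl, F₄.reg 32 rfl, F₃.reg 32 rfl, F₂.reg 32 rfl, p32]) hn
    (fun j hj => (E₄ j hj).frame F₅ rfl rfl rfl rfl)
    (fun b j hj => by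
      rw [F₅.arr _ (by cases b <;> rfl), F₄.arr _ (by cases b <;> rfl)]; exact C₃ b j hj)
    (fun b v => by rw [F₅.arr _ (by cases b <;> rfl)]; exact L₄ b v)
    (fun b v => by rw [F₅.arr _ (by cases b <;> rfl)]; exact h₄ b v) h₅
  refine ⟨_, _, x₁.seq (x₂.seq (x₃.seq (x₄.seq (x₅.seq (x₆.seq (.assign 0 (.reg 33) τ₆)))))), ?_, ?_⟩
  · have g1 : 1 ≤ m + n := by omega
    have g2 : 2 * m + 1 ≤ (m + n) * 2 := by omega
    have g7 : n + 6 + 1 ≤ (m + n) * 8 := by omega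
    have u1 := Nat.mul_le_mul_right startProg.maxCost g1
    have u2 := Nat.mul_le_mul_right ((fwdStep k).maxCost + 8) g2
    have u3 := Nat.mul_le_mul_right goalProg.maxCost g1
    have u4 := Nat.mul_le_mul_right ((bwdStep k).maxCost + 8) g2
    have u5 := Nat.mul_le_mul_right (productProg k).maxCost g1
    have u6 := Nat.mul_le_mul_right ((vertexStep k).maxCost + 8) g7
    have u7 := Nat.mul_le_mul_right ((edgeStep k).maxCost + 8) g2
    have u8 := Nat.mul_le_mul_right 2 g1
    have e : (m + n) * algebraCost k = (m + n) * startProg.maxCost +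
        (m + n) * 2 * ((fwdStep k).maxCost + 8) + (m + n) * goalProg.maxCost +
        (m + n) * 2 * ((bwdStep k).maxCost + 8) + (m + n) * (productProg k).maxCost +
        (m + n) * 8 * ((vertexStep k).maxCost + 8) + (m + n) * 2 * ((edgeStep k).maxCost + 8) +
        (m + n) * 2 := by
      rw [algebraCost]; ring
    have e' : (Term.reg 33).cost = 1 := rfl
    rw [e, e']
    linarith
  · rw [disjointSum_eq_meetSum h.field.two, hl]
    simp only [Function.update_self, Term.eval]
    exact h₆

end

end WordRAM

/-! ### The preparation -/

namespace WordRAM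

open FlagEdge Survey

/-- Sorting the edges, computing the distances and the edges with labels as vertices. -/
def prepareProg : Prog :=
  .seq tableProg (.seq (.assign 12 (.const 0)) (.seq adjacencyProg (.seq queueProg (.seq kahnProg
    (.seq (distProg 2 9 10) (.seq (distProg 4 11 12) flagProg))))))

/-- The time for the preparation, up to the size of the graph. -/
def prepareCost : ℕ :=
  13 * tableCost + 2 + (adjacencyStep.maxCost + 8) + 2 * (queueStep.maxCost + 8) + 2 * kahnCost +
    ((distStep 9 10).maxCost + 11) + ((distStep 11 12).maxCost + 11) + (flagStep.maxCost + 8)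

theorem add_le_mul_add {n m c₁ c₂ c₃ c₄ c₅ c₆ c₇ k₁ k₂ k₃ k₄ k₅ k₆ k₇ k₈ : ℕ} (hn : 1 ≤ n)
    (h₁ : k₁ ≤ (2 * (n + 5) + 1) * c₁) (h₂ : k₂ ≤ 2) (h₃ : k₃ ≤ (m + 1) * (c₂ + 8))
    (h₄ : k₄ ≤ (n + 1) * (c₃ + 8)) (h₅ : k₅ ≤ (m + n + 1) * c₄)
    (h₆ : k₆ ≤ (m + 1) * (c₅ + 8) + 3) (h₇ : k₇ ≤ (m + 1) * (c₆ + 8) + 3)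
    (h₈ : k₈ ≤ (m + 1) * (c₇ + 8)) :
    k₁ + (k₂ + (k₃ + (k₄ + (k₅ + (k₆ + (k₇ + k₈)))))) ≤
      (m + n) * (13 * c₁ + 2 + (c₂ + 8) + 2 * (c₃ + 8) + 2 * c₄ + (c₅ + 11) + (c₆ + 11) +
        (c₇ + 8)) := by
  have g2 : m + 1 ≤ m + n := by omega
  have u1 := Nat.mul_le_mul_right c₁ (show 2 * (n + 5) + 1 ≤ (m + n) * 13 by omega)
  have u2 := Nat.mul_le_mul_right (c₂ + 8) g2
  have u3 := Nat.mul_le_mul_right (c₃ + 8) (show n + 1 ≤ (m + n) * 2 by omega)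
  have u4 := Nat.mul_le_mul_right c₄ (show m + n + 1 ≤ (m + n) * 2 by omega)
  have u5 := Nat.mul_le_mul_right (c₅ + 8) g2
  have u6 := Nat.mul_le_mul_right (c₆ + 8) g2
  have u7 := Nat.mul_le_mul_right (c₇ + 8) g2
  linarith

variable {w : ℕ} {ω : ℕ → ℕ} {n m : ℕ} {G : WeightedDAG n} {s : Bool → Fin n}

/-- The data that the preparation provides. -/
structure Prepared (D : Survey G s m) (t : Bool → Fin n) (i : ℕ) (τ : State) : Prop where
  table : HasTable n i τ
  terminals : HasTerminals n s t τ
  edges : τ.reg 1 = m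
  pos : τ.pos = 0
  edgeAt : ∀ j < 2 * m, EdgeAt τ j (D.flagEdge t j)
  zero : ∀ a, 19 ≤ a → a ≤ 22 → ∀ v, τ.arr a v = 0

/-- The sources, or the targets, of the two paths. -/
def pick (a b : Fin n) (i : Bool) : Fin n := if i then b else a

theorem acyclic_of_transGen {f g : ℕ → ℕ}
    (h : ∀ e < m, ∃ u v : Fin n, G.graph.Adj u v ∧ f e = u ∧ g e = v) (v : ℕ) :
    ¬ Relation.TransGen (fun u v => ∃ e < m, f e = u ∧ g e = v) v v := by
  have key : ∀ a b, Relation.TransGen (fun u v => ∃ e < m, f e = u ∧ g e = v) a b →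
      ∃ u v : Fin n, a = u ∧ b = v ∧ Relation.TransGen G.graph.Adj u v := by
    intro a b hab
    induction hab with
    | single hb =>
      obtain ⟨e, he, rfl, rfl⟩ := hb
      obtain ⟨u, v, huv, hu, hv⟩ := h e he
      exact ⟨u, v, hu, hv, .single huv⟩
    | tail _ hbc ih =>
      obtain ⟨u, v, hu, hv, huv⟩ := ih
      obtain ⟨e, he, h1, h2⟩ := hbc
      obtain ⟨u', v', huv', hu', hv'⟩ := h e he
      obtain rfl : v = u' := Fin.ext (by omega)
      exact ⟨u, v', hu, by omega, huv.tail huv'⟩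
  intro hv
  obtain ⟨u, u', h1, h2, h3⟩ := key v v hv
  obtain rfl : u = u' := Fin.ext (by omega)
  exact G.acyclic u h3

theorem runs_prepareProg (e : Fin m ≃ G.Edge) (s₁ t₁ s₂ t₂ : Fin n)
    (hwt : ∀ u v, G.graph.Adj u v → G.weight u v < 2 ^ w) (hn1 : 1 ≤ n)
    (hn : (n + 2) ^ 4 ≤ 2 ^ w) (hn6 : n + 6 < 2 ^ w) (hmw : 2 * m + 2 < 2 ^ w) :
    Runs w ω prepareProg (input G e s₁ t₁ s₂ t₂) ((m + n) * prepareCost) (fun τ =>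
      ∃ (D : Survey G (pick s₁ s₂) m) (i : ℕ), Prepared D (pick t₁ t₂) i τ ∧
        n < 2 ^ (2 ^ i * 4) ∧ (i = 0 ∨ 2 ^ (2 ^ i * 2) ≤ n)) := by
  set σ := input G e s₁ t₁ s₂ t₂ with hσ
  set tl := σ.arr 0 with htl
  set hd := σ.arr 1 with hhd
  have arr0 : ∀ a, 3 ≤ a → ∀ v, σ.arr a v = 0 := by
    intro a ha v
    obtain ⟨a, rfl⟩ := Nat.exists_eq_add_of_le' ha
    simp [hσ, input]
  have hedge : ∀ j < m, ∃ u v : Fin n, G.graph.Adj u v ∧ tl j = u ∧ hd j = v ∧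
      σ.arr 2 j = G.weight u v := by
    intro j hj
    refine ⟨(e ⟨j, hj⟩).1.1, (e ⟨j, hj⟩).1.2, (e ⟨j, hj⟩).2, ?_, ?_, ?_⟩ <;>
      simp [htl, hhd, hσ, input, hj]
  have hsurj : ∀ u v : Fin n, G.graph.Adj u v → ∃ j < m, tl j = u ∧ hd j = v := by
    intro u v huv
    refine ⟨e.symm ⟨(u, v), huv⟩, (e.symm ⟨(u, v), huv⟩).2, ?_, ?_⟩ <;>
      simp [htl, hhd, hσ, input]
  have hT : HasTerminals n (pick s₁ s₂) (pick t₁ t₂) σ :=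
    ⟨rfl, fun i => by cases i <;> rfl, fun i => by cases i <;> rfl⟩
  obtain ⟨τ₁, k₁, x₁, b₁, F₁, i, T₁, hi₁, hi₂⟩ :=
    (runs_tableProg (w := w) (ω := ω) (σ := σ) (n := n) rfl hn1 hn (arr0 3 le_rfl)).frame
  -- Register 12 was a loop bound while the table was built and must be cleared before it counts the
  -- queue.
  obtain ⟨τ₂, k₂, x₂, b₂, F₂, h₂⟩ := (Runs.assign (w := w) (ω := ω) 12 (.const 0) τ₁).frame
  obtain ⟨τ₃, k₃, x₃, b₃, F₃, h₃, h₃', h₃''⟩ :=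
    (runs_adjacencyProg (w := w) (ω := ω) (σ := τ₂) (m := m)
      (by rw [F₂.reg 1 rfl, F₁.reg 1 rfl]; rfl) (by omega)
      (by rw [F₂.arr 4 rfl, F₁.arr 4 rfl]; exact arr0 4 (by omega))
      (by rw [F₂.arr 6 rfl, F₁.arr 6 rfl]; exact arr0 6 (by omega))).frame
  rw [F₂.arr 0 rfl, F₁.arr 0 rfl] at h₃ h₃'
  rw [F₂.arr 1 rfl, F₁.arr 1 rfl] at h₃''
  obtain ⟨τ₄, k₄, x₄, b₄, F₄, h₄⟩ := (runs_queueProg (w := w) (ω := ω) (σ := τ₃) (n := n) (m := m)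
    (tl := tl) (hd := hd) (ord := τ₃.arr 8)
    (by rw [F₃.reg 0 rfl, F₂.reg 0 rfl, F₁.reg 0 rfl]; rfl) (by omega)
    (by rw [F₃.reg 12 rfl, h₂]; simp [Term.eval]) h₃'').frame
  obtain ⟨τ₅, k₅, x₅, b₅, F₅, o1, o2, o3, o4⟩ := (runs_kahnProg (w := w) (ω := ω) (σ := τ₄) (n := n)
    (m := m) (tl := tl) (hd := hd) (by omega) (by omega)
    (by rw [F₄.arr 1 rfl, F₃.arr 1 rfl, F₂.arr 1 rfl, F₁.arr 1 rfl])
    (fun j hj => by obtain ⟨u, v, -, hu, -⟩ := hedge j hj; omega)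
    (fun j hj => by obtain ⟨u, v, -, -, hv, -⟩ := hedge j hj; omega)
    (acyclic_of_transGen (G := G) fun j hj => by
      obtain ⟨u, v, h1, h2, h3, -⟩ := hedge j hj; exact ⟨u, v, h1, h2, h3⟩)
    (by rw [F₄.arr 4 rfl]; exact h₃) (by rw [F₄.arr 5 rfl]; exact h₃')
    (by rw [F₄.arr 6 rfl]; exact h₃'')
    (by rw [F₄.reg 13 rfl, F₃.reg 13 rfl, F₂.reg 13 rfl, F₁.reg 13 rfl]; rfl)
    (by rw [F₄.reg 14 rfl, F₃.reg 14 rfl, F₂.reg 14 rfl, F₁.reg 14 rfl]; rfl)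
    (by rw [F₄.reg 15 rfl, F₃.reg 15 rfl, F₂.reg 15 rfl, F₁.reg 15 rfl]; rfl)
    (by rw [F₄.arr 8 rfl]; exact h₄)).frame
  set ord := τ₅.arr 8 with hord
  have A₅ : ∀ a < 3, τ₅.arr a = σ.arr a := by
    intro a ha
    interval_cases a
    · rw [F₅.arr 0 rfl, F₄.arr 0 rfl, F₃.arr 0 rfl, F₂.arr 0 rfl, F₁.arr 0 rfl]
    · rw [F₅.arr 1 rfl, F₄.arr 1 rfl, F₃.arr 1 rfl, F₂.arr 1 rfl, F₁.arr 1 rfl]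
    · rw [F₅.arr 2 rfl, F₄.arr 2 rfl, F₃.arr 2 rfl, F₂.arr 2 rfl, F₁.arr 2 rfl]
  have Z₅ : ∀ a, 9 ≤ a → ∀ v, τ₅.arr a v = 0 := by
    intro a ha v
    have ne : ∀ b < 9, (a == b) = false := fun b hb => by
      rw [beq_eq_false_iff_ne]; omega
    have wa : tableProg.warr a = false ∧ adjacencyProg.warr a = false ∧ queueProg.warr a = false ∧
        kahnProg.warr a = false := by
      simp [tableProg, tableStep, tableCell, adjacencyProg, adjacencyStep, queueProg, queueStep,
        kahnProg, kahnEdge, kahnVertex, forUp, Prog.warr, ne]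
    rw [F₅.arr a wa.2.2.2, F₄.arr a wa.2.2.1, F₃.arr a wa.2.1, F₂.arr a rfl, F₁.arr a wa.1]
    exact arr0 a (by omega) v
  have R₅ : ∀ r < 6, τ₅.reg r = σ.reg r := by
    intro r hr
    interval_cases r
    all_goals
      rw [F₅.reg _ rfl, F₄.reg _ rfl, F₃.reg _ rfl, F₂.reg _ rfl, F₁.reg _ rfl]
  have edge : ∀ j < m, ∃ u v : Fin n, G.graph.Adj u v ∧ tl (ord j) = u ∧ hd (ord j) = v ∧
      σ.arr 2 (ord j) = G.weight u v := fun j hj => hedge _ (o1 j hj)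
  have surj : ∀ u v : Fin n, G.graph.Adj u v → ∃ j < m, tl (ord j) = u ∧ hd (ord j) = v := by
    intro u v huv
    obtain ⟨f, hf, h1, h2⟩ := hsurj u v huv
    obtain ⟨j, hj, rfl⟩ := o2 f hf
    exact ⟨j, hj, h1, h2⟩
  -- Kahn's order puts each edge into a tail strictly earlier. If edge `j` entered the tail of edge
  -- `i` with i ≤ j, it would also occur at a position before `i`, against injectivity.
  have sorted : ∀ i j, i ≤ j → j < m → hd (ord j) ≠ tl (ord i) := by
    intro i j hij hj h
    obtain ⟨j', hj', h'⟩ := o4 i (by omega) (ord j) (o1 j hj) h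
    have := o3 j' (by omega) j hj h'
    omega
  have lenw : ∀ j < m, σ.arr 2 (ord j) < 2 ^ w := by
    intro j hj
    obtain ⟨u, v, huv, -, -, h⟩ := edge j hj
    rw [h]; exact hwt u v huv
  let D : Survey G (pick s₁ s₂) m :=
    { src := fun j => tl (ord j)
      dst := fun j => hd (ord j)
      len := fun j => σ.arr 2 (ord j)
      -- The offset matches the initial high word 1 at the source.
      base := 2 ^ w
      dist := fun b => relaxUpTo (pick s₁ s₂ b) (2 ^ w) (fun j => tl (ord j)) (fun j => hd (ord j))
        (fun j => σ.arr 2 (ord j)) m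
      edge := edge
      surj := surj
      sorted := sorted
      isDist := fun b => isDist_relaxUpTo _ (by positivity) edge surj sorted }
  obtain ⟨τ₆, k₆, x₆, b₆, F₆, h₆⟩ := (runs_distProg (w := w) (ω := ω) (r := 2) (hi := 9) (lo := 10)
    (m := m) (σ := τ₅) (src := D.src) (dst := D.dst) (len := D.len) (by norm_num)
    (by rw [R₅ 1 (by omega)]; rfl) (by omega) rfl rfl rfl rfl (Z₅ 9 (by omega)) (Z₅ 10 (by omega))
    (fun j _ => by rw [A₅ 0 (by omega)]) (fun j _ => by rw [A₅ 1 (by omega)])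
    (fun j _ => by rw [A₅ 2 (by omega)]) lenw).frame
  have A₆ : ∀ a, a < 3 ∨ a = 8 → τ₆.arr a = τ₅.arr a := by
    rintro a (ha | rfl)
    · interval_cases a <;> exact F₆.arr _ rfl
    · exact F₆.arr _ rfl
  have R₆ : ∀ r < 6, τ₆.reg r = σ.reg r := by
    intro r hr
    rw [← R₅ r hr]
    interval_cases r <;> exact F₆.reg _ rfl
  obtain ⟨τ₇, k₇, x₇, b₇, F₇, h₇⟩ := (runs_distProg (w := w) (ω := ω) (r := 4) (hi := 11) (lo := 12)
    (m := m) (σ := τ₆) (src := D.src) (dst := D.dst) (len := D.len) (by norm_num)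
    (by rw [R₆ 1 (by omega)]; rfl) (by omega) rfl rfl rfl rfl
    (by rw [F₆.arr 11 rfl]; exact Z₅ 11 (by omega)) (by rw [F₆.arr 12 rfl]; exact Z₅ 12 (by omega))
    (fun j _ => by rw [A₆ 0 (by omega), A₆ 8 (by omega), A₅ 0 (by omega)])
    (fun j _ => by rw [A₆ 1 (by omega), A₆ 8 (by omega), A₅ 1 (by omega)])
    (fun j _ => by rw [A₆ 2 (by omega), A₆ 8 (by omega), A₅ 2 (by omega)]) lenw).frame
  have A₇ : ∀ a, a < 3 ∨ a = 8 → τ₇.arr a = τ₅.arr a := by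
    intro a ha
    rw [← A₆ a ha]
    rcases ha with ha | rfl
    · interval_cases a <;> exact F₇.arr _ rfl
    · exact F₇.arr _ rfl
  have R₇ : ∀ r < 6, τ₇.reg r = σ.reg r := by
    intro r hr
    rw [← R₆ r hr]
    interval_cases r <;> exact F₇.reg _ rfl
  have hdist : HasDist w D τ₇ := by
    intro b
    cases b
    · rw [R₅ 2 (by omega)] at h₆
      have h9 : τ₇.arr 9 = τ₆.arr 9 := F₇.arr 9 rfl
      have h10 : τ₇.arr 10 = τ₆.arr 10 := F₇.arr 10 rfl
      exact h₆.congr h9 h10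
    · rw [R₆ 4 (by omega)] at h₇
      exact h₇
  obtain ⟨τ₈, k₈, x₈, b₈, F₈, h₈⟩ := (runs_flagProg (w := w) (ω := ω) (σ := τ₇) (D := D)
    (t := pick t₁ t₂) (hT.congr R₇) hdist (by rw [R₇ 1 (by omega)]; rfl) hmw hn6
    (fun j _ => by rw [A₇ 0 (by omega), A₇ 8 (by omega), A₅ 0 (by omega)])
    (fun j _ => by rw [A₇ 1 (by omega), A₇ 8 (by omega), A₅ 1 (by omega)])
    (fun j _ => by rw [A₇ 2 (by omega), A₇ 8 (by omega), A₅ 2 (by omega)]) lenw).frame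
  have R₈ : ∀ r < 6, τ₈.reg r = σ.reg r := by
    intro r hr
    rw [← R₇ r hr]
    interval_cases r <;> exact F₈.reg _ rfl
  have T₅ := (((T₁.frame F₂ rfl rfl rfl).frame F₃ rfl rfl rfl).frame F₄ rfl rfl rfl).frame F₅
    rfl rfl rfl
  refine ⟨τ₈, _, x₁.seq (x₂.seq (x₃.seq (x₄.seq (x₅.seq (x₆.seq (x₇.seq x₈)))))), ?_, D, i,
    ⟨?_, hT.congr R₈, by rw [R₈ 1 (by omega)]; rfl, ?_, h₈, ?_⟩, hi₁, hi₂⟩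
  · exact add_le_mul_add hn1 b₁ b₂ b₃ b₄ b₅ b₆ b₇ b₈
  · exact ((T₅.frame F₆ rfl rfl rfl).frame F₇ rfl rfl rfl).frame F₈ rfl rfl rfl
  · rw [F₈.pos rfl, F₇.pos rfl, F₆.pos rfl, F₅.pos rfl, F₄.pos rfl, F₃.pos rfl, F₂.pos rfl,
      F₁.pos rfl]
    rfl
  · intro a h1 h2 v
    rw [← Z₅ a (by omega) v]
    interval_cases a
    all_goals
      rw [F₈.arr _ rfl, F₇.arr _ rfl, F₆.arr _ rfl]

end WordRAM

/-! ### The algorithm -/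

open FlagEdge Survey

theorem succ_pow_le_two_pow {n c w : ℕ} (h : c * (Nat.log 2 n + 1) ≤ w) :
    (n + 1) ^ c ≤ 2 ^ w := by
  have h1 : n + 1 ≤ 2 ^ (Nat.log 2 n + 1) := Nat.lt_pow_succ_log_self (by norm_num) n
  calc (n + 1) ^ c ≤ (2 ^ (Nat.log 2 n + 1)) ^ c := Nat.pow_le_pow_left h1 c
    _ = 2 ^ (c * (Nat.log 2 n + 1)) := by rw [← pow_mul, mul_comm]
    _ ≤ 2 ^ w := Nat.pow_le_pow_right (by norm_num) h

theorem WeightedDAG.card_edge_le {n m : ℕ} {G : WeightedDAG n} (e : Fin m ≃ G.Edge) :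
    m ≤ n * n := by
  have := Fintype.card_le_of_injective (fun j => (e j).1)
    (Subtype.val_injective.comp e.injective)
  simpa using this

/-- As q divides the number of words, reduction modulo q keeps the distribution uniform: a word with
given residue is determined by its quotient. -/
theorem card_fiber_mod_mul_le {K : Type} {φ : ℕ → K} {q W : ℕ} (hq : 0 < q) (hW : q ∣ W)
    (inj : ∀ x < q, ∀ y < q, φ x = φ y → x = y) [DecidableEq K] (κ : K) :
    (Finset.univ.filter fun y : Fin W => φ (y % q) = κ).card * q ≤ Fintype.card (Fin W) := by
  obtain ⟨c, rfl⟩ := hW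
  rw [Fintype.card_fin]
  refine (Nat.mul_le_mul_right q ?_).trans_eq (mul_comm c q)
  have := Finset.card_le_card_of_injOn (t := Finset.range c) (fun y : Fin (q * c) => (y : ℕ) / q)
    (s := Finset.univ.filter fun y : Fin (q * c) => φ (y % q) = κ)
    (fun y _ => by simpa using Nat.div_lt_of_lt_mul y.2) (fun y hy z hz hyz => ?_)
  · simpa using this
  · simp only [Finset.coe_filter, Finset.mem_univ, true_and, Set.mem_ofPred_eq] at hy hz
    have h := inj _ (Nat.mod_lt y hq) _ (Nat.mod_lt z hq) (hy.trans hz.symm)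
    refine Fin.ext ?_
    rw [← Nat.div_add_mod y q, ← Nat.div_add_mod z q, h]
    congr 2

namespace WordRAM

/-- The program that decides whether there are two disjoint shortest paths. -/
def disjointPathsProg (k : ℕ) : Prog := .seq prepareProg (algebraProg k)

/-- The table size gives 2^i < 2(⌊log₂ n⌋ + 1). After d + 4 doublings a field element has fewer than
2^(d+5)(⌊log₂ n⌋ + 1) bits, which is where the constant in the word length comes from. -/
theorem nimContext {n i d w : ℕ} {K : Type} [Field K] {φ : ℕ → K} (hn : 1 ≤ n)
    (hw : 2 ^ (d + 5) * (Nat.log 2 n + 1) ≤ w) (hnw : (n + 2) ^ 4 ≤ 2 ^ w)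
    (hi : i = 0 ∨ 2 ^ (2 ^ i * 2) ≤ n) (hφ : IsNimField (i + (d + 4)) K φ) :
    NimContext w n i (d + 4) K φ := by
  have hp : 0 < 2 ^ (d + 4) := by positivity
  have h5 : 2 ^ (d + 5) = 2 * 2 ^ (d + 4) := by rw [pow_succ 2 (d + 4)]; ring
  refine ⟨?_, ?_, hφ⟩
  · have h1 : 2 ^ 2 ^ i ≤ n + 1 := by
      rcases hi with rfl | hi
      · simpa using hn
      · exact ((Nat.pow_le_pow_right (by norm_num) (by omega)).trans hi).trans (by omega)
    calc 2 ^ 2 ^ i * (n + 2) ≤ (n + 2) * (n + 2) := Nat.mul_le_mul_right _ (by omega)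
      _ = (n + 2) ^ 2 := by ring
      _ ≤ (n + 2) ^ 4 := Nat.pow_le_pow_right (by omega) (by norm_num)
      _ ≤ 2 ^ w := hnw
  · have h1 : 2 ^ i < 2 * (Nat.log 2 n + 1) := by
      rcases hi with rfl | hi
      · simp; omega
      · have := Nat.le_log_of_pow_le (by norm_num) hi
        omega
    calc 2 ^ (i + (d + 4)) = 2 ^ i * 2 ^ (d + 4) := pow_add _ _ _
      _ < 2 * (Nat.log 2 n + 1) * 2 ^ (d + 4) := Nat.mul_lt_mul_of_pos_right h1 hp
      _ = 2 ^ (d + 5) * (Nat.log 2 n + 1) := by rw [h5]; ring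
      _ ≤ w := hw

/-- There are 2m variables with m ≤ n², so a field with (n + 1)^(d+3) elements is large enough. The
table loop stopped with 2^(4 · 2^i) > n, and d + 4 doublings raise this number to the power 2^(d+2)
≥ d + 3. -/
theorem two_mul_mul_pow_le {n m i d : ℕ} (hm : m ≤ n * n) (hn : 1 ≤ n)
    (hi : n < 2 ^ (2 ^ i * 4)) : 2 * m * n ^ d ≤ 2 ^ 2 ^ (i + (d + 4)) := by
  have e : 2 ^ 2 ^ (i + (d + 4)) = (2 ^ (2 ^ i * 4)) ^ 2 ^ (d + 2) := by
    rw [← pow_mul]; congr 1; ring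
  have hd : d + 3 ≤ 2 ^ (d + 2) := Nat.lt_two_pow_self (n := d + 2)
  calc 2 * m * n ^ d ≤ (n + 1) * ((n + 1) * (n + 1)) * (n + 1) ^ d := by
        refine Nat.mul_le_mul (Nat.mul_le_mul (by omega) (hm.trans ?_))
          (Nat.pow_le_pow_left (by omega) d)
        exact Nat.mul_le_mul (by omega) (by omega)
    _ = (n + 1) ^ (d + 3) := by ring
    _ ≤ (n + 1) ^ 2 ^ (d + 2) := Nat.pow_le_pow_right (by omega) hd
    _ ≤ (2 ^ (2 ^ i * 4)) ^ 2 ^ (d + 2) := Nat.pow_le_pow_left hi _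
    _ = _ := e.symm

open Classical in
theorem acceptProb_eq {w : ℕ} {p : Prog} {σ : State} {R : ℕ}
    {F : (Fin R → Fin (2 ^ w)) → Prop} (h : ∀ ω, Accepts w p σ (tape ω) ↔ ¬ F ω) :
    acceptProb w p σ R =
      1 - ((Finset.univ.filter F).card : ℝ) / (Fintype.card (Fin (2 ^ w)) ^ R : ℕ) := by
  have hT : Fintype.card (Fin R → Fin (2 ^ w)) = Fintype.card (Fin (2 ^ w)) ^ R := by simp
  have hpos : (0 : ℝ) < (Fintype.card (Fin (2 ^ w)) ^ R : ℕ) := by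
    rw [Fintype.card_fin]; positivity
  have h1 : Fintype.card {ω : Fin R → Fin (2 ^ w) // Accepts w p σ (tape ω)} +
      (Finset.univ.filter F).card = Fintype.card (Fin (2 ^ w)) ^ R := by
    rw [Fintype.card_subtype, ← hT, ← Finset.card_univ, add_comm,
      ← Finset.card_filter_add_card_filter_not (s := Finset.univ) F]
    congr 2
    ext ω
    simp [h]
  rw [acceptProb, hT, eq_sub_iff_add_eq, ← add_div, div_eq_one_iff_eq hpos.ne']
  exact_mod_cast h1

end WordRAM

open WordRAM

theorem theorem2 (d : ℕ) :
    ∃ (p : WordRAM.Prog) (c C : ℕ), 2 ≤ c ∧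
      ∀ (n m : ℕ) (G : WeightedDAG n) (e : Fin m ≃ G.Edge) (s₁ t₁ s₂ t₂ : Fin n) (w : ℕ),
        c * (Nat.log 2 n + 1) ≤ w →
        (∀ u v, G.graph.Adj u v → G.weight u v < 2 ^ w) →
        (∀ ω : ℕ → Fin (2 ^ w),
          WordRAM.HaltsWithin w p (WordRAM.input G e s₁ t₁ s₂ t₂) (C * (m + n))
            (fun i => (ω i : ℕ))) ∧
        (G.HasTwoDSP s₁ t₁ s₂ t₂ →
          1 - 1 / (n : ℝ) ^ d ≤
            WordRAM.acceptProb w p (WordRAM.input G e s₁ t₁ s₂ t₂) (C * (m + n))) ∧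
        (¬ G.HasTwoDSP s₁ t₁ s₂ t₂ →
          WordRAM.acceptProb w p (WordRAM.input G e s₁ t₁ s₂ t₂) (C * (m + n)) = 0) := by
  classical
  -- The summand 2 in the time constant ensures that the probability space has at least 2m random
  -- words, one for each variable. Since 2^(d+5) ≥ 32, a word also has room for (n + 1)^32.
  refine ⟨disjointPathsProg (d + 4), 2 ^ (d + 5), prepareCost + algebraCost (d + 4) + 2, ?_, ?_⟩
  · have := Nat.one_le_two_pow (n := d + 4)
    rw [pow_succ]; omega
  intro n m G e s₁ t₁ s₂ t₂ w hw hwt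
  set C := prepareCost + algebraCost (d + 4) + 2 with hC
  set σ := input G e s₁ t₁ s₂ t₂
  have hn1 : 1 ≤ n := by have := s₁.2; omega
  have hmn : m ≤ n * n := WeightedDAG.card_edge_le e
  have hpow : (n + 1) ^ 32 ≤ 2 ^ w := by
    have h32 : 32 ≤ 2 ^ (d + 5) := by
      rw [pow_add]; have := Nat.one_le_two_pow (n := d); omega
    exact succ_pow_le_two_pow ((Nat.mul_le_mul_right _ h32).trans hw)
  have h4 : (n + 1) ^ 4 ≤ 2 ^ w := (Nat.pow_le_pow_right (by omega) (by norm_num)).trans hpow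
  have hn4 : (n + 2) ^ 4 ≤ 2 ^ w := by
    refine le_trans ?_ ((Nat.pow_le_pow_right (by omega) (show 8 ≤ 32 by norm_num)).trans hpow)
    calc (n + 2) ^ 4 ≤ ((n + 1) ^ 2) ^ 4 := Nat.pow_le_pow_left (by nlinarith) 4
      _ = (n + 1) ^ 8 := by rw [← pow_mul]
  have h4' : 4 * ((n + 1) * (n + 1)) ≤ (n + 1) ^ 4 := by
    have : (n + 1) ^ 4 = ((n + 1) * (n + 1)) * ((n + 1) * (n + 1)) := by ring
    rw [this]
    exact Nat.mul_le_mul_right _ (show 4 ≤ (n + 1) * (n + 1) by nlinarith)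
  have hn6 : n + 6 < 2 ^ w := by nlinarith
  have hmw : 2 * m + 2 < 2 ^ w := by nlinarith
  -- The preparation draws no random words, so it is run on an arbitrary tape. The survey, the table
  -- size and the field are thereby fixed before the random words are quantified.
  obtain ⟨τ, k₀, x₀, b₀, D, i, hτ, hi₁, hi₂⟩ := runs_prepareProg (w := w) (ω := fun _ => 0) e
    s₁ t₁ s₂ t₂ hwt hn1 hn4 hn6 hmw
  obtain ⟨K, _, φ, hφ⟩ := exists_isNimField (i + (d + 4))
  have hctx := nimContext hn1 hw hn4 hi₂ hφ
  set q := 2 ^ 2 ^ (i + (d + 4)) with hq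
  set V : (ℕ → K) → K := fun x => disjointSum (goal (pick s₁ s₂) (pick t₁ t₂))
    (label (D.flagEdges (pick t₁ t₂)) x) (start n false) (start n true) with hV
  have main : ∀ ω : ℕ → ℕ, Runs w ω (disjointPathsProg (d + 4)) σ (C * (m + n)) fun υ =>
      RepAt (i + (d + 4)) φ (υ.reg 0) (V fun j => φ (ω j % q)) := by
    intro ω
    obtain ⟨υ, k, x, b, h⟩ := runs_algebraProg (ω := ω) hctx hτ.table hτ.terminals hτ.edges hτ.pos
      hτ.edgeAt hτ.zero hn6 hn1 hmw
    refine ⟨υ, _, (x₀.congr_tape rfl ω).seq x, (Nat.add_le_add b₀ b).trans ?_, h⟩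
    rw [← mul_add, mul_comm]
    exact Nat.mul_le_mul_right _ (Nat.le_add_right _ _)
  have accept : ∀ ω : Fin (C * (m + n)) → Fin (2 ^ w),
      Accepts w (disjointPathsProg (d + 4)) σ (tape ω) ↔
        ¬ V (sample (fun y : Fin (2 ^ w) => φ (y % q)) ω) = 0 := by
    intro ω
    have hsample : (fun j => φ (tape ω j % q)) = sample (fun y : Fin (2 ^ w) => φ (y % q)) ω := by
      funext j
      simp only [tape, sample]
      split_ifs
      · rfl
      · rw [Nat.zero_mod, hφ.zero]
    obtain ⟨υ, k, x, -, h1, h2⟩ := main (tape ω)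
    rw [← hsample, ← h2]
    -- The answer is a word while the generating function is a field element; injectivity of `φ` on
    -- words below q identifies their zeros.
    have hz : φ (υ.reg 0) = 0 ↔ υ.reg 0 = 0 :=
      ⟨fun h => hφ.inj _ h1 _ (by positivity) (h.trans hφ.zero.symm), fun h => by rw [h, hφ.zero]⟩
    rw [hz]
    constructor
    · rintro ⟨υ', k', x', h'⟩
      rwa [x.deterministic x']
    · exact fun h' => ⟨υ, k, x, h'⟩
  have linked : Linked (goal (pick s₁ s₂) (pick t₁ t₂)) (D.flagEdges (pick t₁ t₂))
      (start n false) (start n true) ↔ G.HasTwoDSP s₁ t₁ s₂ t₂ := linked_iff_hasTwoDSP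
  refine ⟨fun ω => ?_, fun h => ?_, fun h => ?_⟩
  · obtain ⟨υ, k, x, b, -⟩ := main fun i => (ω i : ℕ)
    exact ⟨υ, k, x, b⟩
  · rw [acceptProb_eq accept]
    have hlen : (D.flagEdges (pick t₁ t₂)).length = 2 * m := by simp [flagEdges]
    have hR : (D.flagEdges (pick t₁ t₂)).length ≤ C * (m + n) := by
      rw [hlen]; exact Nat.mul_le_mul (by omega) (by omega)
    have hfib := card_fiber_mod_mul_le (W := 2 ^ w) (φ := φ) (q := q) (by positivity)
      (pow_dvd_pow 2 hctx.bits_lt.le) hφ.inj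
    have hcard := card_disjointSum_eq_zero_mul_le (fun y : Fin (2 ^ w) => φ (y % q)) q
      (fun κ => by convert hfib κ) _ _ _ hR _ _ (linked.2 h)
    rw [hlen] at hcard
    have hmnq : 2 * m * n ^ d ≤ q := two_mul_mul_pow_le hmn hn1 hi₁
    set Z := (Finset.univ.filter fun ω : Fin (C * (m + n)) → Fin (2 ^ w) =>
      V (sample (fun y : Fin (2 ^ w) => φ (y % q)) ω) = 0).card with hZ
    set T := Fintype.card (Fin (2 ^ w)) ^ (C * (m + n)) with hT
    have hcard' : Z * q ≤ 2 * m * T := by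
      rw [hZ]; convert hcard
    have hZT : Z * n ^ d ≤ T := by
      have hq0 : 0 < q := by positivity
      refine Nat.le_of_mul_le_mul_left ?_ hq0
      calc q * (Z * n ^ d) = Z * q * n ^ d := by ring
        _ ≤ 2 * m * T * n ^ d := Nat.mul_le_mul_right _ hcard'
        _ = 2 * m * n ^ d * T := by ring
        _ ≤ q * T := Nat.mul_le_mul_right _ hmnq
    have hT0 : (0 : ℝ) < (T : ℕ) := by
      rw [hT, Fintype.card_fin]; positivity
    have hn0 : (0 : ℝ) < (n : ℝ) ^ d := by positivity
    have : (Z : ℝ) / (T : ℕ) ≤ 1 / (n : ℝ) ^ d := by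
      rw [div_le_div_iff₀ hT0 hn0, one_mul]
      exact_mod_cast hZT
    linarith
  · have hempty : IsEmpty {ω : Fin (C * (m + n)) → Fin (2 ^ w) //
        Accepts w (disjointPathsProg (d + 4)) σ (tape ω)} := by
      refine ⟨fun ω => h (linked.1 ?_)⟩
      exact linked_of_disjointSum_ne_zero ((accept ω.1).1 ω.2)
    rw [acceptProb, Fintype.card_eq_zero, Nat.cast_zero, zero_div]
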